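/- **Setting.** Let $(M^{n+1},g)$ be a smooth Riemannian manifold with Levi-Civita connection $\nabla$ and curvature tensor $R(X,Y)Z=\nabla_X\nabla_YZ-\nabla_Y\nabla_XZ-\nabla_{[X,Y]}Z$, let $p\in M$, and let $E_1,\dots,E_{n+1}$ be an orthonormal basis of $T_pM$, which identifies $T_pM$ with $\mathbb R^{n+1}$ and its unit sphere with $S^n$. Let $F(x)=\exp_p(x_iE_i)$ and $X_i=F_*\partial_{x_i}$. For $\rho>0$, $w\in C^2(S^n)$ and a local parametrization $z\mapsto\Theta(z)$ of $S^n$, put $w(z)=w(\Theta(z))$, $G(z)=F(\rho(1-w(z))\Theta(z))$; the image of $G$ is the perturbed geodesic sphere $S_\rho(p,w)$. Write $\Theta_i=\partial_{z^i}\Theta$, $w_i=\partial_{z^i}w$, $w_{ij}=\partial_{z^i}\partial_{z^j}w$, $Z_i=G_*\partial_{z^i}$, $\Upsilon=\Theta^jX_j$. Let $N=\tilde N/g(\tilde N,\tilde N)^{1/2}$, where $\tilde N=-\Upsilon+A^jZ_j$ is orthogonal to all $Z_i$, be the unit normal of $S_\rho(p,w)$. The parametrization is assumed to satisfy, at the point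 $z$ under consideration, $\langle\Theta_i,\Theta_j\rangle=\delta_{ij}$ and $\overline\nabla_{\Theta_i}\Theta_j=0$, where $\overline\nabla$ is the Levi-Civita connection of $S^n$; at this point $\nabla w=\sum_kw_k\Theta_k$. **Proposition.** Let $K\subset M$ be compact, $0<\delta<1$ and $\Lambda>0$. There is $\rho_0>0$ such that for all $p\in K$, all orthonormal bases $E$ of $T_pM$, all $\rho\in(0,\rho_0)$, and all $w$, $\Theta$, $z$ as above with $|w|\le\delta$ and $|\nabla w|\le\Lambda$ at $\Theta(z)$, one has at $z$, for $1\le i,j\le n$, $$ \begin{aligned} -g(\nabla_{Z_i}N,Z_j)={}&\rho(1-w)\delta_{ij}+\rho\,w_{ij}+\tfrac23\,g(R(\Theta,\Theta_i)\Theta,\Theta_j)\,\rho^3(1-w)^3\\ &+\tfrac5{12}\,g(\nabla_\Theta R(\Theta,\Theta_i)\Theta,\Theta_j)\,\rho^4(1-w)^4\\ &-\tfrac13\big(g(R(\nabla w,\Theta_i)\Theta_j,\Theta)+g(R(\Theta,\Theta_i)\Theta_j,\nabla w)\big)\rho^3\\ &+\mathcal O(\rho^5)+\rho^4L^1(w)+\rho\,Q^1(w)+\rho\,L^2(w)\ltimes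 Q^1(w), \end{aligned} $$ with all curvature terms evaluated at $p$. The error terms (for each $i,j$) are as follows. Their coefficients are smooth functions of $\Theta\in S^n$ and of the orthonormal basis $(\Theta_1,\dots,\Theta_n)$ of $T_\Theta S^n$. They depend on $p,E,\rho$ but not on $w$, and every derivative of them is bounded by a constant that does not depend on $p\in K$, $E$ or $\rho\in(0,\rho_0)$. * $\mathcal O(\rho^5)$ is a smooth function each of whose derivatives is bounded by such a constant times $\rho^5$. * $L^j(w)$ is a linear combination of $w$ and its derivatives of order at most $j$, with such coefficients. * $Q^1(w)$ is a smooth function of $\Theta$, the basis $(\Theta_k)$, $w$ and the $w_k$ on the range $|w|\le\delta$, $|\nabla w|\le\Lambda$. All its derivatives are bounded by such constants, and it vanishes together with its first derivative in $(w,w_k)$ at $(w,w_k)=0$. * $L^2(w)\ltimes Q^1(w)$ is a finite sum, with a number of terms independent of $p,E,\rho$, of products of an operator of type $L^2$ and one of type $Q^1$. -/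

import Mathlib

open Set Metric Bundle Matrix
open scoped Manifold ContDiff

noncomputable section

namespace SmallSpheres

/-- Euclidean space `ℝ^m`. -/
abbrev V (m : ℕ) : Type := EuclideanSpace ℝ (Fin m)

/-- The coordinate vector `∂_a` of `ℝ^m`. -/
def coordVec {m : ℕ} (a : Fin m) : V m := EuclideanSpace.single a (1 : ℝ)

/-- The partial derivative `∂_a f (x)`. -/
def pd {m : ℕ} {W : Type*} [NormedAddCommGroup W] [NormedSpace ℝ W]
    (a : Fin m) (f : V m → W) (x : V m) : W :=
  fderiv ℝ f x (coordVec a)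

/-! ### Riemannian geometry in coordinates

`h` is a field of metric coefficients on (an open part of) `ℝ^m`. -/

section Coordinates

variable {m : ℕ}

/-- `g(u, v)` at the point with coordinates `x`. -/
def ip (h : V m → Matrix (Fin m) (Fin m) ℝ) (x u v : V m) : ℝ :=
  ∑ a, ∑ b, h x a b * u a * v b

/-- The Christoffel symbol `Γ^k_{ab}` of the Levi-Civita connection. -/
def christoffel (h : V m → Matrix (Fin m) (Fin m) ℝ) (k a b : Fin m) (x : V m) : ℝ :=
  (1 / 2) * ∑ l, (h x)⁻¹ k l *
    (pd a (fun y => h y b l) x + pd b (fun y => h y a l) x - pd l (fun y => h y a b) x)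

/-- The component `R^d` of `R(∂_a, ∂_b) ∂_c`, for
`R(X, Y) Z = ∇_X ∇_Y Z - ∇_Y ∇_X Z - ∇_{[X, Y]} Z`. -/
def riemannUp (h : V m → Matrix (Fin m) (Fin m) ℝ) (a b c d : Fin m) (x : V m) : ℝ :=
  pd a (christoffel h d b c) x - pd b (christoffel h d a c) x
    + ∑ e, (christoffel h d a e x * christoffel h e b c x
        - christoffel h d b e x * christoffel h e a c x)

/-- `g(R(∂_a, ∂_b) ∂_c, ∂_d)`. -/
def riemann (h : V m → Matrix (Fin m) (Fin m) ℝ) (a b c d : Fin m) (x : V m) : ℝ :=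
  ∑ e, h x d e * riemannUp h a b c e x

/-- `g((∇_{∂_e} R)(∂_a, ∂_b) ∂_c, ∂_d)`. -/
def nablaRiemann (h : V m → Matrix (Fin m) (Fin m) ℝ) (e a b c d : Fin m) (x : V m) : ℝ :=
  pd e (riemann h a b c d) x
    - ∑ f, (christoffel h f e a x * riemann h f b c d x
        + christoffel h f e b x * riemann h a f c d x
        + christoffel h f e c x * riemann h a b f d x
        + christoffel h f e d x * riemann h a b c f x)

/-- `g(R(s, t) u, v)` for tangent vectors `s, t, u, v` at `x`. -/
def curv (h : V m → Matrix (Fin m) (Fin m) ℝ) (x s t u v : V m) : ℝ :=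
  ∑ a, ∑ b, ∑ c, ∑ d, riemann h a b c d x * s a * t b * u c * v d

/-- `g((∇_r R)(s, t) u, v)` for tangent vectors `r, s, t, u, v` at `x`. -/
def nablaCurv (h : V m → Matrix (Fin m) (Fin m) ℝ) (x r s t u v : V m) : ℝ :=
  ∑ e, ∑ a, ∑ b, ∑ c, ∑ d, nablaRiemann h e a b c d x * r e * s a * t b * u c * v d

/-- For a parametrised submanifold `y` and a vector field `N` along it, the covariant derivative
`∇_{Z_i} N` along `y`, where `Z_i = y_* ∂_{z^i}`. -/
def covAlong {n : ℕ} (h : V m → Matrix (Fin m) (Fin m) ℝ) (y N : V n → V m) (i : Fin n)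
    (z : V n) : V m :=
  WithLp.toLp 2 fun k => pd i N z k
    + ∑ a, ∑ b, christoffel h k a b (y z) * pd i y z a * N z b

/-- The first fundamental form `g(Z_i, Z_j)` of a parametrised submanifold `y`. -/
def firstFF {n : ℕ} (h : V m → Matrix (Fin m) (Fin m) ℝ) (y : V n → V m) (z : V n) :
    Matrix (Fin n) (Fin n) ℝ :=
  Matrix.of fun i j => ip h (y z) (pd i y z) (pd j y z)

/-- `Ñ = - Υ + ∑ A^j Z_j`, the coefficients `A^j` being such that `Ñ` is orthogonal to all `Z_i`,
that is `∑_j A^j g(Z_j, Z_i) = g(Υ, Z_i)`. -/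
def preNormal {n : ℕ} (h : V m → Matrix (Fin m) (Fin m) ℝ) (y Υ : V n → V m) (z : V n) : V m :=
  - Υ z + ∑ j, ((firstFF h y z)⁻¹ *ᵥ fun i => ip h (y z) (Υ z) (pd i y z)) j • pd j y z

/-- The unit normal `N = Ñ / g(Ñ, Ñ)^{1/2}`, on the side opposite to `Υ`. -/
def unitNormal {n : ℕ} (h : V m → Matrix (Fin m) (Fin m) ℝ) (y Υ : V n → V m) (z : V n) : V m :=
  (Real.sqrt (ip h (y z) (preNormal h y Υ z) (preNormal h y Υ z)))⁻¹ • preNormal h y Υ z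

/-- The second fundamental form `- g(∇_{Z_i} N, Z_j)`. -/
def secondFF {n : ℕ} (h : V m → Matrix (Fin m) (Fin m) ℝ) (y Υ : V n → V m) (i j : Fin n)
    (z : V n) : ℝ :=
  - ip h (y z) (covAlong h y (unitNormal h y Υ) i z) (pd j y z)

end Coordinates

/-! ### Geodesics, the exponential map and normal coordinates on a Riemannian manifold -/

section Manifold

variable {m : ℕ} {M : Type*} [TopologicalSpace M] [ChartedSpace (V m) M] [IsManifold (𝓡 m) ∞ M]

/-- The coefficients `g(φ_* ∂_a, φ_* ∂_b)` of the metric in a local parametrization `φ` of `M`. -/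
def metricIn (g : ContMDiffRiemannianMetric (𝓡 m) ∞ (V m) (fun q : M => TangentSpace (𝓡 m) q))
    (φ : V m → M) (x : V m) : Matrix (Fin m) (Fin m) ℝ :=
  Matrix.of fun a b => g.inner (φ x) (mfderiv (𝓡 m) (𝓡 m) φ x (coordVec a))
    (mfderiv (𝓡 m) (𝓡 m) φ x (coordVec b))

/-- `c` is a geodesic on the open set `s` of times: it is of class `C^2` and, in the chart of `M` at
`c t`, satisfies `u'' ^ k + Γ^k_{ab}(u) u' ^ a u' ^ b = 0` at `t`, for each `t` in `s`. -/
structure IsGeodesicOn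
    (g : ContMDiffRiemannianMetric (𝓡 m) ∞ (V m) (fun q : M => TangentSpace (𝓡 m) q))
    (c : ℝ → M) (s : Set ℝ) : Prop where
  smooth : ContMDiffOn 𝓘(ℝ, ℝ) (𝓡 m) 2 c s
  equation : ∀ t ∈ s, ∀ k : Fin m,
    deriv (deriv fun τ => extChartAt (𝓡 m) (c t) (c τ)) t k
      + ∑ a, ∑ b, christoffel (metricIn g (extChartAt (𝓡 m) (c t)).symm) k a b
            (extChartAt (𝓡 m) (c t) (c t))
          * deriv (fun τ => extChartAt (𝓡 m) (c t) (c τ)) t a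
          * deriv (fun τ => extChartAt (𝓡 m) (c t) (c τ)) t b = 0

/-- `q = exp_p v`: a geodesic starts at `p` with velocity `v` and is at `q` at time `1`. -/
def IsExp (g : ContMDiffRiemannianMetric (𝓡 m) ∞ (V m) (fun q : M => TangentSpace (𝓡 m) q))
    (p : M) (v : TangentSpace (𝓡 m) p) (q : M) : Prop :=
  ∃ (c : ℝ → M) (ε : ℝ), 0 < ε ∧ IsGeodesicOn g c (Ioo (-ε) (1 + ε)) ∧
    (⟨c 0, mfderiv 𝓘(ℝ, ℝ) (𝓡 m) c 0 (1 : ℝ)⟩ : TangentBundle (𝓡 m) M) = ⟨p, v⟩ ∧ c 1 = q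

open Classical in
/-- The exponential map of `M` at `p` (with the value `p` outside its domain). -/
def expMap (g : ContMDiffRiemannianMetric (𝓡 m) ∞ (V m) (fun q : M => TangentSpace (𝓡 m) q))
    (p : M) (v : TangentSpace (𝓡 m) p) : M :=
  if h : ∃ q, IsExp g p v q then h.choose else p

/-- `E` is an orthonormal basis of `T_p M` (`m` orthonormal vectors, with `m = dim M`). -/
def IsOrthonormalBasis
    (g : ContMDiffRiemannianMetric (𝓡 m) ∞ (V m) (fun q : M => TangentSpace (𝓡 m) q))
    (p : M) (E : Fin m → TangentSpace (𝓡 m) p) : Prop :=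
  ∀ i j, g.inner p (E i) (E j) = if i = j then 1 else 0

/-- Geodesic normal coordinates `F(x) = exp_p (∑ x_i E_i)`. -/
def normalCoord
    (g : ContMDiffRiemannianMetric (𝓡 m) ∞ (V m) (fun q : M => TangentSpace (𝓡 m) q))
    (p : M) (E : Fin m → TangentSpace (𝓡 m) p) (x : V m) : M :=
  expMap g p (∑ i, x i • E i)

/-- The metric coefficients `g_{ij}(x) = g(X_i, X_j)`, `X_i = F_* ∂_{x_i}`, in the normal
coordinates `F`. Since `X_i = E_i` at `p = F(0)`, a vector `∑ v_i E_i` of `T_p M` has coordinates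
`v`; geometric quantities of `M` near `p` are computed in the chart `F`. -/
def normalMetric
    (g : ContMDiffRiemannianMetric (𝓡 m) ∞ (V m) (fun q : M => TangentSpace (𝓡 m) q))
    (p : M) (E : Fin m → TangentSpace (𝓡 m) p) : V m → Matrix (Fin m) (Fin m) ℝ :=
  metricIn g (normalCoord g p E)

end Manifold

/-! ### Perturbed geodesic spheres -/

/-- The unit sphere `S^n` of `ℝ^{n+1} ≅ T_p M`. -/
abbrev S (n : ℕ) : Type := sphere (0 : V (n + 1)) 1

/-- `Θ` as a vector of `ℝ^{n+1}`. -/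
def pos {n : ℕ} (Θ : V n → S n) (z : V n) : V (n + 1) := (Θ z : V (n + 1))

/-- The map `z ↦ ρ (1 - w) Θ`, the expression in normal coordinates of the parametrization
`G(z) = F(ρ (1 - w(z)) Θ(z))` of the perturbed geodesic sphere `S_ρ(p, w)`. -/
def sphereParam {n : ℕ} (ρ : ℝ) (w : S n → ℝ) (Θ : V n → S n) (z : V n) : V (n + 1) :=
  (ρ * (1 - w (Θ z))) • pos Θ z

/-- The second fundamental form `- g(∇_{Z_i} N, Z_j)` of `S_ρ(p, w)` at the point `G(z)`, with
`Z_i = G_* ∂_{z^i}`, and `N` the unit normal built from `Υ = Θ^j X_j`. -/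
def sphereSecondFF {n : ℕ} {M : Type*} [TopologicalSpace M] [ChartedSpace (V (n + 1)) M]
    [IsManifold (𝓡 (n + 1)) ∞ M]
    (g : ContMDiffRiemannianMetric (𝓡 (n + 1)) ∞ (V (n + 1))
      (fun q : M => TangentSpace (𝓡 (n + 1)) q))
    (p : M) (E : Fin (n + 1) → TangentSpace (𝓡 (n + 1)) p) (ρ : ℝ) (w : S n → ℝ)
    (Θ : V n → S n) (i j : Fin n) (z : V n) : ℝ :=
  secondFF (normalMetric g p E) (sphereParam ρ w Θ) (pos Θ) i j z

/-- `Θ` is smooth near `z` and, at `z`, `⟨Θ_i, Θ_j⟩ = δ_ij` (so `Θ` is a local parametrization of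
`S^n` near `z`) and `∇̄_{Θ_i} Θ_j = 0`, the Levi-Civita connection `∇̄` of `S^n` being the
projection of the Euclidean derivative to the tangent space of `S^n`. -/
structure IsNormalAt {n : ℕ} (Θ : V n → S n) (z : V n) : Prop where
  smooth : ContMDiffAt (𝓡 n) (𝓡 n) ∞ Θ z
  orthonormal : ∀ i j, inner ℝ (pd i (pos Θ) z) (pd j (pos Θ) z) = if i = j then (1 : ℝ) else 0
  connection : ∀ i j,
    (Submodule.span ℝ {pos Θ z})ᗮ.starProjection (pd i (pd j (pos Θ)) z) = 0

/-! ### Error terms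

Coefficients are smooth functions of the point `Θ` of `S^n` together with the orthonormal basis
`Θ_1, …, Θ_n` of the tangent space at this point: along a smooth orthonormal frame field they are
smooth functions on `S^n`. -/

/-- Points `(θ, e_1, …, e_n)`. -/
abbrev Frame (n : ℕ) : Type := V (n + 1) × (Fin n → V (n + 1))

/-- `θ ∈ S^n` and `e_1, …, e_n` is an orthonormal basis of `T_θ S^n`. -/
def IsFrame {n : ℕ} (x : Frame n) : Prop :=
  ‖x.1‖ = 1 ∧ (∀ i, inner ℝ x.1 (x.2 i) = (0 : ℝ)) ∧
    ∀ i j, inner ℝ (x.2 i) (x.2 j) = if i = j then (1 : ℝ) else 0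

/-- The frame `(Θ, Θ_1, …, Θ_n)` at `z`. -/
def frameAt {n : ℕ} (Θ : V n → S n) (z : V n) : Frame n :=
  (pos Θ z, fun i => pd i (pos Θ) z)

/-- Values `(w, (w_1, …, w_n))` of a function and of its first derivatives. -/
abbrev Jet (n : ℕ) : Type := ℝ × V n

/-- The first order jet `(w, (w_i))` at `z`. -/
def jetAt {n : ℕ} (w : S n → ℝ) (Θ : V n → S n) (z : V n) : Jet n :=
  (w (Θ z), WithLp.toLp 2 fun i => pd i (fun y => w (Θ y)) z)

/-- The second derivatives `w_{ij} = ∂_{z^i} ∂_{z^j} w` at `z`. -/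
def hessAt {n : ℕ} (w : S n → ℝ) (Θ : V n → S n) (z : V n) (i j : Fin n) : ℝ :=
  pd i (pd j (fun y => w (Θ y))) z

/-- The vector `∇w = ∑ w_k Θ_k` at a point where the `Θ_k` are orthonormal. -/
def gradAt {n : ℕ} (w : S n → ℝ) (Θ : V n → S n) (z : V n) : V (n + 1) :=
  ∑ k, pd k (fun y => w (Θ y)) z • pd k (pos Θ) z

/-- `a` is smooth, and its derivatives of order `k` are bounded by `C k`. -/
def IsCoeff {n : ℕ} (C : ℕ → ℝ) (a : Frame n → ℝ) : Prop :=
  ∀ x, IsFrame x → ContDiffAt ℝ ∞ a x ∧ ∀ k, ‖iteratedFDeriv ℝ k a x‖ ≤ C k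

/-- Operators of type `L^1`: linear combinations of `w` and its first derivatives. -/
def IsL1 {n : ℕ} (C : ℕ → ℝ) (L : Frame n → Jet n → ℝ) : Prop :=
  ∃ (a : Frame n → ℝ) (b : Fin n → Frame n → ℝ), IsCoeff C a ∧ (∀ k, IsCoeff C (b k)) ∧
    ∀ x J, L x J = a x * J.1 + ∑ k, b k x * J.2 k

/-- Operators of type `L^2`: linear combinations of `w` and its derivatives of order at most 2. -/
def IsL2 {n : ℕ} (C : ℕ → ℝ) (L : Frame n → Jet n → (Fin n → Fin n → ℝ) → ℝ) : Prop :=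
  ∃ (a : Frame n → ℝ) (b : Fin n → Frame n → ℝ) (c : Fin n → Fin n → Frame n → ℝ),
    IsCoeff C a ∧ (∀ k, IsCoeff C (b k)) ∧ (∀ k l, IsCoeff C (c k l)) ∧
    ∀ x J H, L x J H = a x * J.1 + ∑ k, b k x * J.2 k + ∑ k, ∑ l, c k l x * H k l

/-- Operators of type `Q^1`, on the functions with `|w| ≤ δ` and `|∇w| ≤ Λ`: nonlinear in `w` and
its first derivatives, smooth with all derivatives bounded, vanishing quadratically at `w = 0`. -/
def IsQ1 {n : ℕ} (C : ℕ → ℝ) (δ Λ : ℝ) (Q : Frame n × Jet n → ℝ) : Prop :=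
  (∀ x J, IsFrame x → |J.1| ≤ δ → ‖J.2‖ ≤ Λ →
    ContDiffAt ℝ ∞ Q (x, J) ∧ ∀ k, ‖iteratedFDeriv ℝ k Q (x, J)‖ ≤ C k) ∧
  ∀ x, IsFrame x → Q (x, 0) = 0 ∧ fderiv ℝ (fun J => Q (x, J)) 0 = 0

end SmallSpheres

end

/-!
# Second fundamental form of perturbed geodesic spheres

The proof has three parts: normal coordinates that depend smoothly on all parameters, the expansion
of the metric in such coordinates, and an exact formula for the second fundamental form.

*Normal coordinates.* The superposition operator `u ↦ X ∘ u` on continuous functions is smooth, so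
the inverse function theorem applied to the integral equation `u = a + τ ∫ X(u)` gives a flow that
depends smoothly on its initial data (`exists_smooth_local_flow`). For the geodesic vector field of
the metric in a chart, extended to all of `ℝ^m`, this produces the exponential map; uniqueness of
geodesics identifies it with `expMap` (`expMap_eq_of_isCoordGeodesic`). Pulling back the metric, one
obtains near each point of `M` a family `H (κ, x)` of metric coefficients, smooth in `x` and in the
parameter `κ`, which consists of the centre `p` and the orthonormal basis `E` and ranges over a compact
set (`exists_normal_family`). All uniformity in `p` and `E` comes from this compactness.

*Expansion of the metric.* Since radial lines are geodesics, `H x x w = ⟨x, w⟩` (the Gauss lemma,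
`IsNormalMetric.gauss`). Differentiating this identity up to four times at the centre determines the
radial derivatives of the metric: `∂²_θθ h(a, b) = 2/3 R(θ, a, θ, b)`,
`∂³_θθθ h(a, b) = ∇_θ R(θ, a, θ, b)`, and the derivative of the lowered Christoffel symbols
(`IsNormalMetric.der2_radial`, `der3_radial`, `lowChr_radial`). Taylor's formula along rays, with
remainders smooth in all variables, gives the expansions used later (`IsRadialExpansion`).

*The second fundamental form.* Differentiating `g(N, Z_j) = 0` shows that
`-g(∇_{Z_i} N, Z_j) = g(N, ∇_{Z_i} Z_j)`. With `Z_k = ρ z_k`, `z_k = (1 - w) Θ_k - w_k Θ` and `α` the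
solution of `∑_l g(z_k, z_l) α_l = w_k`, the Gauss lemma gives `Ñ = -(Θ + ∑ α_k z_k)` and
`g(Ñ, Ñ) = 1 - ∑ α_k w_k`, whence an exact formula for the second fundamental form in terms of the
two-jet of `w` (`IsNormalMetric.secondFF_jet`). The second derivative `w_ij` enters it only through
the summand `ρ |Ñ| w_ij`, and `|Ñ| - 1` is of type `Q¹`; this is the only product needed in the error
term `L² ⋉ Q¹`. For a geodesic sphere, `w = 0`, what remains is a radial expansion in which the
coefficients `1/2 + 1/2` and `1/6 + 1/4 = 5/12` combine the metric with its radial derivative. The rest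
is split into a part of order `ρ⁵`, a part of order `ρ⁴` vanishing at `w = 0`, and a part vanishing to
second order (`IsRadialExpansion.decomposition`). Each part is a smooth function of the parameters,
of `ρ ≥ 0`, of the frame and of the one-jet of `w`, so that its derivatives are bounded on compact sets;
Taylor expansion at `w = 0` yields the operators `O`, `L¹` and `Q¹`
(`IsNormalFamily.exists_error_terms`). A finite cover of `K` concludes the proof.
-/

noncomputable section

namespace SmallSpheres

/-! ### Smoothness of superposition operators and of integrals with parameters -/

section Superposition

universe u

set_option linter.unusedSectionVars false

variable {I : Type*} [TopologicalSpace I] [CompactSpace I]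
  {E F : Type u} [NormedAddCommGroup E] [NormedSpace ℝ E] [NormedAddCommGroup F] [NormedSpace ℝ F]

/-- The superposition (Nemytskii) operator `u ↦ X ∘ u` on spaces of continuous functions. -/
def superpos (X : E → F) (hX : Continuous X) (u : C(I, E)) : C(I, F) :=
  (⟨X, hX⟩ : C(E, F)).comp u

@[simp] lemma superpos_apply (X : E → F) (hX : Continuous X) (u : C(I, E)) (t : I) :
    superpos X hX u t = X (u t) := rfl

lemma continuous_superpos (X : E → F) (hX : Continuous X) :
    Continuous (superpos (I := I) X hX) :=
  ContinuousMap.continuous_postcomp _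

/-- A shortcut for instance search. -/
scoped instance instNormedAddCommGroupContinuousMapCLM : NormedAddCommGroup C(I, E →L[ℝ] F) :=
  ContinuousMap.instNormedAddCommGroup

/-- A shortcut for instance search. -/
scoped instance instNormedSpaceContinuousMapCLM : NormedSpace ℝ C(I, E →L[ℝ] F) :=
  ContinuousMap.normedSpace

/-- Pointwise application of a continuous family of linear maps to a continuous function. -/
def pointwiseApply : C(I, E →L[ℝ] F) →L[ℝ] C(I, E) →L[ℝ] C(I, F) :=
  LinearMap.mkContinuous₂
    (LinearMap.mk₂ ℝ (fun (A : C(I, E →L[ℝ] F)) (v : C(I, E)) =>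
        (⟨fun t => A t (v t), by fun_prop⟩ : C(I, F)))
      (fun A B v => by ext t; simp) (fun c A v => by ext t; simp)
      (fun A v w => by ext t; simp) (fun c A v => by ext t; simp)) 1
    (fun A v => by
      rw [one_mul, ContinuousMap.norm_le _ (by positivity)]
      intro t
      exact ((A t).le_opNorm _).trans
        (mul_le_mul (A.norm_coe_le_norm t) (v.norm_coe_le_norm t) (norm_nonneg _) (norm_nonneg A)))

/-- The constant functions, as a continuous linear map into `C(I, E)`. -/
def constCLM (I : Type*) [TopologicalSpace I] [CompactSpace I] : E →L[ℝ] C(I, E) :=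
  LinearMap.mkContinuous
    ({ toFun := fun q => ContinuousMap.const I q
       map_add' := fun _ _ => rfl
       map_smul' := fun _ _ => rfl } : E →ₗ[ℝ] C(I, E)) 1
    (fun q => by
      rw [one_mul, ContinuousMap.norm_le _ (norm_nonneg _)]
      exact fun _ => le_rfl)

@[simp] lemma constCLM_apply (q : E) (t : I) : constCLM I q t = q := rfl

@[simp] lemma pointwiseApply_apply (A : C(I, E →L[ℝ] F)) (v : C(I, E)) (t : I) :
    pointwiseApply A v t = A t (v t) := rfl

lemma hasFDerivAt_superpos {X : E → F} (hX : ContDiff ℝ 1 X) (u : C(I, E)) :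
    HasFDerivAt (superpos (I := I) X hX.continuous)
      (pointwiseApply (superpos (fderiv ℝ X) (hX.continuous_fderiv one_ne_zero) u)) u := by
  rw [hasFDerivAt_iff_isLittleO_nhds_zero, Asymptotics.isLittleO_iff]
  intro ε hε
  -- continuity of the superposition operator of the derivative controls the mean value estimate
  -- uniformly in the point of `I`
  have hc := (continuous_superpos (I := I) (fderiv ℝ X)
    (hX.continuous_fderiv one_ne_zero)).continuousAt (x := u)
  obtain ⟨d, hd, hc⟩ := Metric.continuousAt_iff.1 hc ε hε
  filter_upwards [Metric.ball_mem_nhds (0 : C(I, E)) hd] with h hh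
  rw [mem_ball_zero_iff] at hh
  rw [ContinuousMap.norm_le _ (by positivity)]
  intro t
  have key := (convex_segment (u t) (u t + h t)).norm_image_sub_le_of_norm_hasFDerivWithin_le'
    (f := X) (f' := fderiv ℝ X) (φ := fderiv ℝ X (u t)) (C := ε)
    (fun x _ => (hX.differentiable one_ne_zero x).hasFDerivAt.hasFDerivWithinAt)
    (by
      intro x hx
      rw [segment_eq_image'] at hx
      obtain ⟨s, hs, rfl⟩ := hx
      have h1 : dist (u + s • h) u < d := by
        rw [dist_eq_norm, add_sub_cancel_left, norm_smul, Real.norm_of_nonneg hs.1]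
        exact (mul_le_of_le_one_left (norm_nonneg _) hs.2).trans_lt hh
      have h2 := (hc h1).le
      rw [dist_eq_norm] at h2
      have := (ContinuousMap.norm_coe_le_norm _ t).trans h2
      simpa using this)
    (left_mem_segment ℝ _ _) (right_mem_segment ℝ _ _)
  have h3 : ‖h t‖ ≤ ‖h‖ := h.norm_coe_le_norm t
  simp only [add_sub_cancel_left] at key
  refine le_trans ?_ (key.trans (mul_le_mul_of_nonneg_left h3 hε.le))
  simp

lemma contDiff_superpos_nat (n : ℕ) {F : Type u} [NormedAddCommGroup F] [NormedSpace ℝ F]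
    {X : E → F} (hX : ContDiff ℝ n X) :
    ContDiff ℝ n (superpos (I := I) X hX.continuous) := by
  induction n generalizing F with
  | zero => exact contDiff_zero.2 (continuous_superpos _ _)
  | succ n ih =>
    have h1 : ContDiff ℝ 1 X := hX.of_le (by norm_cast; omega)
    refine contDiff_succ_iff_hasFDerivAt.2 ⟨_, ?_, fun u => hasFDerivAt_superpos h1 u⟩
    have h2 : ContDiff ℝ n (fderiv ℝ X) := hX.fderiv_right (by norm_cast)
    exact pointwiseApply.contDiff.comp (ih h2)

/-- The superposition operator of a smooth map is smooth for the uniform norm. -/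
lemma contDiff_superpos {X : E → F} (hX : ContDiff ℝ ∞ X) :
    ContDiff ℝ ∞ (superpos (I := I) X hX.continuous) :=
  contDiff_infty.2 fun n => contDiff_superpos_nat n (contDiff_infty.1 hX n)

end Superposition

section Integral

universe u

variable {Q W : Type u} [NormedAddCommGroup Q] [NormedSpace ℝ Q]
  [NormedAddCommGroup W] [NormedSpace ℝ W]

/-- The integral over `[a, b]` as a continuous linear map on `C([a, b], W)`. -/
def integralCLM (a b : ℝ) (hab : a ≤ b) : C(Icc a b, W) →L[ℝ] W :=
  LinearMap.mkContinuous
    { toFun := fun u => ∫ s in a..b, IccExtend hab u s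
      map_add' := fun u v => by
        have hu : Continuous (IccExtend hab u) := u.continuous.Icc_extend'
        have hv : Continuous (IccExtend hab v) := v.continuous.Icc_extend'
        rw [← intervalIntegral.integral_add (hu.intervalIntegrable _ _)
          (hv.intervalIntegrable _ _)]
        rfl
      map_smul' := fun c u => by
        simp only [RingHom.id_apply]
        rw [← intervalIntegral.integral_smul]
        rfl } |b - a|
    (fun u => by
      rw [mul_comm]
      exact intervalIntegral.norm_integral_le_of_norm_le_const
        fun s _ => u.norm_coe_le_norm _)

/-- An integral over `[0, 1]` depends smoothly on parameters: it is the composition of a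
superposition operator with continuous affine maps. -/
lemma contDiff_integral_param {F : Q × ℝ → W} (hF : ContDiff ℝ ∞ F) :
    ContDiff ℝ ∞ fun q => ∫ s in (0 : ℝ)..1, F (q, s) := by
  let L : Q →L[ℝ] C(Icc (0 : ℝ) 1, Q × ℝ) :=
    (ContinuousLinearMap.compLeftContinuous ℝ (Icc (0 : ℝ) 1)
      (ContinuousLinearMap.inl ℝ Q ℝ)).comp (constCLM _)
  let c : C(Icc (0 : ℝ) 1, Q × ℝ) := ⟨fun s => (0, (s : ℝ)), by fun_prop⟩
  have h : ContDiff ℝ ∞ fun q =>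
      integralCLM 0 1 zero_le_one (superpos F hF.continuous (L q + c)) :=
    (integralCLM (W := W) 0 1 zero_le_one).contDiff.comp
      ((contDiff_superpos hF).comp (L.contDiff.add contDiff_const))
  convert h using 2 with q
  change _ = ∫ s in (0 : ℝ)..1, IccExtend zero_le_one _ s
  refine intervalIntegral.integral_congr fun s hs => ?_
  rw [uIcc_of_le zero_le_one] at hs
  rw [IccExtend_of_mem _ _ hs, superpos_apply]
  simp [L, c]

/-- Taylor expansion in one real variable with a remainder depending smoothly on parameters;
`f (k + 1)` is the derivative of `f k` in this variable. -/
lemma exists_taylor_remainder [CompleteSpace W] (N : ℕ) (f : ℕ → Q × ℝ → W)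
    (hf : ∀ k, ContDiff ℝ ∞ (f k))
    (hd : ∀ k q t, HasDerivAt (fun s => f k (q, s)) (f (k + 1) (q, t)) t) :
    ∃ R : Q × ℝ → W, ContDiff ℝ ∞ R ∧ ∀ q t,
      f 0 (q, t) = ∑ k ∈ Finset.range N, ((k.factorial : ℝ)⁻¹ * t ^ k) • f k (q, 0)
        + t ^ N • R (q, t) := by
  induction N generalizing f with
  | zero => exact ⟨f 0, hf 0, by simp⟩
  | succ N ih =>
    -- the expansion of `f 1` of order `N` is integrated once more
    obtain ⟨R, hR, hfR⟩ := ih (fun k => f (k + 1)) (fun k => hf _) (fun k => hd _)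
    refine ⟨fun p => ∫ s in (0 : ℝ)..1, s ^ N • R (p.1, p.2 * s), ?_, fun q t => ?_⟩
    · refine contDiff_integral_param (Q := Q × ℝ)
        (F := fun z : (Q × ℝ) × ℝ => z.2 ^ N • R (z.1.1, z.1.2 * z.2)) ?_
      fun_prop
    · -- Hadamard: `f 0 (q, t) = f 0 (q, 0) + t ∫₀¹ f 1 (q, t s) ds`
      have h1 : ∀ s ∈ uIcc (0 : ℝ) 1,
          HasDerivAt (fun s => f 0 (q, t * s)) (t • f 1 (q, t * s)) s := fun s _ => by
        have := (hd 0 q (t * s)).scomp s ((hasDerivAt_id s).const_mul t)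
        simpa [Function.comp_def] using this
      have hc : Continuous fun s : ℝ => f 1 (q, t * s) := by
        have := (hf 1).continuous
        fun_prop
      have h2 := intervalIntegral.integral_eq_sub_of_hasDerivAt h1
        ((hc.const_smul t).intervalIntegrable _ _)
      simp only [mul_one, mul_zero] at h2
      have hRc : Continuous fun s : ℝ => s ^ N • R (q, t * s) := by
        have := hR.continuous
        fun_prop
      have h3 : ∫ s in (0 : ℝ)..1, t • f 1 (q, t * s)
          = ∑ k ∈ Finset.range N,
              (((k + 1).factorial : ℝ)⁻¹ * t ^ (k + 1)) • f (k + 1) (q, 0)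
            + t ^ (N + 1) • ∫ s in (0 : ℝ)..1, s ^ N • R (q, t * s) := by
        have h4 : ∀ s : ℝ, t • f 1 (q, t * s)
            = ∑ k ∈ Finset.range N, s ^ k • (((k.factorial : ℝ)⁻¹ * t ^ (k + 1)) •
                f (k + 1) (q, 0)) + t ^ (N + 1) • (s ^ N • R (q, t * s)) := fun s => by
          rw [hfR q (t * s), smul_add, Finset.smul_sum]
          congr 1
          · refine Finset.sum_congr rfl fun k _ => ?_
            simp only [smul_smul]
            congr 1
            ring
          · simp only [smul_smul]
            congr 1
            ring
        simp only [h4]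
        rw [intervalIntegral.integral_add, intervalIntegral.integral_finsetSum,
          intervalIntegral.integral_smul]
        · congr 1
          refine Finset.sum_congr rfl fun k _ => ?_
          rw [intervalIntegral.integral_smul_const, integral_pow, smul_smul]
          congr 1
          rw [Nat.factorial_succ]
          push_cast
          field_simp
          simp
        · exact fun k _ => Continuous.intervalIntegrable (by fun_prop) _ _
        · exact Continuous.intervalIntegrable (by fun_prop) _ _
        · exact (hRc.const_smul _).intervalIntegrable _ _
      rw [Finset.sum_range_succ', eq_comm]
      rw [h3] at h2
      simp only [Nat.factorial_zero, Nat.cast_one, inv_one, pow_zero, mul_one, one_smul]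
      rw [add_right_comm, h2]
      abel

end Integral

/-! ### Smooth dependence of solutions of differential equations on initial data -/

section Flow

open Filter Topology

universe u

variable {E : Type u} [NormedAddCommGroup E] [NormedSpace ℝ E]

/-- The operator `u ↦ ∫₀ᵗ u` on continuous functions on the time interval `[-1, 2]`, chosen because
`0` and `1` are interior points of it. -/
def primitiveCLM : C(Icc (-1 : ℝ) 2, E) →L[ℝ] C(Icc (-1 : ℝ) 2, E) :=
  LinearMap.mkContinuous
    ({ toFun := fun u => ⟨fun t => ∫ s in (0 : ℝ)..t, IccExtend (by norm_num) u s, by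
          have h : Continuous (IccExtend (by norm_num : (-1 : ℝ) ≤ 2) u) := u.continuous.Icc_extend'
          exact (intervalIntegral.continuous_primitive
            (fun a b => h.intervalIntegrable a b) 0).comp continuous_subtype_val⟩
       map_add' := fun u v => by
        have hu : Continuous (IccExtend (by norm_num : (-1 : ℝ) ≤ 2) u) := u.continuous.Icc_extend'
        have hv : Continuous (IccExtend (by norm_num : (-1 : ℝ) ≤ 2) v) := v.continuous.Icc_extend'
        ext t
        simp only [ContinuousMap.coe_mk, ContinuousMap.add_apply]
        rw [← intervalIntegral.integral_add (hu.intervalIntegrable _ _)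
          (hv.intervalIntegrable _ _)]
        rfl
       map_smul' := fun c u => by
        ext t
        simp only [RingHom.id_apply, ContinuousMap.coe_mk, ContinuousMap.smul_apply]
        rw [← intervalIntegral.integral_smul]
        rfl } : C(Icc (-1 : ℝ) 2, E) →ₗ[ℝ] C(Icc (-1 : ℝ) 2, E)) 2
    (fun u => by
      rw [ContinuousMap.norm_le _ (by positivity)]
      intro t
      have h : ‖∫ s in (0 : ℝ)..t, IccExtend (by norm_num : (-1 : ℝ) ≤ 2) u s‖
          ≤ ‖u‖ * |(t : ℝ) - 0| :=
        intervalIntegral.norm_integral_le_of_norm_le_const fun s _ => u.norm_coe_le_norm _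
      have ht : |(t : ℝ) - 0| ≤ 2 := by
        rw [sub_zero, abs_le]
        exact ⟨by linarith [t.2.1], t.2.2⟩
      calc _ ≤ ‖u‖ * |(t : ℝ) - 0| := h
        _ ≤ ‖u‖ * 2 := mul_le_mul_of_nonneg_left ht (norm_nonneg _)
        _ = 2 * ‖u‖ := mul_comm _ _)

/-- The map whose zeros in the second component are the solutions `u` of `u' = τ X(u)` with
initial value `a`. -/
def integralEqMap (τ : ℝ) (X : E → E) (hX : Continuous X) (p : E × C(Icc (-1 : ℝ) 2, E)) :
    E × C(Icc (-1 : ℝ) 2, E) :=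
  (p.1, p.2 - constCLM _ p.1 - τ • primitiveCLM (superpos X hX p.2))

lemma contDiff_integralEqMap (τ : ℝ) {X : E → E} (hX : ContDiff ℝ ∞ X) :
    ContDiff ℝ ∞ (integralEqMap τ X hX.continuous) := by
  refine contDiff_fst.prodMk ((contDiff_snd.sub
    ((constCLM (E := E) (Icc (-1 : ℝ) 2)).contDiff.comp contDiff_fst)).sub (ContDiff.const_smul τ ?_))
  exact (primitiveCLM (E := E)).contDiff.comp ((contDiff_superpos hX).comp contDiff_snd)

/-- `1 - τ S` is invertible for some `τ > 0`, by a Neumann series. -/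
lemma exists_equiv_sub_smul [CompleteSpace E] (S : E →L[ℝ] E) :
    ∃ τ : ℝ, 0 < τ ∧ ∃ T : E ≃L[ℝ] E, ∀ v, T v = v - τ • S v := by
  have hpos : 0 < (‖S‖ + 1)⁻¹ := by positivity
  have hlt : ‖(‖S‖ + 1)⁻¹ • S‖ < 1 := by
    rw [norm_smul, Real.norm_of_nonneg hpos.le, inv_mul_lt_one₀ (by positivity)]
    linarith
  exact ⟨_, hpos, ContinuousLinearEquiv.ofUnit (Units.oneSub _ hlt), fun v => rfl⟩

/-- For small `τ` the linearized integral equation is uniquely solvable. -/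
lemma exists_equiv_fderiv_integralEqMap [CompleteSpace E] {X : E → E} (hX : ContDiff ℝ ∞ X)
    (u : C(Icc (-1 : ℝ) 2, E)) (a : E) :
    ∃ τ : ℝ, 0 < τ ∧ ∃ e : (E × C(Icc (-1 : ℝ) 2, E)) ≃L[ℝ] (E × C(Icc (-1 : ℝ) 2, E)),
      HasFDerivAt (integralEqMap τ X hX.continuous)
        (e : (E × C(Icc (-1 : ℝ) 2, E)) →L[ℝ] (E × C(Icc (-1 : ℝ) 2, E))) (a, u) := by
  have hX1 : ContDiff ℝ 1 X := hX.of_le (by exact_mod_cast le_top)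
  set S : C(Icc (-1 : ℝ) 2, E) →L[ℝ] C(Icc (-1 : ℝ) 2, E) := primitiveCLM.comp
    (pointwiseApply (superpos (fderiv ℝ X) (hX1.continuous_fderiv one_ne_zero) u)) with hS
  obtain ⟨τ, hpos, T, hTv⟩ := exists_equiv_sub_smul S
  -- the derivative is triangular, with the diagonal entries `1` and `T`
  let A : (E × C(Icc (-1 : ℝ) 2, E)) →L[ℝ] (E × C(Icc (-1 : ℝ) 2, E)) :=
    (ContinuousLinearMap.fst ℝ E _).prod
      ((T : C(Icc (-1 : ℝ) 2, E) →L[ℝ] _).comp (ContinuousLinearMap.snd ℝ E _)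
        - (constCLM _).comp (ContinuousLinearMap.fst ℝ E _))
  let B : (E × C(Icc (-1 : ℝ) 2, E)) →L[ℝ] (E × C(Icc (-1 : ℝ) 2, E)) :=
    (ContinuousLinearMap.fst ℝ E _).prod
      ((T.symm : C(Icc (-1 : ℝ) 2, E) →L[ℝ] _).comp ((ContinuousLinearMap.snd ℝ E _)
        + (constCLM _).comp (ContinuousLinearMap.fst ℝ E _)))
  refine ⟨τ, hpos, ContinuousLinearEquiv.equivOfInverse A B (fun p => ?_) (fun p => ?_), ?_⟩
  · ext1 <;> simp [A, B]
  · ext1 <;> simp [A, B]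
  · have h1 : HasFDerivAt (fun p : E × C(Icc (-1 : ℝ) 2, E) =>
        superpos X hX.continuous p.2) _ (a, u) :=
      (hasFDerivAt_superpos hX1 u).comp (a, u)
        (ContinuousLinearMap.snd ℝ E C(Icc (-1 : ℝ) 2, E)).hasFDerivAt
    have h2 := (primitiveCLM (E := E)).hasFDerivAt.comp (a, u) h1
    have h3 := (ContinuousLinearMap.snd ℝ E C(Icc (-1 : ℝ) 2, E)).hasFDerivAt (x := (a, u))
    have h4 := ((constCLM (E := E) (Icc (-1 : ℝ) 2)).comp
      (ContinuousLinearMap.fst ℝ E C(Icc (-1 : ℝ) 2, E))).hasFDerivAt (x := (a, u))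
    have h5 := (ContinuousLinearMap.fst ℝ E C(Icc (-1 : ℝ) 2, E)).hasFDerivAt (x := (a, u))
    refine (h5.prodMk ((h3.sub h4).sub (h2.const_smul τ))).congr_fderiv ?_
    refine ContinuousLinearMap.ext fun p => ?_
    have h6 : T p.2 = p.2 - τ • S p.2 := hTv _
    refine Prod.ext rfl ?_
    change p.2 - constCLM _ p.1 - τ • S p.2 = T p.2 - constCLM _ p.1
    rw [h6]
    abel

/-- Near an equilibrium `z₀` of the smooth vector field `X`, the solutions of `u' = τ X(u)`, for
some `τ > 0`, exist on `(-1, 2)`, depend smoothly on their initial value and stay close to `z₀`. -/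
theorem exists_smooth_local_flow [CompleteSpace E] {X : E → E} (hX : ContDiff ℝ ∞ X) {z₀ : E}
    (hz : X z₀ = 0) :
    ∃ τ : ℝ, 0 < τ ∧ ∃ ζ : E → ℝ → E,
      (∀ᶠ a in 𝓝 z₀, ∀ t, ContDiffAt ℝ ∞ (fun b => ζ b t) a) ∧
      (∀ᶠ a in 𝓝 z₀, ζ a 0 = a ∧
        ∀ t ∈ Ioo (-1 : ℝ) 2, HasDerivAt (ζ a) (τ • X (ζ a t)) t) ∧
      ∀ V ∈ 𝓝 z₀, ∀ᶠ a in 𝓝 z₀, ∀ t, ζ a t ∈ V := by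
  have hI : (-1 : ℝ) ≤ 2 := by norm_num
  set u₀ : C(Icc (-1 : ℝ) 2, E) := constCLM _ z₀ with hu₀
  obtain ⟨τ, hτ, e, he⟩ := exists_equiv_fderiv_integralEqMap hX u₀ z₀
  set f := integralEqMap τ X hX.continuous with hf
  have hfs : ContDiff ℝ ∞ f := contDiff_integralEqMap τ hX
  have hf0 : f (z₀, u₀) = (z₀, 0) := by
    have : superpos X hX.continuous u₀ = 0 := by
      ext t
      simp [hu₀, hz]
    simp only [hf, integralEqMap]
    rw [this, hu₀]
    simp
  -- `Φ` is the local inverse, by the inverse function theorem, at the constant solution `u₀`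
  set Φ := hfs.contDiffAt.toOpenPartialHomeomorph f he (by simp) with hΦ
  have hΦf : ∀ p, Φ p = f p := fun p => rfl
  have hs : (z₀, u₀) ∈ Φ.source := hfs.contDiffAt.mem_toOpenPartialHomeomorph_source he (by simp)
  have ht : (z₀, (0 : C(Icc (-1 : ℝ) 2, E))) ∈ Φ.target := by
    rw [← hf0]
    exact Φ.map_source hs
  have hsym0 : Φ.symm (z₀, 0) = (z₀, u₀) := by
    rw [← hf0]
    exact Φ.left_inv hs
  have hcs : ContinuousAt Φ.symm (z₀, 0) := Φ.continuousAt_symm ht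
  -- the inverse is smooth wherever the derivative of `f` is invertible, which is an open condition
  have hev : ∀ᶠ b in 𝓝 (z₀, (0 : C(Icc (-1 : ℝ) 2, E))), ContDiffAt ℝ ∞ Φ.symm b := by
    have h1 : ∀ᶠ b in 𝓝 (z₀, (0 : C(Icc (-1 : ℝ) 2, E))), fderiv ℝ f (Φ.symm b) ∈
        range ((↑) : ((E × C(Icc (-1 : ℝ) 2, E)) ≃L[ℝ] (E × C(Icc (-1 : ℝ) 2, E))) →
          ((E × C(Icc (-1 : ℝ) 2, E)) →L[ℝ] (E × C(Icc (-1 : ℝ) 2, E)))) := by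
      have hc : ContinuousAt (fun b => fderiv ℝ f (Φ.symm b))
          (z₀, (0 : C(Icc (-1 : ℝ) 2, E))) :=
        ((hfs.continuous_fderiv (by simp)).continuousAt).comp hcs
      refine hc.eventually ?_
      simp only [hsym0, he.fderiv]
      exact ContinuousLinearEquiv.nhds e
    filter_upwards [h1, Φ.open_target.mem_nhds ht] with b hb hbt
    obtain ⟨e', he'⟩ := hb
    refine Φ.contDiffAt_symm (f₀' := e') hbt ?_ hfs.contDiffAt
    rw [he']
    exact (hfs.differentiable (by simp) _).hasFDerivAt
  set j : E → E × C(Icc (-1 : ℝ) 2, E) := fun a => (a, 0) with hj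
  have hjs : ContDiff ℝ ∞ j := contDiff_id.prodMk contDiff_const
  have hjc : Tendsto j (𝓝 z₀) (𝓝 (z₀, 0)) := hjs.continuous.tendsto z₀
  -- the solution with initial value `a`, continued by constants outside of `[-1, 2]`
  set ζ : E → ℝ → E := fun a t => (Φ.symm (j a)).2 (projIcc _ _ hI t) with hζ
  refine ⟨τ, hτ, ζ, ?_, ?_, ?_⟩
  · filter_upwards [hjc.eventually hev] with a ha t
    have h1 : ContDiffAt ℝ ∞ (fun b => (Φ.symm (j b)).2) a :=
      contDiffAt_snd.comp a (ha.comp a hjs.contDiffAt)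
    exact (ContinuousMap.evalCLM ℝ (projIcc _ _ hI t)).contDiff.contDiffAt.comp a h1
  · filter_upwards [hjc.eventually (Φ.open_target.mem_nhds ht)] with a ha
    have h1 : f (Φ.symm (j a)) = j a := Φ.right_inv ha
    have h2 : (Φ.symm (j a)).1 = a := congrArg Prod.fst h1
    set u := (Φ.symm (j a)).2 with hu
    have h3 : u = constCLM _ a + τ • primitiveCLM (superpos X hX.continuous u) := by
      have := congrArg Prod.snd h1
      simp only [hf, integralEqMap] at this
      rw [h2] at this
      rw [← sub_eq_zero, ← sub_sub]
      exact this
    have hXu : Continuous (IccExtend hI (superpos X hX.continuous u)) :=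
      (superpos X hX.continuous u).continuous.Icc_extend'
    have h4 : ∀ t ∈ Icc (-1 : ℝ) 2, ζ a t = a + τ • ∫ s in (0 : ℝ)..t,
        IccExtend hI (superpos X hX.continuous u) s := fun t ht => by
      have := congrArg (fun v : C(Icc (-1 : ℝ) 2, E) => v ⟨t, ht⟩) h3
      simp only [hζ, projIcc_of_mem hI ht]
      exact this
    refine ⟨by rw [h4 0 (by norm_num)]; simp, fun t ht => ?_⟩
    have h5 : HasDerivAt (fun t => a + τ • ∫ s in (0 : ℝ)..t,
        IccExtend hI (superpos X hX.continuous u) s)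
        (τ • IccExtend hI (superpos X hX.continuous u) t) t :=
      ((intervalIntegral.integral_hasDerivAt_right (hXu.intervalIntegrable _ _)
        (hXu.stronglyMeasurableAtFilter _ _) hXu.continuousAt).const_smul τ).const_add a
    have h6 : ζ a =ᶠ[𝓝 t] fun t => a + τ • ∫ s in (0 : ℝ)..t,
        IccExtend hI (superpos X hX.continuous u) s := by
      filter_upwards [Ioo_mem_nhds ht.1 ht.2] with s hs
      exact h4 s (Ioo_subset_Icc_self hs)
    exact h5.congr_of_eventuallyEq h6
  · intro V hV
    obtain ⟨r, hr, hrV⟩ := Metric.mem_nhds_iff.1 hV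
    have h1 : ContinuousAt (fun a => (Φ.symm (j a)).2) z₀ :=
      continuousAt_snd.comp (ContinuousAt.comp (f := j) hcs hjs.continuous.continuousAt)
    filter_upwards [h1.eventually (Metric.ball_mem_nhds _ hr)] with a ha t
    refine hrV ?_
    have h2 : (Φ.symm (j z₀)).2 = u₀ := by rw [show j z₀ = (z₀, 0) from rfl, hsym0]
    rw [h2] at ha
    have h3 := (ContinuousMap.dist_apply_le_dist (f := (Φ.symm (j a)).2) (g := u₀)
      (projIcc _ _ hI t)).trans_lt ha
    exact h3

end Flow

/-! ### Lowered Christoffel symbols -/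

section Lowered

open Filter Topology

variable {m : ℕ}

/-- Bilinear forms on `ℝ^m`. -/
abbrev Bil (m : ℕ) : Type := V m →L[ℝ] V m →L[ℝ] ℝ

/-! The following instances are shortcuts for instance search. -/

scoped instance instNormedAddCommGroupV : NormedAddCommGroup (V m) := PiLp.normedAddCommGroup 2 _

scoped instance instNormedSpaceV : NormedSpace ℝ (V m) := PiLp.normedSpace 2 ℝ _

scoped instance instNormedAddCommGroupDual : NormedAddCommGroup (V m →L[ℝ] ℝ) :=
  ContinuousLinearMap.toNormedAddCommGroup

scoped instance instNormedSpaceDual : NormedSpace ℝ (V m →L[ℝ] ℝ) :=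
  ContinuousLinearMap.toNormedSpace

scoped instance instNormedAddCommGroupBil : NormedAddCommGroup (Bil m) :=
  ContinuousLinearMap.toNormedAddCommGroup

scoped instance instNormedSpaceBil : NormedSpace ℝ (Bil m) :=
  ContinuousLinearMap.toNormedSpace

scoped instance instAddCommGroupBil : AddCommGroup (Bil m) := ContinuousLinearMap.addCommGroup

scoped instance instNormedAddCommGroupCLMBil : NormedAddCommGroup (V m →L[ℝ] Bil m) :=
  ContinuousLinearMap.toNormedAddCommGroup

scoped instance instNormedSpaceCLMBil : NormedSpace ℝ (V m →L[ℝ] Bil m) :=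
  ContinuousLinearMap.toNormedSpace

/-- The matrix of a bilinear form. -/
def mat (A : Bil m) : Matrix (Fin m) (Fin m) ℝ :=
  Matrix.of fun a b => A (coordVec a) (coordVec b)

@[simp] lemma mat_apply (A : Bil m) (a b : Fin m) : mat A a b = A (coordVec a) (coordVec b) := rfl

/-- The lowered Christoffel symbol `g(c, ∇_a b)`, where `K c` is the derivative of the metric in the
direction `c`. -/
def lowChr (K : V m →L[ℝ] Bil m) (c a b : V m) : ℝ :=
  (1 / 2) * (K a b c + K b a c - K c a b)

lemma sum_smul_coordVec (v : V m) : ∑ a, v a • coordVec a = v := by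
  ext b
  simp [coordVec, Pi.single_apply]

/-- A linear map is determined by its values on the coordinate vectors. -/
lemma clm_eq_sum {W : Type*} [AddCommGroup W] [Module ℝ W] [TopologicalSpace W]
    (L : V m →L[ℝ] W) (v : V m) : L v = ∑ a, v a • L (coordVec a) := by
  conv_lhs => rw [← sum_smul_coordVec v]
  simp only [map_sum, map_smul]

lemma bil_eq_sum (A : Bil m) (u v : V m) :
    A u v = ∑ a, ∑ b, A (coordVec a) (coordVec b) * u a * v b := by
  rw [clm_eq_sum A u, _root_.sum_apply]
  refine Finset.sum_congr rfl fun a _ => ?_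
  rw [_root_.smul_apply, clm_eq_sum (A (coordVec a)) v, Finset.smul_sum]
  refine Finset.sum_congr rfl fun b _ => ?_
  simp only [smul_eq_mul]
  ring

lemma ip_eq {h : V m → Matrix (Fin m) (Fin m) ℝ} {A : Bil m} {x : V m} (hx : h x = mat A)
    (u v : V m) : ip h x u v = A u v := by
  rw [bil_eq_sum A, ip, hx]
  rfl

lemma pd_congr {W : Type*} [NormedAddCommGroup W] [NormedSpace ℝ W] {f g : V m → W} {x : V m}
    (h : f =ᶠ[𝓝 x] g) (a : Fin m) : pd a f x = pd a g x := by
  rw [pd, pd, h.fderiv_eq]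

lemma pd_eventuallyEq {W : Type*} [NormedAddCommGroup W] [NormedSpace ℝ W] {f g : V m → W}
    {x : V m} (h : f =ᶠ[𝓝 x] g) (a : Fin m) : pd a f =ᶠ[𝓝 x] pd a g := by
  filter_upwards [h.eventuallyEq_nhds] with y hy
  exact pd_congr hy a

lemma fderiv_apply₂ {H : V m → Bil m} {x : V m} (hH : DifferentiableAt ℝ H x) (a b c : V m) :
    fderiv ℝ (fun y => H y a b) x c = fderiv ℝ H x c a b := by
  have h1 : HasFDerivAt (fun y => H y a b) _ x :=
    (hH.hasFDerivAt.clm_apply (hasFDerivAt_const a x)).clm_apply (hasFDerivAt_const b x)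
  rw [h1.fderiv]
  simp

lemma pd_entry {h : V m → Matrix (Fin m) (Fin m) ℝ} {H : V m → Bil m} {x : V m}
    (hh : ∀ᶠ y in 𝓝 x, h y = mat (H y)) (hH : DifferentiableAt ℝ H x) (a b c : Fin m) :
    pd c (fun y => h y a b) x = fderiv ℝ H x (coordVec c) (coordVec a) (coordVec b) := by
  have h1 : (fun y => h y a b) =ᶠ[𝓝 x] fun y => H y (coordVec a) (coordVec b) := by
    filter_upwards [hh] with y hy
    rw [hy, mat_apply]
  rw [pd_congr h1, pd, fderiv_apply₂ hH]

/-- The matrix of a positive definite form is invertible. -/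
lemma isUnit_det_mat {A : Bil m} (hA : ∀ v, v ≠ 0 → 0 < A v v) : IsUnit (mat A).det := by
  rw [← Matrix.isUnit_iff_isUnit_det, ← Matrix.mulVec_injective_iff_isUnit]
  refine (injective_iff_map_eq_zero (mat A).mulVecLin).2 ?_
  intro v hv
  by_contra hne
  have h1 : (WithLp.toLp 2 v : V m) ≠ 0 := fun h0 => hne (by simpa using h0)
  have h2 := hA _ h1
  rw [bil_eq_sum] at h2
  refine h2.ne' (Finset.sum_eq_zero fun a _ => ?_)
  have h3 := congrFun hv a
  simp only [Matrix.mulVecLin_apply, Matrix.mulVec, dotProduct, mat_apply, Pi.zero_apply] at h3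
  calc _ = v a * ∑ b, A (coordVec a) (coordVec b) * v b := by
        rw [Finset.mul_sum]
        exact Finset.sum_congr rfl fun b _ => by ring
    _ = 0 := by rw [h3, mul_zero]

variable {h : V m → Matrix (Fin m) (Fin m) ℝ} {H : V m → Bil m} {x : V m}

lemma sum_mul_christoffel (hh : ∀ᶠ y in 𝓝 x, h y = mat (H y)) (hH : DifferentiableAt ℝ H x)
    (hu : IsUnit (mat (H x)).det) (d a b : Fin m) :
    ∑ k, H x (coordVec d) (coordVec k) * christoffel h k a b x
      = lowChr (fderiv ℝ H x) (coordVec d) (coordVec a) (coordVec b) := by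
  have hx := hh.self_of_nhds
  set q : Fin m → ℝ := fun l => (1 / 2) * (pd a (fun y => h y b l) x + pd b (fun y => h y a l) x
    - pd l (fun y => h y a b) x) with hq
  have h1 : ∀ k, christoffel h k a b x = ((mat (H x))⁻¹ *ᵥ q) k := fun k => by
    rw [christoffel, Matrix.mulVec, dotProduct, Finset.mul_sum, hx]
    refine Finset.sum_congr rfl fun l _ => ?_
    simp only [hq]
    ring
  have h2 : ∑ k, H x (coordVec d) (coordVec k) * christoffel h k a b x
      = (mat (H x) *ᵥ ((mat (H x))⁻¹ *ᵥ q)) d := by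
    simp only [h1]
    rfl
  rw [h2, Matrix.mulVec_mulVec, Matrix.mul_nonsing_inv _ hu, Matrix.one_mulVec, hq, lowChr]
  simp only [pd_entry hh hH]

/-- The vector `Γ(u, v)`. -/
def chrVec (h : V m → Matrix (Fin m) (Fin m) ℝ) (x u v : V m) : V m :=
  WithLp.toLp 2 fun k => ∑ a, ∑ b, christoffel h k a b x * u a * v b

lemma lowChr_eq_sum (K : V m →L[ℝ] Bil m) (c a b : V m) :
    lowChr K c a b = ∑ i, ∑ j, ∑ k,
      lowChr K (coordVec i) (coordVec j) (coordVec k) * c i * a j * b k := by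
  have hK : ∀ p q r : V m, K p q r = ∑ i, ∑ j, ∑ k,
      K (coordVec i) (coordVec j) (coordVec k) * p i * q j * r k := fun p q r => by
    rw [clm_eq_sum K p]
    simp only [_root_.sum_apply, _root_.smul_apply]
    refine Finset.sum_congr rfl fun i _ => ?_
    rw [bil_eq_sum, Finset.smul_sum]
    refine Finset.sum_congr rfl fun j _ => ?_
    rw [Finset.smul_sum]
    refine Finset.sum_congr rfl fun k _ => ?_
    simp only [smul_eq_mul]
    ring
  have h1 : K a b c = ∑ i, ∑ j, ∑ k,
      K (coordVec j) (coordVec k) (coordVec i) * c i * a j * b k := by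
    rw [hK a b c]
    -- cyclic permutation of the three summations
    rw [Finset.sum_congr rfl fun i _ => Finset.sum_comm]
    rw [Finset.sum_comm]
    exact Finset.sum_congr rfl fun i _ => Finset.sum_congr rfl fun j _ =>
      Finset.sum_congr rfl fun k _ => by ring
  have h2 : K b a c = ∑ i, ∑ j, ∑ k,
      K (coordVec k) (coordVec j) (coordVec i) * c i * a j * b k := by
    rw [hK b a c]
    rw [Finset.sum_congr rfl fun i _ => Finset.sum_comm]
    rw [Finset.sum_comm]
    rw [Finset.sum_congr rfl fun i _ => Finset.sum_comm]
    exact Finset.sum_congr rfl fun i _ => Finset.sum_congr rfl fun j _ =>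
      Finset.sum_congr rfl fun k _ => by ring
  rw [lowChr, h1, h2, hK c a b, ← Finset.sum_add_distrib, ← Finset.sum_sub_distrib,
    Finset.mul_sum]
  refine Finset.sum_congr rfl fun i _ => ?_
  rw [← Finset.sum_add_distrib, ← Finset.sum_sub_distrib, Finset.mul_sum]
  refine Finset.sum_congr rfl fun j _ => ?_
  rw [← Finset.sum_add_distrib, ← Finset.sum_sub_distrib, Finset.mul_sum]
  refine Finset.sum_congr rfl fun k _ => ?_
  rw [lowChr]
  ring

/-- Lowering the index of `Γ(u, v)`. -/
lemma apply_chrVec (hh : ∀ᶠ y in 𝓝 x, h y = mat (H y)) (hH : DifferentiableAt ℝ H x)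
    (hu : IsUnit (mat (H x)).det) (c u v : V m) :
    H x c (chrVec h x u v) = lowChr (fderiv ℝ H x) c u v := by
  rw [lowChr_eq_sum, bil_eq_sum]
  refine Finset.sum_congr rfl fun i _ => ?_
  simp only [chrVec, ← sum_mul_christoffel hh hH hu, Finset.mul_sum, Finset.sum_mul]
  rw [Finset.sum_comm]
  refine Finset.sum_congr rfl fun j _ => ?_
  rw [Finset.sum_comm]
  refine Finset.sum_congr rfl fun k _ => ?_
  refine Finset.sum_congr rfl fun l _ => ?_
  ring

/-- A vector is zero if it is orthogonal to all vectors. -/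
lemma eq_zero_of_forall_bil {A : Bil m} (hA : ∀ v, v ≠ 0 → 0 < A v v) {u : V m}
    (hu : ∀ w, A w u = 0) : u = 0 := by
  by_contra hne
  exact (hA u hne).ne' (hu u)

/-- The geodesic equation, in coordinates and in lowered form. -/
lemma geodesic_equation_iff (hh : ∀ᶠ y in 𝓝 x, h y = mat (H y)) (hH : DifferentiableAt ℝ H x)
    (hpos : ∀ v, v ≠ 0 → 0 < H x v v) (a v : V m) :
    (∀ k, a k + ∑ i, ∑ j, christoffel h k i j x * v i * v j = 0) ↔
      ∀ w, H x w a + lowChr (fderiv ℝ H x) w v v = 0 := by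
  have hu := isUnit_det_mat hpos
  have h1 : (∀ k, a k + ∑ i, ∑ j, christoffel h k i j x * v i * v j = 0) ↔
      a + chrVec h x v v = 0 := by
    constructor
    · intro hk
      ext k
      simpa [chrVec] using hk k
    · intro hk k
      simpa [chrVec] using congrArg (fun z : V m => z k) hk
  rw [h1]
  constructor
  · intro h2 w
    rw [← apply_chrVec hh hH hu, ← map_add, h2, map_zero]
  · intro h2
    refine eq_zero_of_forall_bil hpos fun w => ?_
    rw [map_add, apply_chrVec hh hH hu, h2]

/-- The lowered geodesic expression is natural with respect to changes of coordinates `φ`, where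
`H'` is the pull-back of `H` by `φ`. -/
lemma lowered_geodesic_pullback {H H' : V m → Bil m} {φ : V m → V m} {x : V m}
    (hφ : ContDiffAt ℝ 2 φ x) (hH : DifferentiableAt ℝ H (φ x)) (hH' : DifferentiableAt ℝ H' x)
    (hsymm : ∀ a b, H (φ x) a b = H (φ x) b a)
    (hpull : ∀ᶠ y in 𝓝 x, ∀ a b, H' y a b = H (φ y) (fderiv ℝ φ y a) (fderiv ℝ φ y b))
    (a v w : V m) :
    H' x w a + lowChr (fderiv ℝ H' x) w v v
      = H (φ x) (fderiv ℝ φ x w) (fderiv ℝ φ x a + fderiv ℝ (fderiv ℝ φ) x v v)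
        + lowChr (fderiv ℝ H (φ x)) (fderiv ℝ φ x w) (fderiv ℝ φ x v) (fderiv ℝ φ x v) := by
  have hφ1 : HasFDerivAt φ (fderiv ℝ φ x) x := (hφ.differentiableAt (by simp)).hasFDerivAt
  have hφ2 : HasFDerivAt (fderiv ℝ φ) (fderiv ℝ (fderiv ℝ φ) x) x :=
    ((hφ.fderiv_right (m := 1) (by norm_num)).differentiableAt (by simp)).hasFDerivAt
  have hsec : fderiv ℝ (fderiv ℝ φ) x v w = fderiv ℝ (fderiv ℝ φ) x w v :=
    (hφ.isSymmSndFDerivAt (by simp)).eq v w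
  have key : ∀ c a b, fderiv ℝ H' x c a b
      = fderiv ℝ H (φ x) (fderiv ℝ φ x c) (fderiv ℝ φ x a) (fderiv ℝ φ x b)
        + H (φ x) (fderiv ℝ (fderiv ℝ φ) x c a) (fderiv ℝ φ x b)
        + H (φ x) (fderiv ℝ φ x a) (fderiv ℝ (fderiv ℝ φ) x c b) := fun c a b => by
    have h1 : (fun y => H' y a b) =ᶠ[𝓝 x]
        fun y => H (φ y) (fderiv ℝ φ y a) (fderiv ℝ φ y b) := by
      filter_upwards [hpull] with y hy using hy a b
    rw [← fderiv_apply₂ hH', h1.fderiv_eq]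
    have h2 := ((hH.hasFDerivAt.comp x hφ1).clm_apply
      (hφ2.clm_apply (hasFDerivAt_const a x))).clm_apply (hφ2.clm_apply (hasFDerivAt_const b x))
    refine (congrArg (fun L => L c) h2.fderiv).trans ?_
    simp
    ring
  have hx := hpull.self_of_nhds
  simp only [lowChr, key, hx, map_add, hsec]
  rw [hsymm (fderiv ℝ φ x v) (fderiv ℝ (fderiv ℝ φ) x w v), hsymm (fderiv ℝ (fderiv ℝ φ) x v v)]
  ring

/-- First and second derivatives of the image of a curve under a change of coordinates. -/
lemma deriv_deriv_comp {φ : V m → V m} {c : ℝ → V m} {t : ℝ}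
    (hφ : ContDiffAt ℝ 2 φ (c t)) (hc : ContDiffAt ℝ 2 c t) :
    deriv (fun s => φ (c s)) t = fderiv ℝ φ (c t) (deriv c t) ∧
    deriv (deriv fun s => φ (c s)) t
      = fderiv ℝ φ (c t) (deriv (deriv c) t)
        + fderiv ℝ (fderiv ℝ φ) (c t) (deriv c t) (deriv c t) := by
  have hev : ∀ᶠ s in 𝓝 t, deriv (fun s => φ (c s)) s = fderiv ℝ φ (c s) (deriv c s) := by
    have h1 : ∀ᶠ s in 𝓝 t, ContDiffAt ℝ 2 φ (c s) :=
      hc.continuousAt.eventually (hφ.eventually (by simp))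
    filter_upwards [h1, hc.eventually (by simp)] with s hs1 hs2
    exact ((hs1.differentiableAt (by simp)).hasFDerivAt.comp_hasDerivAt s
      (hs2.differentiableAt (by simp)).hasDerivAt).deriv
  refine ⟨hev.self_of_nhds, ?_⟩
  have h2 : HasFDerivAt (fderiv ℝ φ) (fderiv ℝ (fderiv ℝ φ) (c t)) (c t) :=
    ((hφ.fderiv_right (m := 1) (by norm_num)).differentiableAt (by simp)).hasFDerivAt
  have h3 : HasDerivAt c (deriv c t) t := (hc.differentiableAt (by simp)).hasDerivAt
  have h4 : HasDerivAt (deriv c) (deriv (deriv c) t) t := by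
    have : ContDiffAt ℝ 1 (deriv c) t := by
      have h5 := hc.fderiv_right (m := 1) (by norm_num)
      exact h5.clm_apply contDiffAt_const
    exact (this.differentiableAt (by simp)).hasDerivAt
  have h6 := (h2.comp_hasDerivAt t h3).clm_apply h4
  have h7 : deriv (fun s => φ (c s)) =ᶠ[𝓝 t] fun s => fderiv ℝ φ (c s) (deriv c s) := hev
  rw [h7.deriv_eq]
  refine h6.deriv.trans ?_
  rw [add_comm]
  rfl

end Lowered

/-! ### The geodesic flow of a metric on `ℝ^m` -/

section MatrixInverse

variable {X : Type*} [NormedAddCommGroup X] [NormedSpace ℝ X]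
  {κ : Type*} [Fintype κ] [DecidableEq κ] {r : WithTop ℕ∞} {x : X}

lemma contDiffAt_det {A : X → Matrix κ κ ℝ} (hA : ∀ i j, ContDiffAt ℝ r (fun y => A y i j) x) :
    ContDiffAt ℝ r (fun y => (A y).det) x := by
  simp only [Matrix.det_apply']
  exact ContDiffAt.sum fun σ _ => contDiffAt_const.mul (contDiffAt_prod fun i _ => hA _ _)

/-- The entries of the inverse of a matrix are smooth functions of its entries (Cramer's rule). -/
lemma contDiffAt_matrix_inv {A : X → Matrix κ κ ℝ}
    (hA : ∀ i j, ContDiffAt ℝ r (fun y => A y i j) x) (hu : IsUnit (A x).det) (i j : κ) :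
    ContDiffAt ℝ r (fun y => (A y)⁻¹ i j) x := by
  simp only [Matrix.inv_def, Matrix.smul_apply, Ring.inverse_eq_inv', smul_eq_mul,
    Matrix.adjugate_apply]
  refine ((contDiffAt_det hA).inv hu.ne_zero).mul (contDiffAt_det fun k l => ?_)
  by_cases hk : k = j
  · subst hk
    simp only [Matrix.updateRow_self]
    exact contDiffAt_const
  · simp only [Matrix.updateRow_ne hk]
    exact hA k l

end MatrixInverse

section GeodesicFlow

open Filter Topology

variable {m : ℕ}

/-- Uniqueness on `[0, 1]` for an autonomous equation with a `C¹` right hand side. -/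
lemma eqOn_of_autonomous {E : Type*} [NormedAddCommGroup E] [NormedSpace ℝ E] {X : E → E}
    (hX : ContDiff ℝ 1 X) {f g : ℝ → E} (hf : ∀ t ∈ Icc (0 : ℝ) 1, HasDerivAt f (X (f t)) t)
    (hg : ∀ t ∈ Icc (0 : ℝ) 1, HasDerivAt g (X (g t)) t) (h0 : f 0 = g 0) :
    EqOn f g (Icc 0 1) := by
  have hfc : ContinuousOn f (Icc 0 1) := fun t ht => (hf t ht).continuousAt.continuousWithinAt
  have hgc : ContinuousOn g (Icc 0 1) := fun t ht => (hg t ht).continuousAt.continuousWithinAt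
  have hK : IsCompact (f '' Icc 0 1 ∪ g '' Icc 0 1) :=
    (isCompact_Icc.image_of_continuousOn hfc).union (isCompact_Icc.image_of_continuousOn hgc)
  obtain ⟨C, hC⟩ := LocallyLipschitzOn.exists_lipschitzOnWith_of_compact hK
    (hX.locallyLipschitz.locallyLipschitzOn)
  exact ODE_solution_unique_of_mem_Icc_right (v := fun _ => X)
    (s := fun _ => f '' Icc 0 1 ∪ g '' Icc 0 1) (fun t _ => hC) hfc
    (fun t ht => (hf t (Ico_subset_Icc_self ht)).hasDerivWithinAt)
    (fun t ht => Or.inl ⟨t, Ico_subset_Icc_self ht, rfl⟩) hgc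
    (fun t ht => (hg t (Ico_subset_Icc_self ht)).hasDerivWithinAt)
    (fun t ht => Or.inr ⟨t, Ico_subset_Icc_self ht, rfl⟩) h0

/-- The Christoffel symbols of a smooth metric are smooth. -/
lemma contDiff_christoffel {H : V m → Bil m} (hH : ContDiff ℝ ∞ H)
    (hpos : ∀ x v, v ≠ 0 → 0 < H x v v) (k a b : Fin m) :
    ContDiff ℝ ∞ (christoffel (fun y => mat (H y)) k a b) := by
  have he : ∀ a b, ContDiff ℝ ∞ fun y => (mat (H y)) a b := fun a b =>
    (hH.clm_apply contDiff_const).clm_apply contDiff_const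
  have hp : ∀ c a b, ContDiff ℝ ∞ fun x => pd c (fun y => (mat (H y)) a b) x := fun c a b =>
    ((he a b).fderiv_right (m := ∞) (by simp)).clm_apply contDiff_const
  unfold christoffel
  refine contDiff_const.mul (ContDiff.sum fun l _ => ContDiff.mul ?_ ?_)
  · exact contDiff_iff_contDiffAt.2 fun x =>
      contDiffAt_matrix_inv (fun i j => (he i j).contDiffAt) (isUnit_det_mat (hpos x)) k l
  · exact ((hp _ _ _).add (hp _ _ _)).sub (hp _ _ _)

/-- The geodesic vector field on `ℝ^m × ℝ^m`. -/
def geodesicField (H : V m → Bil m) (p : V m × V m) : V m × V m :=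
  (p.2, -chrVec (fun y => mat (H y)) p.1 p.2 p.2)

lemma contDiff_geodesicField {H : V m → Bil m} (hH : ContDiff ℝ ∞ H)
    (hpos : ∀ x v, v ≠ 0 → 0 < H x v v) : ContDiff ℝ ∞ (geodesicField H) := by
  refine contDiff_snd.prodMk (ContDiff.neg (contDiff_euclidean.2 fun k => ?_))
  simp only [chrVec]
  have h2 : ∀ a : Fin m, ContDiff ℝ ∞ fun p : V m × V m => p.2 a := fun a =>
    (contDiff_euclidean.1 contDiff_snd) a
  exact ContDiff.sum fun a _ => ContDiff.sum fun b _ =>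
    (((contDiff_christoffel hH hpos k a b).comp contDiff_fst).mul (h2 a)).mul (h2 b)

lemma chrVec_smul (h : V m → Matrix (Fin m) (Fin m) ℝ) (x v : V m) (s : ℝ) :
    chrVec h x (s • v) (s • v) = s ^ 2 • chrVec h x v v := by
  ext k
  simp only [chrVec, PiLp.smul_apply, smul_eq_mul, Finset.mul_sum]
  refine Finset.sum_congr rfl fun a _ => Finset.sum_congr rfl fun b _ => ?_
  ring

/-- `c` is, together with its velocity `v`, a solution of the geodesic equation on `(-1, 2)`, with
initial position `y₀` and initial velocity `v₀`. -/
structure IsCoordGeodesic (H : V m → Bil m) (y₀ v₀ : V m) (c v : ℝ → V m) : Prop where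
  init : c 0 = y₀
  init_vel : v 0 = v₀
  hasDerivAt : ∀ t ∈ Ioo (-1 : ℝ) 2, HasDerivAt c (v t) t
  hasDerivAt_vel : ∀ t ∈ Ioo (-1 : ℝ) 2,
    HasDerivAt v (-chrVec (fun y => mat (H y)) (c t) (v t) (v t)) t

lemma IsCoordGeodesic.hasDerivAt_prod {H : V m → Bil m} {y₀ v₀ : V m} {c v : ℝ → V m}
    (h : IsCoordGeodesic H y₀ v₀ c v) {t : ℝ} (ht : t ∈ Ioo (-1 : ℝ) 2) :
    HasDerivAt (fun s => (c s, v s)) (geodesicField H (c t, v t)) t :=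
  (h.hasDerivAt t ht).prodMk (h.hasDerivAt_vel t ht)

/-- Geodesics with initial velocities `s v₀` and `v₀` differ by a change of time. -/
lemma IsCoordGeodesic.eq_scale {H : V m → Bil m} (hH : ContDiff ℝ ∞ H)
    (hpos : ∀ x v, v ≠ 0 → 0 < H x v v) {y₀ v₀ : V m} {s : ℝ} (hs : s ∈ Icc (0 : ℝ) 1)
    {c v c' v' : ℝ → V m} (h : IsCoordGeodesic H y₀ v₀ c v)
    (h' : IsCoordGeodesic H y₀ (s • v₀) c' v') : c' 1 = c s := by
  have hX : ContDiff ℝ 1 (geodesicField H) :=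
    (contDiff_geodesicField hH hpos).of_le (by exact_mod_cast le_top)
  have key := eqOn_of_autonomous hX (f := fun t => (c' t, v' t))
    (g := fun t => (c (s * t), s • v (s * t)))
    (fun t ht => h'.hasDerivAt_prod ⟨by linarith [ht.1], by linarith [ht.2]⟩)
    (fun t ht => by
      have hst : s * t ∈ Ioo (-1 : ℝ) 2 :=
        ⟨by nlinarith [hs.1, ht.1], by nlinarith [hs.1, ht.1, hs.2, ht.2]⟩
      have hm : HasDerivAt (fun t => s * t) s t := by
        simpa using (hasDerivAt_id t).const_mul s
      have h1 := (h.hasDerivAt _ hst).scomp t hm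
      have h2 := ((h.hasDerivAt_vel _ hst).scomp t hm).const_smul s
      have h3 := h1.prodMk h2
      refine h3.congr_deriv ?_
      simp only [geodesicField, chrVec_smul, smul_neg, smul_smul, pow_two])
    (by simp [h.init, h'.init, h.init_vel, h'.init_vel])
  have h1 := congrArg Prod.fst (key (right_mem_Icc.2 zero_le_one))
  simpa using h1

/-- Geodesics of a smooth metric on `ℝ^m` with small initial velocities exist on `(-1, 2)`, depend
smoothly on their initial data and stay near their initial point. -/
theorem exists_geodesics {H : V m → Bil m} (hH : ContDiff ℝ ∞ H)
    (hpos : ∀ x v, v ≠ 0 → 0 < H x v v) (y₀ : V m) {U : Set (V m)} (hU : U ∈ 𝓝 y₀) :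
    ∃ (sol vel : V m → V m → ℝ → V m) (ε : ℝ), 0 < ε ∧
      ∀ y ∈ ball y₀ ε, ∀ v ∈ ball (0 : V m) ε,
        IsCoordGeodesic H y v (sol y v) (vel y v) ∧ (∀ t, sol y v t ∈ U) ∧
        ContDiffAt ℝ ∞ (fun p : V m × V m => sol p.1 p.2 1) (y, v) := by
  have hz : geodesicField H (y₀, 0) = 0 := by
    have : chrVec (fun y => mat (H y)) y₀ 0 0 = 0 := by
      simpa using chrVec_smul (fun y => mat (H y)) y₀ 0 0
    simp [geodesicField, this]
  obtain ⟨τ, hτ, ζ, h1, h2, h3⟩ :=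
    exists_smooth_local_flow (contDiff_geodesicField hH hpos) (z₀ := (y₀, 0)) hz
  -- rescaling time by `τ` turns the flow of `τ X` into geodesics with velocity divided by `τ`
  set σ : V m × V m → V m × V m := fun p => (p.1, τ⁻¹ • p.2) with hσ
  have hσs : ContDiff ℝ ∞ σ := contDiff_fst.prodMk (contDiff_snd.const_smul _)
  have hσt : Tendsto σ (𝓝 (y₀, 0)) (𝓝 (y₀, 0)) := by
    have := hσs.continuous.tendsto (y₀, 0)
    simpa [hσ] using this
  have hev := hσt.eventually ((h1.and h2).and
    (h3 (U ×ˢ univ) (prod_mem_nhds hU univ_mem)))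
  rw [nhds_prod_eq] at hev
  obtain ⟨P, hP, Q, hQ, hPQ⟩ := Filter.eventually_prod_iff.1 hev
  obtain ⟨ε₁, hε₁, hb₁⟩ := Metric.eventually_nhds_iff_ball.1 hP
  obtain ⟨ε₂, hε₂, hb₂⟩ := Metric.eventually_nhds_iff_ball.1 hQ
  refine ⟨fun y v t => (ζ (σ (y, v)) t).1, fun y v t => τ • (ζ (σ (y, v)) t).2, min ε₁ ε₂,
    lt_min hε₁ hε₂, fun y hy v hv => ?_⟩
  obtain ⟨⟨hs, hi, hd⟩, hU'⟩ := hPQ (hb₁ y (ball_subset_ball (min_le_left _ _) hy))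
    (hb₂ v (ball_subset_ball (min_le_right _ _) hv))
  refine ⟨⟨congrArg Prod.fst hi, by simp only [hi]; simp [hσ, smul_smul, hτ.ne'], fun t ht => ?_, fun t ht => ?_⟩,
    fun t => (hU' t).1, ?_⟩
  · exact ((ContinuousLinearMap.fst ℝ (V m) (V m)).hasFDerivAt.comp_hasDerivAt t (hd t ht))
  · have h4 := ((ContinuousLinearMap.snd ℝ (V m) (V m)).hasFDerivAt.comp_hasDerivAt t
      (hd t ht)).const_smul τ
    refine h4.congr_deriv ?_
    rw [chrVec_smul]
    simp [geodesicField, smul_smul, pow_two]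
  · have h5 : ContDiffAt ℝ ∞ (fun p : V m × V m => ζ (σ p) 1) (y, v) :=
      (hs 1).comp (y, v) hσs.contDiffAt
    exact contDiffAt_fst.comp (y, v) h5

end GeodesicFlow

/-! ### The metric and the geodesics of a manifold in a chart -/

section Charts

open Filter Topology

variable {m : ℕ} {M : Type*} [TopologicalSpace M] [ChartedSpace (V m) M] [IsManifold (𝓡 m) ∞ M]

/-- The pull-back of a bilinear form by a linear map. -/
def pullBil {W : Type*} [AddCommGroup W] [Module ℝ W] [TopologicalSpace W] [IsTopologicalAddGroup W]
    [ContinuousSMul ℝ W] (B : W →L[ℝ] W →L[ℝ] ℝ) (A : V m →L[ℝ] W) : Bil m :=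
  LinearMap.toContinuousBilinearMap (LinearMap.mk₂ ℝ (fun a b => B (A a) (A b))
    (fun a a' b => by simp) (fun c a b => by simp) (fun a b b' => by simp) (fun c a b => by simp))

@[simp] lemma pullBil_apply {W : Type*} [AddCommGroup W] [Module ℝ W] [TopologicalSpace W]
    [IsTopologicalAddGroup W] [ContinuousSMul ℝ W] (B : W →L[ℝ] W →L[ℝ] ℝ) (A : V m →L[ℝ] W)
    (a b : V m) : pullBil B A a b = B (A a) (A b) := rfl

lemma mat_injective {A B : Bil m} (h : mat A = mat B) : A = B := by
  ext u v
  rw [bil_eq_sum A, bil_eq_sum B]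
  refine Finset.sum_congr rfl fun a _ => Finset.sum_congr rfl fun b _ => ?_
  rw [← mat_apply A, ← mat_apply B, h]

/-- A field of bilinear forms is smooth if its values on fixed vectors are. -/
lemma contDiffOn_bil {X : Type*} [NormedAddCommGroup X] [NormedSpace ℝ X] {f : X → Bil m}
    {s : Set X} {r : WithTop ℕ∞} (h : ∀ a b, ContDiffOn ℝ r (fun x => f x a b) s) :
    ContDiffOn ℝ r f s :=
  contDiffOn_clm_apply.2 fun a => contDiffOn_clm_apply.2 fun b => h a b

lemma contMDiffAt_chart_symm (q : M) {y : V m} (hy : y ∈ (extChartAt (𝓡 m) q).target) :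
    ContMDiffAt 𝓘(ℝ, V m) (𝓡 m) ∞ (extChartAt (𝓡 m) q).symm y :=
  (contMDiffOn_extChartAt_symm q).contMDiffAt ((isOpen_extChartAt_target q).mem_nhds hy)

lemma contMDiffAt_chart (q : M) {x : M} (hx : x ∈ (extChartAt (𝓡 m) q).source) :
    ContMDiffAt (𝓡 m) 𝓘(ℝ, V m) ∞ (extChartAt (𝓡 m) q) x :=
  contMDiffAt_extChartAt' (by rwa [extChartAt_source] at hx)

lemma mdifferentiableAt_chart_symm (q : M) {y : V m} (hy : y ∈ (extChartAt (𝓡 m) q).target) :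
    MDifferentiableAt 𝓘(ℝ, V m) (𝓡 m) (extChartAt (𝓡 m) q).symm y :=
  (contMDiffAt_chart_symm q hy).mdifferentiableAt (by simp)

lemma mdifferentiableAt_chart (q : M) {x : M} (hx : x ∈ (extChartAt (𝓡 m) q).source) :
    MDifferentiableAt (𝓡 m) 𝓘(ℝ, V m) (extChartAt (𝓡 m) q) x :=
  (contMDiffAt_chart q hx).mdifferentiableAt (by simp)

lemma mfderiv_chart_comp_symm (q : M) {y : V m} (hy : y ∈ (extChartAt (𝓡 m) q).target) (v : V m) :
    mfderiv (𝓡 m) 𝓘(ℝ, V m) (extChartAt (𝓡 m) q) ((extChartAt (𝓡 m) q).symm y)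
      (mfderiv 𝓘(ℝ, V m) (𝓡 m) (extChartAt (𝓡 m) q).symm y v) = v := by
  have h := mfderiv_extChartAt_comp_mfderivWithin_extChartAt_symm (I := 𝓡 m) hy
  rw [ModelWithCorners.range_eq_univ, mfderivWithin_univ] at h
  exact congrArg (fun L => L v) h

lemma mfderiv_symm_comp_chart (q : M) {x : M} (hx : x ∈ (extChartAt (𝓡 m) q).source)
    (v : TangentSpace (𝓡 m) x) :
    mfderiv 𝓘(ℝ, V m) (𝓡 m) (extChartAt (𝓡 m) q).symm (extChartAt (𝓡 m) q x)
      (mfderiv (𝓡 m) 𝓘(ℝ, V m) (extChartAt (𝓡 m) q) x v) = v := by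
  have hy := (extChartAt (𝓡 m) q).map_source hx
  have h1 : mfderiv (𝓡 m) (𝓡 m) ((extChartAt (𝓡 m) q).symm ∘ extChartAt (𝓡 m) q) x
      = ContinuousLinearMap.id ℝ (TangentSpace (𝓡 m) x) := by
    rw [← mfderiv_id]
    refine Filter.EventuallyEq.mfderiv_eq ?_
    filter_upwards [extChartAt_source_mem_nhds' (I := 𝓡 m) hx] with z hz
    exact (extChartAt (𝓡 m) q).left_inv hz
  rw [mfderiv_comp x (mdifferentiableAt_chart_symm q hy) (mdifferentiableAt_chart q hx)] at h1
  exact congrArg (fun L => L v) h1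

variable (g : ContMDiffRiemannianMetric (𝓡 m) ∞ (V m) (fun q : M => TangentSpace (𝓡 m) q))

/-- The coordinate expression of the metric in the chart at `q`. -/
def chartMetric (q : M) (y : V m) : Bil m :=
  pullBil (W := TangentSpace (𝓡 m) ((extChartAt (𝓡 m) q).symm y)) (g.inner ((extChartAt (𝓡 m) q).symm y))
    (mfderiv 𝓘(ℝ, V m) (𝓡 m) (extChartAt (𝓡 m) q).symm y)

lemma chartMetric_apply (q : M) (y a b : V m) :
    chartMetric g q y a b = g.inner ((extChartAt (𝓡 m) q).symm y)
      (mfderiv 𝓘(ℝ, V m) (𝓡 m) (extChartAt (𝓡 m) q).symm y a)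
      (mfderiv 𝓘(ℝ, V m) (𝓡 m) (extChartAt (𝓡 m) q).symm y b) := rfl

lemma metricIn_chart (q : M) (y : V m) :
    metricIn g (extChartAt (𝓡 m) q).symm y = mat (chartMetric g q y) := rfl

lemma chartMetric_symm (q : M) (y a b : V m) : chartMetric g q y a b = chartMetric g q y b a :=
  g.symm _ _ _

lemma chartMetric_pos (q : M) {y : V m} (hy : y ∈ (extChartAt (𝓡 m) q).target) (v : V m)
    (hv : v ≠ 0) : 0 < chartMetric g q y v v := by
  refine g.pos _ _ fun h => hv ?_
  exact (mfderiv_chart_comp_symm q hy v).symm.trans ((congrArg _ h).trans (map_zero _))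

lemma contDiffOn_chartMetric (q : M) :
    ContDiffOn ℝ ∞ (chartMetric g q) (extChartAt (𝓡 m) q).target := by
  have hopen := isOpen_extChartAt_target (I := 𝓡 m) q
  refine contDiffOn_bil fun a b => ?_
  -- the coordinate vector fields of the chart are smooth sections of the tangent bundle
  have hsec : ∀ a : V m, ContMDiffOn 𝓘(ℝ, V m) ((𝓡 m).prod 𝓘(ℝ, V m)) ∞
      (fun y => (⟨(extChartAt (𝓡 m) q).symm y,
        mfderiv 𝓘(ℝ, V m) (𝓡 m) (extChartAt (𝓡 m) q).symm y a⟩ : TangentBundle (𝓡 m) M))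
      (extChartAt (𝓡 m) q).target := fun a => by
    have h1 := (contMDiffOn_extChartAt_symm (I := 𝓡 m) (n := ∞) q).contMDiffOn_tangentMapWithin
      (m := ∞) (by simp) hopen.uniqueMDiffOn
    have h2 : ContMDiff 𝓘(ℝ, V m) 𝓘(ℝ, V m).tangent ∞
        (fun y : V m => (⟨y, a⟩ : TangentBundle 𝓘(ℝ, V m) (V m))) :=
      contMDiff_vectorSpace_iff_contDiff.2 contDiff_const
    have h3 := h1.comp h2.contMDiffOn (s := (extChartAt (𝓡 m) q).target) (fun y hy => hy)
    refine h3.congr fun y hy => ?_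
    simp only [Function.comp_apply, tangentMapWithin]
    rw [mfderivWithin_of_isOpen hopen hy]
  intro y hy
  have hg := g.contMDiff ((extChartAt (𝓡 m) q).symm y)
  have h4 : ContMDiffAt 𝓘(ℝ, V m) ((𝓡 m).prod 𝓘(ℝ)) ∞
      (fun y => TotalSpace.mk' ℝ (E := Bundle.Trivial M ℝ) ((extChartAt (𝓡 m) q).symm y)
        (chartMetric g q y a b)) y :=
    ContMDiffAt.clm_bundle_apply₂ (F₁ := V m) (F₂ := V m)
      (hg.comp y (contMDiffAt_chart_symm q hy)) ((hsec a).contMDiffAt (hopen.mem_nhds hy))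
      ((hsec b).contMDiffAt (hopen.mem_nhds hy))
  simp only [contMDiffAt_totalSpace] at h4
  exact (contMDiffAt_iff_contDiffAt.1 h4.2).contDiffWithinAt

/-- Coefficients of the metric in a local parametrization, computed in the chart at `q`. -/
lemma metricIn_eq_of_chart (q : M) {F : V m → M} {φ : V m → V m} {x : V m}
    (hF : F =ᶠ[𝓝 x] fun y => (extChartAt (𝓡 m) q).symm (φ y)) (hφ : DifferentiableAt ℝ φ x)
    (hx : φ x ∈ (extChartAt (𝓡 m) q).target) :
    metricIn g F x = mat (pullBil (chartMetric g q (φ x)) (fderiv ℝ φ x)) := by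
  have h1 : mfderiv (𝓡 m) (𝓡 m) ((extChartAt (𝓡 m) q).symm ∘ φ) x
      = (mfderiv 𝓘(ℝ, V m) (𝓡 m) (extChartAt (𝓡 m) q).symm (φ x)).comp (fderiv ℝ φ x) := by
    rw [mfderiv_comp x (mdifferentiableAt_chart_symm q hx) hφ.mdifferentiableAt, mfderiv_eq_fderiv]
    rfl
  have h2 : F x = ((extChartAt (𝓡 m) q).symm ∘ φ) x := hF.self_of_nhds
  have h3 : mfderiv (𝓡 m) (𝓡 m) F x = mfderiv (𝓡 m) (𝓡 m) ((extChartAt (𝓡 m) q).symm ∘ φ) x :=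
    hF.mfderiv_eq
  have h4 : ∀ {q₁ q₂ : M}, q₁ = q₂ → ∀ u v : V m, g.inner q₁ u v = g.inner q₂ u v := by
    rintro _ _ rfl u v
    rfl
  ext a b
  simp only [metricIn, Matrix.of_apply, mat_apply, pullBil_apply, chartMetric_apply]
  rw [h3, h1]
  exact h4 h2 _ _

end Charts

section Geodesics

open Filter Topology

variable {m : ℕ}

lemma two_le_infty : (2 : WithTop ℕ∞) ≤ ∞ :=
  WithTop.coe_le_coe.2 (le_top : (2 : ℕ∞) ≤ ⊤)

/-- The Euclidean inner product as a bilinear form. -/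
def eucl (m : ℕ) : Bil m := LinearMap.toContinuousBilinearMap (innerₗ (V m))

@[simp] lemma eucl_apply (a b : V m) : eucl m a b = inner ℝ a b := rfl

variable {M : Type*} [TopologicalSpace M] [ChartedSpace (V m) M] [IsManifold (𝓡 m) ∞ M]
  (g : ContMDiffRiemannianMetric (𝓡 m) ∞ (V m) (fun q : M => TangentSpace (𝓡 m) q))

/-- The metric in the chart at `q` agrees near `q` with a smooth metric on all of `ℝ^m`, obtained
by interpolation with the Euclidean metric by means of a bump function. -/
lemma exists_global_metric (q : M) :
    ∃ H : V m → Bil m, ContDiff ℝ ∞ H ∧ (∀ x v, v ≠ 0 → 0 < H x v v) ∧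
      (∀ x a b, H x a b = H x b a) ∧ ∃ R : ℝ, 0 < R ∧
        ball (extChartAt (𝓡 m) q q) R ⊆ (extChartAt (𝓡 m) q).target ∧
        ∀ y ∈ ball (extChartAt (𝓡 m) q q) R, H y = chartMetric g q y := by
  set y₀ := extChartAt (𝓡 m) q q with hy₀
  have hopen := isOpen_extChartAt_target (I := 𝓡 m) q
  obtain ⟨r, hr, hrt⟩ := Metric.isOpen_iff.1 hopen y₀ (mem_extChartAt_target (I := 𝓡 m) q)
  let f : ContDiffBump y₀ := ⟨r / 3, r / 2, by positivity, by linarith⟩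
  have hsub : closedBall y₀ (r / 2) ⊆ (extChartAt (𝓡 m) q).target :=
    (closedBall_subset_ball (by linarith)).trans hrt
  have hzero : ∀ y, y ∉ closedBall y₀ (r / 2) → f y = 0 := fun y hy =>
    f.zero_of_le_dist (le_of_lt (by simpa [f] using hy))
  refine ⟨fun y => f y • chartMetric g q y + (1 - f y) • eucl m, ?_, fun x v hv => ?_,
    fun x a b => ?_, r / 3, by positivity, ?_, fun y hy => ?_⟩
  -- smoothness: outside of the chart the metric is locally Euclidean
  · refine contDiff_iff_contDiffAt.2 fun y => ?_
    by_cases hy : y ∈ (extChartAt (𝓡 m) q).target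
    · have h1 : ContDiffAt ℝ ∞ (chartMetric g q) y :=
        (contDiffOn_chartMetric g q).contDiffAt (hopen.mem_nhds hy)
      exact (f.contDiffAt.smul h1).add ((contDiffAt_const.sub f.contDiffAt).smul contDiffAt_const)
    · have hy' : (closedBall y₀ (r / 2))ᶜ ∈ 𝓝 y :=
        isClosed_closedBall.isOpen_compl.mem_nhds fun h => hy (hsub h)
      refine (contDiffAt_const (c := eucl m)).congr_of_eventuallyEq ?_
      filter_upwards [hy'] with z hz
      simp [hzero z hz]
  · have h2 : 0 < eucl m v v := real_inner_self_pos.2 hv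
    have hf0 : 0 ≤ f x := f.nonneg
    have hf1 : f x ≤ 1 := f.le_one
    simp only [_root_.add_apply, _root_.smul_apply, smul_eq_mul]
    by_cases hx : x ∈ (extChartAt (𝓡 m) q).target
    · have h3 := chartMetric_pos g q hx v hv
      rcases hf0.eq_or_lt with h0 | h0
      · rw [← h0]
        simpa using h2
      · exact add_pos_of_pos_of_nonneg (mul_pos h0 h3) (mul_nonneg (by linarith) h2.le)
    · rw [hzero x fun h => hx (hsub h)]
      simpa using h2
  · simp only [_root_.add_apply, _root_.smul_apply, eucl_apply, chartMetric_symm g q x a b,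
      real_inner_comm]
  · exact (ball_subset_closedBall.trans (closedBall_subset_closedBall (by linarith))).trans hsub
  · have : f y = 1 := f.one_of_mem_closedBall (ball_subset_closedBall hy)
    simp [this]

variable {g}

lemma contDiffAt_chart_comp {q : M} {c : ℝ → M} {t : ℝ} (hc : ContMDiffAt 𝓘(ℝ, ℝ) (𝓡 m) 2 c t)
    (ht : c t ∈ (extChartAt (𝓡 m) q).source) :
    ContDiffAt ℝ 2 (fun s => extChartAt (𝓡 m) q (c s)) t := by
  have h1 : ContMDiffAt (𝓡 m) 𝓘(ℝ, V m) 2 (extChartAt (𝓡 m) q) (c t) :=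
    (contMDiffAt_chart q ht).of_le two_le_infty
  exact contMDiffAt_iff_contDiffAt.1 (h1.comp t hc)

lemma contDiffAt_coord_change {q q' : M} {y : V m} (hy : y ∈ (extChartAt (𝓡 m) q').target)
    (hy' : (extChartAt (𝓡 m) q').symm y ∈ (extChartAt (𝓡 m) q).source) :
    ContDiffAt ℝ ∞ (fun z => extChartAt (𝓡 m) q ((extChartAt (𝓡 m) q').symm z)) y :=
  contMDiffAt_iff_contDiffAt.1 ((contMDiffAt_chart q hy').comp y (contMDiffAt_chart_symm q' hy))

/-- The geodesic equation does not depend on the chart. -/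
lemma geodesic_chart_iff {q : M} {c : ℝ → M} {t : ℝ} (hc : ContMDiffAt 𝓘(ℝ, ℝ) (𝓡 m) 2 c t)
    (ht : c t ∈ (extChartAt (𝓡 m) q).source) :
    (∀ k : Fin m, deriv (deriv fun τ => extChartAt (𝓡 m) (c t) (c τ)) t k
      + ∑ a, ∑ b, christoffel (metricIn g (extChartAt (𝓡 m) (c t)).symm) k a b
            (extChartAt (𝓡 m) (c t) (c t))
          * deriv (fun τ => extChartAt (𝓡 m) (c t) (c τ)) t a
          * deriv (fun τ => extChartAt (𝓡 m) (c t) (c τ)) t b = 0) ↔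
    ∀ w, chartMetric g q (extChartAt (𝓡 m) q (c t)) w
        (deriv (deriv fun τ => extChartAt (𝓡 m) q (c τ)) t)
      + lowChr (fderiv ℝ (chartMetric g q) (extChartAt (𝓡 m) q (c t))) w
        (deriv (fun τ => extChartAt (𝓡 m) q (c τ)) t)
        (deriv (fun τ => extChartAt (𝓡 m) q (c τ)) t) = 0 := by
  set q' := c t with hq'
  set v : ℝ → V m := fun τ => extChartAt (𝓡 m) q' (c τ) with hv
  set u : ℝ → V m := fun τ => extChartAt (𝓡 m) q (c τ) with hu
  set φ : V m → V m := fun z => extChartAt (𝓡 m) q ((extChartAt (𝓡 m) q').symm z) with hφ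
  set φ' : V m → V m := fun z => extChartAt (𝓡 m) q' ((extChartAt (𝓡 m) q).symm z) with hφ'
  have hsrc : c t ∈ (extChartAt (𝓡 m) q').source := mem_extChartAt_source (I := 𝓡 m) q'
  have hvt : v t ∈ (extChartAt (𝓡 m) q').target := (extChartAt (𝓡 m) q').map_source hsrc
  have hut : u t ∈ (extChartAt (𝓡 m) q).target := (extChartAt (𝓡 m) q).map_source ht
  have hinv : (extChartAt (𝓡 m) q').symm (v t) = c t := (extChartAt (𝓡 m) q').left_inv hsrc
  have hinv' : (extChartAt (𝓡 m) q).symm (u t) = c t := (extChartAt (𝓡 m) q).left_inv ht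
  have hφt : φ (v t) = u t := by rw [hφ]; simp only [hinv, hu]
  have hφs : ContDiffAt ℝ ∞ φ (v t) := contDiffAt_coord_change hvt (by rw [hinv]; exact ht)
  have hφs' : ContDiffAt ℝ ∞ φ' (u t) := contDiffAt_coord_change hut (by rw [hinv']; exact hsrc)
  have hv2 : ContDiffAt ℝ 2 v t := contDiffAt_chart_comp hc hsrc
  have hsymm_cont : ContinuousAt (extChartAt (𝓡 m) q').symm (v t) :=
    (contMDiffAt_chart_symm q' hvt).continuousAt
  -- near the point, both charts are defined and `φ ∘ v = u`
  have huv : u =ᶠ[𝓝 t] fun τ => φ (v τ) := by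
    filter_upwards [hc.continuousAt.preimage_mem_nhds
      (extChartAt_source_mem_nhds' (I := 𝓡 m) hsrc)] with τ hτ
    simp only [hu, hφ, hv]
    rw [(extChartAt (𝓡 m) q').left_inv hτ]
  have hnear : ∀ᶠ y in 𝓝 (v t), y ∈ (extChartAt (𝓡 m) q').target ∧
      (extChartAt (𝓡 m) q').symm y ∈ (extChartAt (𝓡 m) q).source := by
    refine Filter.Eventually.and ((isOpen_extChartAt_target (I := 𝓡 m) q').mem_nhds hvt)
      (hsymm_cont.preimage_mem_nhds ?_)
    rw [hinv]
    exact extChartAt_source_mem_nhds' (I := 𝓡 m) ht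
  -- the metrics in the two charts are related by pull-back along `φ`
  have hpull : ∀ᶠ y in 𝓝 (v t), ∀ a b, chartMetric g q' y a b
      = chartMetric g q (φ y) (fderiv ℝ φ y a) (fderiv ℝ φ y b) := by
    filter_upwards [hnear.eventually_nhds] with y hy a b
    have hy1 := hy.self_of_nhds
    have h1 : metricIn g (extChartAt (𝓡 m) q').symm y
        = mat (pullBil (chartMetric g q (φ y)) (fderiv ℝ φ y)) := by
      refine metricIn_eq_of_chart g q ?_
        ((contDiffAt_coord_change hy1.1 hy1.2).differentiableAt (by simp))
        ((extChartAt (𝓡 m) q).map_source hy1.2)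
      filter_upwards [hy] with z hz
      exact ((extChartAt (𝓡 m) q).left_inv hz.2).symm
    rw [metricIn_chart] at h1
    rw [mat_injective h1, pullBil_apply]
  have hdiff : ∀ (p : M) {y : V m}, y ∈ (extChartAt (𝓡 m) p).target →
      DifferentiableAt ℝ (chartMetric g p) y := fun p y hy =>
    ((contDiffOn_chartMetric g p).contDiffAt
      ((isOpen_extChartAt_target (I := 𝓡 m) p).mem_nhds hy)).differentiableAt (by simp)
  have hφ2 : ContDiffAt ℝ 2 φ (v t) := hφs.of_le two_le_infty
  obtain ⟨hd1, hd2⟩ := deriv_deriv_comp hφ2 hv2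
  have hu1 : deriv u t = fderiv ℝ φ (v t) (deriv v t) := by rw [huv.deriv_eq, hd1]
  have hu2 : deriv (deriv u) t = fderiv ℝ φ (v t) (deriv (deriv v) t)
      + fderiv ℝ (fderiv ℝ φ) (v t) (deriv v t) (deriv v t) := by
    rw [← hd2]
    exact (huv.deriv).deriv_eq
  rw [geodesic_equation_iff (H := chartMetric g q')
    (Eventually.of_forall fun y => metricIn_chart g q' y)
    (hdiff q' hvt) (chartMetric_pos g q' hvt)]
  -- the lowered geodesic equation is natural under the coordinate change `φ`
  have key : ∀ w, chartMetric g q' (v t) w (deriv (deriv v) t)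
      + lowChr (fderiv ℝ (chartMetric g q') (v t)) w (deriv v t) (deriv v t)
      = chartMetric g q (u t) (fderiv ℝ φ (v t) w) (deriv (deriv u) t)
        + lowChr (fderiv ℝ (chartMetric g q) (u t)) (fderiv ℝ φ (v t) w) (deriv u t)
          (deriv u t) := fun w => by
    rw [lowered_geodesic_pullback hφ2 (by rw [hφt]; exact hdiff q hut) (hdiff q' hvt)
      (fun a b => chartMetric_symm g q _ a b) hpull, hφt, hu1, hu2]
  constructor
  · intro h w
    -- the derivative of `φ` is onto, so that all test vectors are of the form `φ_* w`
    have h3 : fderiv ℝ φ (v t) (fderiv ℝ φ' (u t) w) = w := by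
      have h4 : (fun z => φ (φ' z)) =ᶠ[𝓝 (u t)] id := by
        have hc' : ContinuousAt (extChartAt (𝓡 m) q).symm (u t) :=
          (contMDiffAt_chart_symm q hut).continuousAt
        have h5 : ∀ᶠ z in 𝓝 (u t), (extChartAt (𝓡 m) q).symm z ∈ (extChartAt (𝓡 m) q').source := by
          refine hc'.preimage_mem_nhds ?_
          rw [hinv']
          exact extChartAt_source_mem_nhds' (I := 𝓡 m) hsrc
        filter_upwards [h5, (isOpen_extChartAt_target (I := 𝓡 m) q).mem_nhds hut] with z hz hz'
        simp only [hφ, hφ']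
        rw [(extChartAt (𝓡 m) q').left_inv hz, (extChartAt (𝓡 m) q).right_inv hz', id]
      have hφ'u : φ' (u t) = v t := by simp only [hφ', hinv', hv]
      have h6 : HasFDerivAt φ (fderiv ℝ φ (v t)) (φ' (u t)) := by
        rw [hφ'u]
        exact (hφs.differentiableAt (by simp)).hasFDerivAt
      have h7 := (h6.comp (u t) (hφs'.differentiableAt (by simp)).hasFDerivAt).fderiv
      have h8 : fderiv ℝ (fun z => φ (φ' z)) (u t) = ContinuousLinearMap.id ℝ (V m) := by
        rw [h4.fderiv_eq, fderiv_id]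
      have h9 := h7.symm.trans h8
      exact congrArg (fun L => L w) h9
    have h10 := h (fderiv ℝ φ' (u t) w)
    rw [key, h3] at h10
    exact h10
  · intro h w
    rw [key]
    exact h _

end Geodesics

section ExpMap

open Filter Topology

variable {m : ℕ} {M : Type*} [TopologicalSpace M] [ChartedSpace (V m) M] [IsManifold (𝓡 m) ∞ M]
  {g : ContMDiffRiemannianMetric (𝓡 m) ∞ (V m) (fun q : M => TangentSpace (𝓡 m) q)}

lemma IsCoordGeodesic.contDiffAt {H : V m → Bil m} (hH : ContDiff ℝ ∞ H)
    (hpos : ∀ x v, v ≠ 0 → 0 < H x v v) {y₀ v₀ : V m} {c v : ℝ → V m}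
    (h : IsCoordGeodesic H y₀ v₀ c v) {t : ℝ} (ht : t ∈ Ioo (-1 : ℝ) 2) : ContDiffAt ℝ 2 c t := by
  have hX : Continuous (geodesicField H) := (contDiff_geodesicField hH hpos).continuous
  have hcv : ContinuousOn (fun s => (c s, v s)) (Ioo (-1) 2) := fun s hs =>
    (h.hasDerivAt_prod hs).continuousAt.continuousWithinAt
  have hv : ContDiffOn ℝ 1 v (Ioo (-1) 2) := by
    rw [show (1 : WithTop ℕ∞) = 0 + 1 from rfl, contDiffOn_succ_iff_deriv_of_isOpen isOpen_Ioo]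
    refine ⟨fun s hs => (h.hasDerivAt_vel s hs).differentiableAt.differentiableWithinAt,
      by simp, contDiffOn_zero.2 ?_⟩
    have h1 : ContinuousOn (fun s => (geodesicField H (c s, v s)).2) (Ioo (-1) 2) :=
      continuous_snd.comp_continuousOn (hX.comp_continuousOn hcv)
    exact h1.congr fun s hs => (h.hasDerivAt_vel s hs).deriv
  have hc : ContDiffOn ℝ 2 c (Ioo (-1) 2) := by
    rw [show (2 : WithTop ℕ∞) = 1 + 1 from (one_add_one_eq_two).symm,
      contDiffOn_succ_iff_deriv_of_isOpen isOpen_Ioo]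
    exact ⟨fun s hs => (h.hasDerivAt s hs).differentiableAt.differentiableWithinAt, by simp,
      hv.congr fun s hs => (h.hasDerivAt s hs).deriv⟩
  exact hc.contDiffAt (isOpen_Ioo.mem_nhds ht)

/-- The geodesic equation in the chart at `q`, in terms of a metric on `ℝ^m` that agrees near the
point with the metric in this chart. -/
lemma geodesic_chart_iff' {H : V m → Bil m} (hH : ContDiff ℝ ∞ H)
    (hpos : ∀ x v, v ≠ 0 → 0 < H x v v) {q : M} {c : ℝ → M} {t : ℝ}
    (hc : ContMDiffAt 𝓘(ℝ, ℝ) (𝓡 m) 2 c t) (ht : c t ∈ (extChartAt (𝓡 m) q).source)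
    (hHg : H =ᶠ[𝓝 (extChartAt (𝓡 m) q (c t))] chartMetric g q) :
    (∀ k : Fin m, deriv (deriv fun τ => extChartAt (𝓡 m) (c t) (c τ)) t k
      + ∑ a, ∑ b, christoffel (metricIn g (extChartAt (𝓡 m) (c t)).symm) k a b
            (extChartAt (𝓡 m) (c t) (c t))
          * deriv (fun τ => extChartAt (𝓡 m) (c t) (c τ)) t a
          * deriv (fun τ => extChartAt (𝓡 m) (c t) (c τ)) t b = 0) ↔
    deriv (deriv fun τ => extChartAt (𝓡 m) q (c τ)) t
      = -chrVec (fun y => mat (H y)) (extChartAt (𝓡 m) q (c t))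
        (deriv (fun τ => extChartAt (𝓡 m) q (c τ)) t)
        (deriv (fun τ => extChartAt (𝓡 m) q (c τ)) t) := by
  rw [geodesic_chart_iff hc ht, ← hHg.self_of_nhds, ← hHg.fderiv_eq]
  set a := deriv (deriv fun τ => extChartAt (𝓡 m) q (c τ)) t
  set b := deriv (fun τ => extChartAt (𝓡 m) q (c τ)) t
  set x := extChartAt (𝓡 m) q (c t)
  have h1 : ∀ w, H x w a + lowChr (fderiv ℝ H x) w b b
      = H x w (a + chrVec (fun y => mat (H y)) x b b) := fun w => by
    rw [map_add, apply_chrVec (Eventually.of_forall fun y => rfl)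
      (hH.differentiable (by simp) x) (isUnit_det_mat (hpos x))]
  simp only [h1]
  constructor
  · intro h
    exact eq_neg_of_add_eq_zero_left (eq_zero_of_forall_bil (hpos x) h)
  · intro h w
    rw [h, neg_add_cancel, map_zero]

/-- A geodesic of the coordinate metric is a geodesic of the manifold. -/
lemma IsCoordGeodesic.isGeodesicOn {H : V m → Bil m} (hH : ContDiff ℝ ∞ H)
    (hpos : ∀ x v, v ≠ 0 → 0 < H x v v) {q : M} {B : Set (V m)} (hB : IsOpen B)
    (hBt : B ⊆ (extChartAt (𝓡 m) q).target) (hHg : ∀ y ∈ B, H y = chartMetric g q y)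
    {y₀ v₀ : V m} {c v : ℝ → V m} (h : IsCoordGeodesic H y₀ v₀ c v) (hcB : ∀ t, c t ∈ B) :
    IsGeodesicOn g (fun t => (extChartAt (𝓡 m) q).symm (c t)) (Ioo (-1) 2) := by
  have hsm : ∀ t ∈ Ioo (-1 : ℝ) 2,
      ContMDiffAt 𝓘(ℝ, ℝ) (𝓡 m) 2 (fun t => (extChartAt (𝓡 m) q).symm (c t)) t := fun t ht =>
    ((contMDiffAt_chart_symm q (hBt (hcB t))).of_le two_le_infty).comp t
      (contMDiffAt_iff_contDiffAt.2 (h.contDiffAt hH hpos ht))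
  refine ⟨fun t ht => (hsm t ht).contMDiffWithinAt, fun t ht => ?_⟩
  have hright : ∀ s, extChartAt (𝓡 m) q ((extChartAt (𝓡 m) q).symm (c s)) = c s := fun s =>
    (extChartAt (𝓡 m) q).right_inv (hBt (hcB s))
  refine (geodesic_chart_iff' (q := q) hH hpos (hsm t ht)
    ((extChartAt (𝓡 m) q).map_target (hBt (hcB t))) ?_).2 ?_
  · rw [hright]
    filter_upwards [hB.mem_nhds (hcB t)] with y hy using hHg y hy
  · simp only [hright]
    have h1 : deriv c =ᶠ[𝓝 t] v := by
      filter_upwards [isOpen_Ioo.mem_nhds ht] with s hs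
      exact (h.hasDerivAt s hs).deriv
    rw [h1.deriv_eq, h1.self_of_nhds]
    exact (h.hasDerivAt_vel t ht).deriv

/-- The velocity of a curve in a chart. -/
lemma deriv_chart_comp {q : M} {c : ℝ → M} {t : ℝ} (hc : MDifferentiableAt 𝓘(ℝ, ℝ) (𝓡 m) c t)
    (ht : c t ∈ (extChartAt (𝓡 m) q).source) :
    deriv (fun τ => extChartAt (𝓡 m) q (c τ)) t
      = mfderiv (𝓡 m) 𝓘(ℝ, V m) (extChartAt (𝓡 m) q) (c t) (mfderiv 𝓘(ℝ, ℝ) (𝓡 m) c t (1 : ℝ)) := by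
  have h1 : mfderiv 𝓘(ℝ, ℝ) 𝓘(ℝ, V m) (extChartAt (𝓡 m) q ∘ c) t
      = (mfderiv (𝓡 m) 𝓘(ℝ, V m) (extChartAt (𝓡 m) q) (c t)).comp
          (mfderiv 𝓘(ℝ, ℝ) (𝓡 m) c t) :=
    mfderiv_comp t (mdifferentiableAt_chart q ht) hc
  rw [mfderiv_eq_fderiv] at h1
  exact congrArg (fun L => L (1 : ℝ)) h1

variable [T2Space M]

/-- Uniqueness of geodesics: a geodesic of the manifold agrees with the geodesic of the coordinate
metric that has the same initial data. -/
lemma IsCoordGeodesic.eq_of_isGeodesicOn {H : V m → Bil m} (hH : ContDiff ℝ ∞ H)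
    (hpos : ∀ x v, v ≠ 0 → 0 < H x v v) {q : M} {B : Set (V m)} (hB : IsOpen B)
    (hBt : B ⊆ (extChartAt (𝓡 m) q).target) (hHg : ∀ y ∈ B, H y = chartMetric g q y)
    {y₀ v₀ : V m} {c v : ℝ → V m} (h : IsCoordGeodesic H y₀ v₀ c v) (hcB : ∀ t, c t ∈ B)
    {γ : ℝ → M} {s : Set ℝ} (hs : IsOpen s) (hs1 : Icc 0 1 ⊆ s) (hγ : IsGeodesicOn g γ s)
    (h0 : γ 0 = (extChartAt (𝓡 m) q).symm y₀)
    (h1 : deriv (fun τ => extChartAt (𝓡 m) q (γ τ)) 0 = v₀) :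
    γ 1 = (extChartAt (𝓡 m) q).symm (c 1) := by
  set ψ := extChartAt (𝓡 m) q with hψ
  set u : ℝ → V m := fun τ => ψ (γ τ) with hu
  have hX : ContDiff ℝ 1 (geodesicField H) :=
    (contDiff_geodesicField hH hpos).of_le (by exact_mod_cast le_top)
  have hγs : ∀ t ∈ s, ContMDiffAt 𝓘(ℝ, ℝ) (𝓡 m) 2 γ t := fun t ht =>
    hγ.smooth.contMDiffAt (hs.mem_nhds ht)
  have hIoo : ∀ {t : ℝ}, t ∈ Icc (0 : ℝ) 1 → t ∈ Ioo (-1 : ℝ) 2 := fun ht =>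
    ⟨by linarith [ht.1], by linarith [ht.2]⟩
  have hcc : ∀ t ∈ Icc (0 : ℝ) 1, ContinuousAt c t := fun t ht =>
    (h.hasDerivAt t (hIoo ht)).continuousAt
  have hsymm : ∀ t ∈ Icc (0 : ℝ) 1, ContinuousAt (fun τ => ψ.symm (c τ)) t := fun t ht =>
    ContinuousAt.comp (f := c) (contMDiffAt_chart_symm q (hBt (hcB t))).continuousAt (hcc t ht)
  have hsrc : ∀ {t}, γ t = ψ.symm (c t) → γ t ∈ ψ.source ∧ u t = c t := fun {t} ht => by
    refine ⟨ht ▸ ψ.map_target (hBt (hcB t)), ?_⟩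
    simp only [hu, ht]
    exact ψ.right_inv (hBt (hcB t))
  have hderiv_cont : ∀ t ∈ s, γ t ∈ ψ.source → ContinuousAt (deriv u) t := fun t ht hts => by
    have h2 : ContDiffAt ℝ 2 u t := contDiffAt_chart_comp (hγs t ht) hts
    have h3 := h2.fderiv_right (m := 1) (by norm_num)
    exact (h3.clm_apply contDiffAt_const).continuousAt
  -- the set of times up to which both curves agree to first order is closed and open
  set A : Set ℝ := {t | γ t = ψ.symm (c t) ∧ deriv u t = v t} with hA
  have key : Icc (0 : ℝ) 1 ⊆ A := by
    refine IsClosed.Icc_subset_of_forall_mem_nhdsWithin ?_ ?_ ?_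
    -- closedness: limits of continuous curves are unique, the manifold being Hausdorff
    · refine isClosed_of_closure_subset fun t ht => ?_
      have htI : t ∈ Icc (0 : ℝ) 1 :=
        isClosed_Icc.closure_subset_iff.2 inter_subset_right ht
      have hfr : ∃ᶠ τ in 𝓝 t, τ ∈ A :=
        (mem_closure_iff_frequently.1 ht).mono fun τ hτ => hτ.1
      have e1 : γ t = ψ.symm (c t) :=
        tendsto_nhds_unique_of_frequently_eq (hγs t (hs1 htI)).continuousAt (hsymm t htI)
          (hfr.mono fun τ hτ => hτ.1)
      have e2 : deriv u t = v t :=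
        tendsto_nhds_unique_of_frequently_eq (hderiv_cont t (hs1 htI) (hsrc e1).1)
          (h.hasDerivAt_vel t (hIoo htI)).continuousAt (hfr.mono fun τ hτ => hτ.2)
      exact ⟨⟨e1, e2⟩, htI⟩
    · have : γ 0 = ψ.symm (c 0) := by rw [h0, h.init]
      exact ⟨this, by rw [h1, h.init_vel]⟩
    · rintro t ⟨⟨e1, e2⟩, htI⟩
      have htI' : t ∈ Icc (0 : ℝ) 1 := Ico_subset_Icc_self htI
      have hts := hs1 htI'
      obtain ⟨hsrc1, hut⟩ := hsrc e1
      -- openness: local uniqueness for the geodesic vector field, which is Lipschitz near the common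
      -- value
      obtain ⟨Kc, N, hN, hlip⟩ := (hX.contDiffAt (x := (c t, v t))).exists_lipschitzOnWith
      have huc : ContinuousAt u t := (contDiffAt_chart_comp (hγs t hts) hsrc1).continuousAt
      have hup : ContinuousAt (fun τ => (u τ, deriv u τ)) t :=
        huc.prodMk (hderiv_cont t hts hsrc1)
      have hev1 : ∀ᶠ τ in 𝓝 t, HasDerivAt (fun τ => (u τ, deriv u τ))
          (geodesicField H (u τ, deriv u τ)) τ ∧ (u τ, deriv u τ) ∈ N := by
        have a1 : ∀ᶠ τ in 𝓝 t, γ τ ∈ ψ.source :=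
          (hγs t hts).continuousAt.preimage_mem_nhds (extChartAt_source_mem_nhds' (I := 𝓡 m) hsrc1)
        have a2 : ∀ᶠ τ in 𝓝 t, u τ ∈ B := huc.preimage_mem_nhds (hB.mem_nhds (hut ▸ hcB t))
        have a3 : ∀ᶠ τ in 𝓝 t, (u τ, deriv u τ) ∈ N :=
          hup.preimage_mem_nhds (by simpa only [hut, e2] using hN)
        filter_upwards [a1, a2, a3, hs.mem_nhds hts] with τ b1 b2 b3 b4
        refine ⟨?_, b3⟩
        have c1 : ContDiffAt ℝ 2 u τ := contDiffAt_chart_comp (hγs τ b4) b1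
        have c2 : HasDerivAt u (deriv u τ) τ := (c1.differentiableAt (by simp)).hasDerivAt
        have c3 : HasDerivAt (deriv u) (deriv (deriv u) τ) τ := by
          have h3 := c1.fderiv_right (m := 1) (by norm_num)
          have h4 : ContDiffAt ℝ 1 (deriv u) τ := h3.clm_apply contDiffAt_const
          exact (h4.differentiableAt (by simp)).hasDerivAt
        have c4 : deriv (deriv u) τ
            = -chrVec (fun y => mat (H y)) (u τ) (deriv u τ) (deriv u τ) := by
          refine (geodesic_chart_iff' (g := g) (q := q) hH hpos (hγs τ b4) b1 ?_).1
            (hγ.equation τ b4)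
          filter_upwards [hB.mem_nhds b2] with y hy using hHg y hy
        rw [c4] at c3
        exact c2.prodMk c3
      have hev2 : ∀ᶠ τ in 𝓝 t, HasDerivAt (fun τ => (c τ, v τ))
          (geodesicField H (c τ, v τ)) τ ∧ (c τ, v τ) ∈ N := by
        have a3 : ∀ᶠ τ in 𝓝 t, (c τ, v τ) ∈ N :=
          ((hcc t htI').prodMk (h.hasDerivAt_vel t (hIoo htI')).continuousAt).preimage_mem_nhds hN
        filter_upwards [a3, isOpen_Ioo.mem_nhds (hIoo htI')] with τ b3 b4
        exact ⟨h.hasDerivAt_prod b4, b3⟩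
      have heq := ODE_solution_unique_of_eventually (v := fun _ => geodesicField H)
        (s := fun _ => N) (Eventually.of_forall fun _ => hlip) hev1 hev2
        (by rw [hut, e2])
      refine mem_nhdsWithin_of_mem_nhds ?_
      filter_upwards [heq, (hγs t hts).continuousAt.preimage_mem_nhds
        (extChartAt_source_mem_nhds' (I := 𝓡 m) hsrc1)] with τ hτ hτs
      have d1 : u τ = c τ := congrArg Prod.fst hτ
      exact ⟨by rw [← d1, hu]; exact (ψ.left_inv hτs).symm, congrArg Prod.snd hτ⟩
  exact (key (right_mem_Icc.2 zero_le_one)).1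

/-- The exponential map in the chart at `q`. -/
lemma expMap_eq_of_isCoordGeodesic {H : V m → Bil m} (hH : ContDiff ℝ ∞ H)
    (hpos : ∀ x v, v ≠ 0 → 0 < H x v v) {q : M} {B : Set (V m)} (hB : IsOpen B)
    (hBt : B ⊆ (extChartAt (𝓡 m) q).target) (hHg : ∀ y ∈ B, H y = chartMetric g q y)
    {p : M} (hp : p ∈ (extChartAt (𝓡 m) q).source) (w : TangentSpace (𝓡 m) p) {c v : ℝ → V m}
    (h : IsCoordGeodesic H (extChartAt (𝓡 m) q p)
      (mfderiv (𝓡 m) 𝓘(ℝ, V m) (extChartAt (𝓡 m) q) p w) c v) (hcB : ∀ t, c t ∈ B) :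
    expMap g p w = (extChartAt (𝓡 m) q).symm (c 1) := by
  set ψ := extChartAt (𝓡 m) q with hψ
  have hgeo := h.isGeodesicOn hH hpos hB hBt hHg hcB
  have h0 : (0 : ℝ) ∈ Ioo (-1 : ℝ) 2 := by norm_num
  have hex : IsExp g p w (ψ.symm (c 1)) := by
    refine ⟨fun t => ψ.symm (c t), 1, one_pos, by norm_num; exact hgeo, ?_, rfl⟩
    have hd : MDifferentiableAt 𝓘(ℝ, ℝ) (𝓡 m) (fun t => ψ.symm (c t)) 0 :=
      (hgeo.smooth.contMDiffAt (isOpen_Ioo.mem_nhds h0)).mdifferentiableAt (by simp)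
    have hc0 : ψ.symm (c 0) = p := by rw [h.init]; exact ψ.left_inv hp
    have hvel := deriv_chart_comp (q := q) hd (by simp only [hc0]; exact hp)
    have hvel2 : deriv (fun τ => ψ (ψ.symm (c τ))) 0
        = mfderiv (𝓡 m) 𝓘(ℝ, V m) ψ p w := by
      have e1 : (fun τ => ψ (ψ.symm (c τ))) = c := funext fun τ => ψ.right_inv (hBt (hcB τ))
      rw [e1, (h.hasDerivAt 0 h0).deriv, h.init_vel]
    rw [hvel2] at hvel
    clear hvel2 h hgeo
    -- two tangent vectors at the same point agree if their images in the chart do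
    have aux : ∀ {p₁ p₂ : M} (w₁ : TangentSpace (𝓡 m) p₁) (w₂ : TangentSpace (𝓡 m) p₂),
        p₁ = p₂ → p₂ ∈ ψ.source → (mfderiv (𝓡 m) 𝓘(ℝ, V m) ψ p₂ w₂ : V m)
          = (mfderiv (𝓡 m) 𝓘(ℝ, V m) ψ p₁ w₁ : V m) →
        (⟨p₁, w₁⟩ : TangentBundle (𝓡 m) M) = ⟨p₂, w₂⟩ := by
      rintro p₁ _ w₁ w₂ rfl hs he
      have e2 := mfderiv_symm_comp_chart q hs w₁
      have e3 := mfderiv_symm_comp_chart q hs w₂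
      have e4 : w₁ = w₂ := e2.symm.trans ((congrArg _ he.symm).trans e3)
      rw [e4]
    exact aux _ _ hc0 hp hvel
  -- the value chosen in the definition of `expMap` is the endpoint of another geodesic with the same
  -- initial data, so uniqueness of geodesics applies
  have hexists : ∃ q', IsExp g p w q' := ⟨_, hex⟩
  rw [expMap, dif_pos hexists]
  obtain ⟨γ, ε, hε, hγ, hinit, hγ1⟩ := hexists.choose_spec
  rw [← hγ1]
  have hI : Icc (0 : ℝ) 1 ⊆ Ioo (-ε) (1 + ε) := fun t ht =>
    ⟨by linarith [ht.1], by linarith [ht.2]⟩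
  have hd : MDifferentiableAt 𝓘(ℝ, ℝ) (𝓡 m) γ 0 :=
    (hγ.smooth.contMDiffAt (isOpen_Ioo.mem_nhds (hI (left_mem_Icc.2 zero_le_one)))).mdifferentiableAt
      (by simp)
  have hγ0 : γ 0 = p := congrArg TotalSpace.proj hinit
  refine h.eq_of_isGeodesicOn hH hpos hB hBt hHg hcB isOpen_Ioo hI hγ ?_ ?_
  · rw [hγ0]
    exact (ψ.left_inv hp).symm
  · rw [deriv_chart_comp hd (by rw [hγ0]; exact hp)]
    have aux : ∀ {x y : TangentBundle (𝓡 m) M}, x = y →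
        (mfderiv (𝓡 m) 𝓘(ℝ, V m) ψ x.proj x.2 : V m)
          = (mfderiv (𝓡 m) 𝓘(ℝ, V m) ψ y.proj y.2 : V m) := by
      rintro x _ rfl
      rfl
    exact aux hinit

end ExpMap

/-! ### Normal coordinates -/

section NormalCoordinates

open Filter Topology

variable {m : ℕ}

/-- The parameters of normal coordinates: the coordinates, in a fixed chart, of a point and of a
basis of the tangent space at this point. -/
abbrev Par (m : ℕ) : Type := V m × (Fin m → V m)

/-- The vector `∑ x_i E_i`. -/
def frameVec (κ : Par m) (x : V m) : V m := ∑ i, x i • κ.2 i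

lemma contDiff_frameVec : ContDiff ℝ ∞ fun z : Par m × V m => frameVec z.1 z.2 := by
  unfold frameVec
  refine ContDiff.sum fun i _ => ?_
  have h1 : ContDiff ℝ ∞ fun z : Par m × V m => z.2 i := contDiff_euclidean.1 contDiff_snd i
  have h2 : ContDiff ℝ ∞ fun z : Par m × V m => z.1.2 i :=
    (contDiff_apply ℝ (V m) i).comp (contDiff_snd.comp contDiff_fst)
  exact h1.smul h2

lemma frameVec_smul (κ : Par m) (s : ℝ) (x : V m) : frameVec κ (s • x) = s • frameVec κ x := by
  simp only [frameVec, PiLp.smul_apply, smul_eq_mul, Finset.smul_sum, smul_smul]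

lemma frameVec_zero (κ : Par m) : frameVec κ 0 = 0 := by
  simpa using frameVec_smul κ 0 0

/-- A neighbourhood of `K × {0}`, with `K` compact, contains a product `K × ball 0 ε`. -/
lemma exists_ball_of_isCompact {A : Type*} [TopologicalSpace A] {K : Set A} (hK : IsCompact K)
    {S : Set (A × V m)} (hS : IsOpen S) (h : ∀ κ ∈ K, (κ, (0 : V m)) ∈ S) :
    ∃ ε : ℝ, 0 < ε ∧ ∀ κ ∈ K, ∀ x ∈ ball (0 : V m) ε, (κ, x) ∈ S := by
  obtain ⟨u, v, _, hv, hKu, h0v, huv⟩ := generalized_tube_lemma hK (isCompact_singleton (x := (0 : V m)))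
    hS (by rintro ⟨κ, x⟩ ⟨h1, rfl⟩; exact h κ h1)
  obtain ⟨ε, hε, hb⟩ := Metric.isOpen_iff.1 hv 0 (h0v rfl)
  exact ⟨ε, hε, fun κ hκ x hx => huv ⟨hKu hκ, hb hx⟩⟩

/-- Frames that are orthonormal for a continuous metric form a compact set over a closed ball. -/
lemma isCompact_orthonormal {H : V m → Bil m} (hH : Continuous H)
    (hpos : ∀ x v, v ≠ 0 → 0 < H x v v) (y₀ : V m) (r : ℝ) :
    IsCompact {κ : Par m | κ.1 ∈ closedBall y₀ r ∧
      ∀ i j, H κ.1 (κ.2 i) (κ.2 j) = if i = j then 1 else 0} := by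
  have hcont : Continuous fun z : V m × V m => H z.1 z.2 z.2 :=
    ((hH.comp continuous_fst).clm_apply continuous_snd).clm_apply continuous_snd
  -- the metric is bounded from below on the closed ball, by compactness of the unit sphere bundle
  have hlow : ∃ c : ℝ, 0 < c ∧ ∀ y ∈ closedBall y₀ r, ∀ v, c * ‖v‖ ^ 2 ≤ H y v v := by
    have hcomp : IsCompact (closedBall y₀ r ×ˢ sphere (0 : V m) 1) :=
      (isCompact_closedBall _ _).prod (isCompact_sphere _ _)
    rcases (closedBall y₀ r ×ˢ sphere (0 : V m) 1).eq_empty_or_nonempty with he | hne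
    · refine ⟨1, one_pos, fun y hy v => ?_⟩
      by_cases hv : v = 0
      · simp [hv]
      · have : (y, ‖v‖⁻¹ • v) ∈ closedBall y₀ r ×ˢ sphere (0 : V m) 1 :=
          ⟨hy, by simp [norm_smul, hv]⟩
        rw [he] at this
        exact this.elim
    · obtain ⟨z, hz, hmin⟩ := hcomp.exists_isMinOn hne hcont.continuousOn
      have hz0 : z.2 ≠ 0 := ne_zero_of_mem_unit_sphere ⟨z.2, hz.2⟩
      refine ⟨H z.1 z.2 z.2, hpos _ _ hz0, fun y hy v => ?_⟩
      by_cases hv : v = 0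
      · simp [hv]
      · have h1 : (y, ‖v‖⁻¹ • v) ∈ closedBall y₀ r ×ˢ sphere (0 : V m) 1 :=
          ⟨hy, by simp [norm_smul, hv]⟩
        have h2 : H z.1 z.2 z.2 ≤ H y (‖v‖⁻¹ • v) (‖v‖⁻¹ • v) := hmin h1
        have hn : 0 < ‖v‖ := norm_pos_iff.2 hv
        simp only [map_smul, _root_.smul_apply, smul_eq_mul] at h2
        calc _ ≤ (‖v‖⁻¹ * (‖v‖⁻¹ * H y v v)) * ‖v‖ ^ 2 :=
              mul_le_mul_of_nonneg_right h2 (by positivity)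
          _ = H y v v := by field_simp
  obtain ⟨c, hc, hlow⟩ := hlow
  refine Metric.isCompact_of_isClosed_isBounded ?_ ?_
  · have hi : ∀ i : Fin m, Continuous fun κ : Par m => κ.2 i := fun i =>
      (continuous_apply i).comp continuous_snd
    have he : {κ : Par m | κ.1 ∈ closedBall y₀ r ∧
        ∀ i j, H κ.1 (κ.2 i) (κ.2 j) = if i = j then 1 else 0} =
        (Prod.fst ⁻¹' closedBall y₀ r) ∩ ⋂ i, ⋂ j, {κ : Par m |
          H κ.1 (κ.2 i) (κ.2 j) = if i = j then 1 else 0} := by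
      ext κ
      simp
    rw [he]
    refine IsClosed.inter (isClosed_closedBall.preimage continuous_fst) ?_
    refine isClosed_iInter fun i => isClosed_iInter fun j => isClosed_eq ?_ continuous_const
    exact ((hH.comp continuous_fst).clm_apply (hi i)).clm_apply (hi j)
  · refine ((isBounded_closedBall (x := y₀) (r := r)).prod
      (isBounded_closedBall (x := (0 : Fin m → V m)) (r := √(c⁻¹)))).subset ?_
    rintro ⟨y, E⟩ ⟨hy, hE⟩
    refine ⟨hy, ?_⟩
    rw [mem_closedBall_zero_iff, pi_norm_le_iff_of_nonneg (Real.sqrt_nonneg _)]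
    intro i
    have h1 := hlow y hy (E i)
    have h2 := hE i i
    simp only [if_true] at h2
    rw [h2] at h1
    refine Real.le_sqrt_of_sq_le ?_
    rwa [inv_eq_one_div, le_div_iff₀ hc, mul_comm]

/-- A family of metrics in normal coordinates, with parameters in the compact set `K`: the
coefficients depend smoothly on all variables, are Euclidean at the centre, and the radial lines in
the ball of radius `ε` satisfy the geodesic equation, in its lowered form. -/
structure IsNormalFamily {P : Type*} [NormedAddCommGroup P] [NormedSpace ℝ P] (K : Set P) (ε : ℝ)
    (H : P × V m → Bil m) : Prop where
  isCompact : IsCompact K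
  pos : 0 < ε
  smooth : ContDiff ℝ ∞ H
  symm : ∀ z a b, H z a b = H z b a
  zero : ∀ κ ∈ K, H (κ, 0) = eucl m
  radial : ∀ κ ∈ K, ∀ x ∈ ball (0 : V m) ε, ∀ w,
    lowChr (fderiv ℝ (fun y => H (κ, y)) x) w x x = 0

/-- The metrics in normal coordinates, pulled back from a metric on `ℝ^m` by its exponential map
and parametrized by the base point and the orthonormal frame, are a normal family. -/
lemma exists_normal_family_of_metric {H : V m → Bil m} (hH : ContDiff ℝ ∞ H)
    (hpos : ∀ x v, v ≠ 0 → 0 < H x v v) (hsymm : ∀ x a b, H x a b = H x b a) (y₀ : V m)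
    {B : Set (V m)} (hB : B ∈ 𝓝 y₀) :
    ∃ (sol vel : V m → V m → ℝ → V m) (ε₁ ε₂ : ℝ) (Z : Par m × V m → V m)
      (HN : Par m × V m → Bil m), 0 < ε₁ ∧
      (∀ y ∈ closedBall y₀ ε₁, ∀ v ∈ ball (0 : V m) ε₁,
        IsCoordGeodesic H y v (sol y v) (vel y v) ∧ ∀ t, sol y v t ∈ B) ∧
      IsNormalFamily {κ : Par m | κ.1 ∈ closedBall y₀ ε₁ ∧
        ∀ i j, H κ.1 (κ.2 i) (κ.2 j) = if i = j then 1 else 0} ε₂ HN ∧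
      ContDiff ℝ ∞ Z ∧
      (∀ z, HN z = pullBil (H (Z z)) (fderiv ℝ (fun y => Z (z.1, y)) z.2)) ∧
      ∀ κ : Par m, κ.1 ∈ closedBall y₀ ε₁ →
        (∀ i j, H κ.1 (κ.2 i) (κ.2 j) = if i = j then 1 else 0) → ∀ x ∈ ball (0 : V m) ε₂,
        frameVec κ x ∈ ball (0 : V m) ε₁ ∧ Z (κ, x) = sol κ.1 (frameVec κ x) 1 := by
  obtain ⟨sol, vel, ε, hε, hsol⟩ := exists_geodesics hH hpos y₀ hB
  -- a bump function extends the exponential map to a smooth map on the whole space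
  let f : ContDiffBump ((y₀, 0) : V m × V m) := ⟨ε / 3, ε / 2, by positivity, by linarith⟩
  set Y : V m × V m → V m := fun p => f p • sol p.1 p.2 1 with hY
  have hYs : ContDiff ℝ ∞ Y := by
    refine contDiff_iff_contDiffAt.2 fun p => ?_
    by_cases hp : p ∈ ball ((y₀, 0) : V m × V m) ε
    · rw [← ball_prod_same] at hp
      exact f.contDiffAt.smul (hsol p.1 hp.1 p.2 hp.2).2.2
    · have hp' : (closedBall ((y₀, 0) : V m × V m) (ε / 2))ᶜ ∈ 𝓝 p :=
        isClosed_closedBall.isOpen_compl.mem_nhds fun h =>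
          hp (closedBall_subset_ball (by linarith) h)
      refine (contDiffAt_const (c := (0 : V m))).congr_of_eventuallyEq ?_
      filter_upwards [hp'] with z hz
      have : f z = 0 := f.zero_of_le_dist (le_of_lt (by simpa [f] using hz))
      simp [hY, this]
  have hYeq : ∀ y ∈ closedBall y₀ (ε / 4), ∀ v ∈ ball (0 : V m) (ε / 4), Y (y, v) = sol y v 1 := by
    intro y hy v hv
    have : f (y, v) = 1 := by
      refine f.one_of_mem_closedBall ?_
      rw [← closedBall_prod_same]
      have h43 : ε / 4 ≤ f.rIn := by
        change ε / 4 ≤ ε / 3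
        linarith
      exact ⟨closedBall_subset_closedBall h43 hy,
        closedBall_subset_closedBall h43 (ball_subset_closedBall hv)⟩
    simp [hY, this]
  have hsol' : ∀ y ∈ closedBall y₀ (ε / 4), ∀ v ∈ ball (0 : V m) (ε / 4),
      IsCoordGeodesic H y v (sol y v) (vel y v) ∧ ∀ t, sol y v t ∈ B := fun y hy v hv =>
    ⟨(hsol y (closedBall_subset_ball (by linarith) hy) v (ball_subset_ball (by linarith) hv)).1,
      (hsol y (closedBall_subset_ball (by linarith) hy) v (ball_subset_ball (by linarith) hv)).2.1⟩
  set K : Set (Par m) := {κ : Par m | κ.1 ∈ closedBall y₀ (ε / 4) ∧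
    ∀ i j, H κ.1 (κ.2 i) (κ.2 j) = if i = j then 1 else 0} with hK
  have hKc : IsCompact K := isCompact_orthonormal hH.continuous hpos y₀ (ε / 4)
  obtain ⟨ε₂, hε₂, hball⟩ := exists_ball_of_isCompact hKc
    (S := {z : Par m × V m | frameVec z.1 z.2 ∈ ball (0 : V m) (ε / 4)})
    (isOpen_ball.preimage contDiff_frameVec.continuous)
    (fun κ _ => by
      change frameVec κ 0 ∈ ball (0 : V m) (ε / 4)
      rw [frameVec_zero]
      exact mem_ball_self (by positivity))
  set Z : Par m × V m → V m := fun z => Y (z.1.1, frameVec z.1 z.2) with hZ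
  have hZs : ContDiff ℝ ∞ Z :=
    hYs.comp ((contDiff_fst.comp contDiff_fst).prodMk contDiff_frameVec)
  have hZx : ∀ κ, ContDiff ℝ ∞ fun x => Z (κ, x) := fun κ =>
    hZs.comp (contDiff_const.prodMk contDiff_id)
  have hZeq : ∀ κ ∈ K, ∀ x ∈ ball (0 : V m) ε₂, Z (κ, x) = sol κ.1 (frameVec κ x) 1 :=
    fun κ hκ x hx => hYeq _ hκ.1 _ (hball κ hκ x hx)
  set HN : Par m × V m → Bil m :=
    fun z => pullBil (H (Z z)) (fderiv ℝ (fun y => Z (z.1, y)) z.2) with hHN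
  have hHNs : ContDiff ℝ ∞ HN := by
    rw [← contDiffOn_univ]
    refine contDiffOn_bil fun a b => contDiffOn_univ.2 ?_
    have hd : ContDiff ℝ ∞ fun z : Par m × V m => fderiv ℝ (fun y => Z (z.1, y)) z.2 :=
      ContDiff.fderiv (f := fun (z : Par m × V m) y => Z (z.1, y)) (g := fun z => z.2) (n := ∞)
        (hZs.comp ((contDiff_fst.comp contDiff_fst).prodMk contDiff_snd)) contDiff_snd (by simp)
    exact ((hH.comp hZs).clm_apply (hd.clm_apply contDiff_const)).clm_apply
      (hd.clm_apply contDiff_const)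
  -- along rays `Z` runs through geodesics
  have hray : ∀ κ ∈ K, ∀ x ∈ ball (0 : V m) ε₂, ∀ t ∈ Icc (0 : ℝ) 1,
      Z (κ, t • x) = sol κ.1 (frameVec κ x) t := by
    intro κ hκ x hx t ht
    have htx : t • x ∈ ball (0 : V m) ε₂ := by
      rw [mem_ball_zero_iff] at hx ⊢
      rw [norm_smul, Real.norm_of_nonneg ht.1]
      exact (mul_le_of_le_one_left (norm_nonneg _) ht.2).trans_lt hx
    have h1 := (hsol' κ.1 hκ.1 _ (hball κ hκ x hx)).1
    have h2 := (hsol' κ.1 hκ.1 _ (hball κ hκ _ htx)).1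
    rw [hZeq κ hκ _ htx]
    rw [frameVec_smul] at h2 ⊢
    exact h1.eq_scale hH hpos ht h2
  -- the derivative of the exponential map at the origin is the given frame
  have hderiv0 : ∀ κ ∈ K, ∀ x ∈ ball (0 : V m) ε₂,
      fderiv ℝ (fun y => Z (κ, y)) 0 x = frameVec κ x := by
    intro κ hκ x hx
    have h1 : HasDerivAt (fun t : ℝ => Z (κ, t • x)) (fderiv ℝ (fun y => Z (κ, y)) 0 x) 0 := by
      have h2 : HasDerivAt (fun t : ℝ => t • x) x 0 := by
        simpa using (hasDerivAt_id (0 : ℝ)).smul_const x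
      have h3 : HasFDerivAt (fun y => Z (κ, y)) (fderiv ℝ (fun y => Z (κ, y)) 0)
          ((0 : ℝ) • x) := by
        rw [zero_smul]
        exact ((hZx κ).differentiable (by simp) 0).hasFDerivAt
      exact h3.comp_hasDerivAt 0 h2
    have hg := (hsol' κ.1 hκ.1 _ (hball κ hκ x hx)).1
    have h4 := hg.hasDerivAt 0 (by norm_num)
    rw [hg.init_vel] at h4
    have h5 : HasDerivWithinAt (fun t : ℝ => Z (κ, t • x)) (frameVec κ x) (Icc 0 1) 0 :=
      h4.hasDerivWithinAt.congr (fun t ht => hray κ hκ x hx t ht)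
        (hray κ hκ x hx 0 (left_mem_Icc.2 zero_le_one))
    exact (uniqueDiffOn_Icc zero_lt_one 0 (left_mem_Icc.2 zero_le_one)).eq_deriv _
      h1.hasDerivWithinAt h5
  -- by homogeneity, the same holds for all vectors
  have hderiv0' : ∀ κ ∈ K, ∀ x, fderiv ℝ (fun y => Z (κ, y)) 0 x = frameVec κ x := by
    intro κ hκ x
    obtain ⟨s, hs, hsx⟩ : ∃ s : ℝ, 0 < s ∧ s • x ∈ ball (0 : V m) ε₂ := by
      refine ⟨ε₂ / (2 * (‖x‖ + 1)), by positivity, ?_⟩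
      rw [mem_ball_zero_iff, norm_smul, Real.norm_of_nonneg (by positivity), div_mul_eq_mul_div,
        div_lt_iff₀ (by positivity)]
      nlinarith [norm_nonneg x]
    have h1 := hderiv0 κ hκ _ hsx
    rw [map_smul, frameVec_smul] at h1
    exact smul_right_injective _ hs.ne' h1
  refine ⟨sol, vel, ε / 4, ε₂, Z, HN, by positivity, hsol',
    ⟨hKc, hε₂, hHNs, fun z a b => hsymm _ _ _, fun κ hκ => ?_, fun κ hκ x hx w => ?_⟩, hZs,
    fun z => rfl, fun κ h1 h2 x hx => ⟨hball κ ⟨h1, h2⟩ x hx, hZeq κ ⟨h1, h2⟩ x hx⟩⟩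
  -- at the centre the metric is Euclidean, as the frame is orthonormal
  · have hZ0 : Z (κ, 0) = κ.1 := by
      have h1 := hray κ hκ 0 (mem_ball_self hε₂) 0 (left_mem_Icc.2 zero_le_one)
      rw [smul_zero] at h1
      rw [h1]
      exact (hsol' κ.1 hκ.1 _ (hball κ hκ 0 (mem_ball_self hε₂))).1.init
    ext a b
    simp only [hHN, pullBil_apply, hZ0, hderiv0' κ hκ, eucl_apply, frameVec, map_sum, map_smul,
      _root_.sum_apply, _root_.smul_apply, hκ.2, smul_eq_mul]
    simp [PiLp.inner_apply, mul_comm]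
  · -- the point is interior to a slightly longer ray
    obtain ⟨s, hs0, hs1, hsx⟩ : ∃ s : ℝ, 0 < s ∧ s < 1 ∧ s⁻¹ • x ∈ ball (0 : V m) ε₂ := by
      rw [mem_ball_zero_iff] at hx
      refine ⟨(‖x‖ + ε₂) / (2 * ε₂), by positivity, ?_, ?_⟩
      · rw [div_lt_one (by positivity)]
        linarith
      · have hn := norm_nonneg x
        rw [mem_ball_zero_iff, norm_smul, Real.norm_of_nonneg (by positivity), inv_div,
          div_mul_eq_mul_div, div_lt_iff₀ (by positivity)]
        nlinarith
    set x' := s⁻¹ • x with hx'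
    have hsx' : s • x' = x := by rw [hx', smul_smul, mul_inv_cancel₀ hs0.ne', one_smul]
    set φ : V m → V m := fun y => Z (κ, y) with hφ
    have hφs : ContDiff ℝ ∞ φ := hZx κ
    have hHNx : ContDiff ℝ ∞ fun y => HN (κ, y) := hHNs.comp (contDiff_const.prodMk contDiff_id)
    have hc : ContDiffAt ℝ 2 (fun t : ℝ => t • x') s := contDiffAt_id.smul contDiffAt_const
    have hc1 : deriv (fun t : ℝ => t • x') = fun _ => x' := by
      ext1 t
      simpa using ((hasDerivAt_id t).smul_const x').deriv
    have hφ2 : ContDiffAt ℝ 2 φ (s • x') := hφs.contDiffAt.of_le two_le_infty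
    obtain ⟨hd1, hd2⟩ := deriv_deriv_comp hφ2 hc
    rw [hc1] at hd1 hd2
    simp only [deriv_const', map_zero, zero_add] at hd2
    -- the geodesic equation for the ray `t ↦ t • x'` in the pulled back metric is that for its image
    have hpb := lowered_geodesic_pullback (H := H) (H' := fun y => HN (κ, y)) (φ := φ) (x := s • x')
      hφ2 (hH.differentiable (by simp) _) (hHNx.differentiable (by simp) _) (fun a b => hsymm _ _ _)
      (Eventually.of_forall fun y a b => rfl) 0 x' w
    rw [map_zero, map_zero, zero_add, zero_add, ← hd1, ← hd2] at hpb
    have hg := (hsol' κ.1 hκ.1 _ (hball κ hκ x' hsx)).1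
    have hsI : s ∈ Ioo (-1 : ℝ) 2 := ⟨by linarith, by linarith⟩
    have he : (fun t : ℝ => φ (t • x')) =ᶠ[𝓝 s] sol κ.1 (frameVec κ x') := by
      filter_upwards [Ioo_mem_nhds hs0 hs1] with t ht
      exact hray κ hκ x' hsx t (Ioo_subset_Icc_self ht)
    have hv : deriv (sol κ.1 (frameVec κ x')) =ᶠ[𝓝 s] vel κ.1 (frameVec κ x') := by
      filter_upwards [isOpen_Ioo.mem_nhds hsI] with t ht
      exact (hg.hasDerivAt t ht).deriv
    rw [he.deriv.deriv_eq, hv.deriv_eq, he.deriv_eq, hv.self_of_nhds,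
      (hg.hasDerivAt_vel s hsI).deriv, ← he.self_of_nhds, map_neg,
      apply_chrVec (Eventually.of_forall fun y => rfl) (hH.differentiable (by simp) _)
        (isUnit_det_mat (hpos _)), neg_add_cancel, hsx'] at hpb
    -- the second term of the equation is homogeneous of degree two in the velocity
    have hquad : ∀ L : V m →L[ℝ] Bil m, lowChr L w x x = s ^ 2 * lowChr L w x' x' := fun L => by
      rw [← hsx']
      simp only [lowChr, map_smul, _root_.smul_apply, smul_eq_mul]
      ring
    rw [hquad, hpb, mul_zero]

/-- The metric of a manifold in normal coordinates is given, near any point, by a normal family. -/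
theorem exists_normal_family {M : Type*} [TopologicalSpace M] [T2Space M] [ChartedSpace (V m) M]
    [IsManifold (𝓡 m) ∞ M]
    (g : ContMDiffRiemannianMetric (𝓡 m) ∞ (V m) (fun q : M => TangentSpace (𝓡 m) q)) (q : M) :
    ∃ U ∈ 𝓝 q, ∃ (K : Set (Par m)) (ε : ℝ) (H : Par m × V m → Bil m), IsNormalFamily K ε H ∧
      ∀ p ∈ U, ∀ E : Fin m → TangentSpace (𝓡 m) p, IsOrthonormalBasis g p E →
        ∃ κ ∈ K, ∀ x ∈ ball (0 : V m) ε, normalMetric g p E x = mat (H (κ, x)) := by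
  obtain ⟨H, hH, hpos, hsymm, R, hR, hRt, hHg⟩ := exists_global_metric g q
  set ψ := extChartAt (𝓡 m) q with hψ
  obtain ⟨sol, vel, ε₁, ε₂, Z, HN, hε₁, hsol, hfam, hZs, hHN, hZ⟩ :=
    exists_normal_family_of_metric hH hpos hsymm (ψ q) (Metric.ball_mem_nhds (ψ q) hR)
  have hcont : ContinuousAt ψ q := continuousAt_extChartAt (I := 𝓡 m) q
  refine ⟨ψ.source ∩ ψ ⁻¹' closedBall (ψ q) ε₁, Filter.inter_mem (extChartAt_source_mem_nhds q)
    (hcont.preimage_mem_nhds (closedBall_mem_nhds _ hε₁)), _, ε₂, HN, hfam, ?_⟩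
  rintro p ⟨hp, hpb⟩ E hE
  have hpR : ψ p ∈ ball (ψ q) R := by
    have h1 := hsol (ψ p) hpb 0 (mem_ball_self hε₁)
    have h2 := h1.2 0
    rwa [h1.1.init] at h2
  -- the parameters belonging to `p` and `E`
  set κ : Par m := (ψ p, fun i => mfderiv (𝓡 m) 𝓘(ℝ, V m) ψ p (E i)) with hκ
  have hlin : ∀ x : V m, (mfderiv (𝓡 m) 𝓘(ℝ, V m) ψ p (∑ i, x i • E i) : V m) = frameVec κ x :=
    fun x => by
      rw [map_sum]
      refine Finset.sum_congr rfl fun i _ => ?_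
      rw [map_smul]
      rfl
  have hon : ∀ i j, H κ.1 (κ.2 i) (κ.2 j) = if i = j then 1 else 0 := fun i j => by
    rw [← hE i j]
    have aux : ∀ {p' : M}, p' = p → ∀ a b : V m, g.inner p' a b = g.inner p a b := by
      rintro _ rfl a b
      rfl
    rw [hHg _ hpR, chartMetric_apply]
    refine (aux (ψ.left_inv hp) _ _).trans ?_
    have h1 := mfderiv_symm_comp_chart q hp (E i)
    have h2 := mfderiv_symm_comp_chart q hp (E j)
    exact congrArg₂ (fun a b : V m => g.inner p a b) h1 h2
  refine ⟨κ, ⟨hpb, hon⟩, fun x hx => ?_⟩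
  have hsolx : ∀ y ∈ ball (0 : V m) ε₂, IsCoordGeodesic H κ.1 (frameVec κ y)
      (sol κ.1 (frameVec κ y)) (vel κ.1 (frameVec κ y)) ∧
      ∀ t, sol κ.1 (frameVec κ y) t ∈ ball (ψ q) R := fun y hy =>
    hsol _ hpb _ (hZ κ hpb hon y hy).1
  -- in the chart, normal coordinates are given by the exponential map of the extended metric
  have hF : normalCoord g p E =ᶠ[𝓝 x] fun y => ψ.symm (Z (κ, y)) := by
    filter_upwards [isOpen_ball.mem_nhds hx] with y hy
    obtain ⟨h1, h2⟩ := hsolx y hy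
    rw [normalCoord, (hZ κ hpb hon y hy).2]
    refine expMap_eq_of_isCoordGeodesic (g := g) (q := q) hH hpos isOpen_ball hRt hHg hp _
      (v := vel κ.1 (frameVec κ y)) ?_ h2
    rw [hlin]
    exact h1
  have hZx : ContDiff ℝ ∞ fun y => Z (κ, y) := hZs.comp (contDiff_const.prodMk contDiff_id)
  have hZR : Z (κ, x) ∈ ball (ψ q) R := by
    rw [(hZ κ hpb hon x hx).2]
    exact (hsolx x hx).2 1
  rw [normalMetric, metricIn_eq_of_chart g q hF (hZx.differentiable (by simp) x) (hRt hZR), hHN,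
    hHg _ hZR]

end NormalCoordinates

/-! ### The Gauss lemma and the Taylor expansion of the metric -/

section GaussLemma

open Filter Topology

variable {m : ℕ}

/-- The coefficients of a metric in normal coordinates: they are Euclidean at the centre, and the
radial lines in the ball of radius `ε` satisfy the geodesic equation, in its lowered form. -/
structure IsNormalMetric (ε : ℝ) (H : V m → Bil m) : Prop where
  pos : 0 < ε
  smooth : ContDiff ℝ ∞ H
  symm : ∀ x a b, H x a b = H x b a
  zero : H 0 = eucl m
  radial : ∀ x ∈ ball (0 : V m) ε, ∀ w, lowChr (fderiv ℝ H x) w x x = 0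

lemma IsNormalFamily.isNormalMetric {P : Type*} [NormedAddCommGroup P] [NormedSpace ℝ P]
    {K : Set P} {ε : ℝ} {H : P × V m → Bil m} (h : IsNormalFamily K ε H) {κ : P} (hκ : κ ∈ K) :
    IsNormalMetric ε fun y => H (κ, y) :=
  ⟨h.pos, h.smooth.comp (contDiff_const.prodMk contDiff_id), fun _ => h.symm _, h.zero κ hκ,
    h.radial κ hκ⟩

variable {ε : ℝ} {H : V m → Bil m}

lemma smul_mem_ball {x : V m} (hx : x ∈ ball (0 : V m) ε) {t : ℝ} (h0 : 0 ≤ t) (h1 : t ≤ 1) :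
    t • x ∈ ball (0 : V m) ε := by
  rw [mem_ball_zero_iff] at hx ⊢
  rw [norm_smul, Real.norm_of_nonneg h0]
  exact (mul_le_of_le_one_left (norm_nonneg _) h1).trans_lt hx

lemma eq_of_hasDerivAt_zero {f : ℝ → ℝ} (hf : Continuous f)
    (h : ∀ t ∈ Ioo (0 : ℝ) 1, HasDerivAt f 0 t) : f 1 = f 0 := by
  obtain ⟨c, _, hc⟩ := exists_hasDerivAt_eq_slope f (fun _ => 0) zero_lt_one hf.continuousOn h
  simp only [sub_zero, div_one] at hc
  linarith

lemma IsNormalMetric.hasDerivAt_ray (h : IsNormalMetric ε H) (x : V m) (t : ℝ) :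
    HasDerivAt (fun t : ℝ => H (t • x)) (fderiv ℝ H (t • x) x) t := by
  have h2 : HasDerivAt (fun t : ℝ => t • x) x t := by
    simpa using (hasDerivAt_id t).smul_const x
  exact (h.smooth.differentiable (by simp) _).hasFDerivAt.comp_hasDerivAt t h2

/-- Radial lines have constant speed. -/
lemma IsNormalMetric.apply_self (h : IsNormalMetric ε H) {x : V m} (hx : x ∈ ball (0 : V m) ε) :
    H x x x = inner ℝ x x := by
  have hd : ∀ t : ℝ, HasDerivAt (fun t : ℝ => H (t • x) x x) (fderiv ℝ H (t • x) x x x) t :=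
    fun t => by
      simpa using ((h.hasDerivAt_ray x t).clm_apply (hasDerivAt_const t x)).clm_apply
        (hasDerivAt_const t x)
  have h1 := eq_of_hasDerivAt_zero (f := fun t : ℝ => H (t • x) x x)
    (continuous_iff_continuousAt.2 fun t => (hd t).continuousAt) (fun t ht => by
      have h2 := h.radial _ (smul_mem_ball hx ht.1.le ht.2.le) (t • x)
      simp only [lowChr, map_smul, _root_.smul_apply, smul_eq_mul] at h2
      have h3 : t ^ 3 * fderiv ℝ H (t • x) x x x = 0 := by linear_combination 2 * h2
      have h4 : fderiv ℝ H (t • x) x x x = 0 :=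
        (mul_eq_zero.1 h3).resolve_left (pow_ne_zero _ ht.1.ne')
      rw [← h4]
      exact hd t)
  simpa [h.zero, eucl_apply] using h1

/-- The Gauss lemma: the radial derivative of `H y y w - ⟨y, w⟩` vanishes, by the geodesic equation
for the radial lines and the derivative of the identity `H y y y = |y|²`. -/
lemma IsNormalMetric.gauss (h : IsNormalMetric ε H) {x : V m} (hx : x ∈ ball (0 : V m) ε)
    (w : V m) : H x x w = inner ℝ x w := by
  -- the derivative of `H y y y = |y|²`
  have hq : ∀ y ∈ ball (0 : V m) ε,
      fderiv ℝ H y w y y + 2 * H y y w = 2 * inner ℝ y w := fun y hy => by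
    have h1 : (fun y => H y y y) =ᶠ[𝓝 y] fun y => inner ℝ y y := by
      filter_upwards [isOpen_ball.mem_nhds hy] with z hz using h.apply_self hz
    have h2 : HasFDerivAt (fun y => H y y y) _ y :=
      ((h.smooth.differentiable (by simp) y).hasFDerivAt.clm_apply (hasFDerivAt_id y)).clm_apply
        (hasFDerivAt_id y)
    have h3 : HasFDerivAt (fun y : V m => (inner ℝ y y : ℝ)) _ y :=
      (hasFDerivAt_id y).inner ℝ (hasFDerivAt_id y)
    have h4 := congrArg (fun L => L w) (h1.fderiv_eq.symm.trans h2.fderiv)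
    rw [h3.fderiv] at h4
    simp only [_root_.add_apply, ContinuousLinearMap.comp_apply, ContinuousLinearMap.flip_apply,
      ContinuousLinearMap.prod_apply, fderivInnerCLM_apply, ContinuousLinearMap.id_apply, id] at h4
    rw [h.symm y w y, real_inner_comm y w] at h4
    linarith
  have hd : ∀ t : ℝ, HasDerivAt (fun t : ℝ => H (t • x) (t • x) w - inner ℝ (t • x) w)
      (fderiv ℝ H (t • x) x (t • x) w + H (t • x) x w - inner ℝ x w) t := fun t => by
    have h2 : HasDerivAt (fun t : ℝ => t • x) x t := by
      simpa using (hasDerivAt_id t).smul_const x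
    have h3 := ((h.hasDerivAt_ray x t).clm_apply h2).clm_apply (hasDerivAt_const t w)
    have h4 := h2.inner ℝ (hasDerivAt_const t w)
    refine (h3.sub h4).congr_deriv ?_
    simp
  have h1 := eq_of_hasDerivAt_zero
    (f := fun t : ℝ => H (t • x) (t • x) w - inner ℝ (t • x) w)
    (continuous_iff_continuousAt.2 fun t => (hd t).continuousAt) (fun t ht => by
      have hy := smul_mem_ball hx ht.1.le ht.2.le
      have h2 := h.radial _ hy w
      have h3 := hq _ hy
      simp only [lowChr] at h2
      have h4 : t * (fderiv ℝ H (t • x) x (t • x) w + H (t • x) x w - inner ℝ x w) = 0 := by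
        have e1 : t * fderiv ℝ H (t • x) x (t • x) w = fderiv ℝ H (t • x) (t • x) (t • x) w := by
          simp only [map_smul, _root_.smul_apply, smul_eq_mul]
        have e2 : t * H (t • x) x w = H (t • x) (t • x) w := by
          simp only [map_smul, _root_.smul_apply, smul_eq_mul]
        have e3 : t * inner ℝ x w = inner ℝ (t • x) w := by
          rw [real_inner_smul_left]
        rw [mul_sub, mul_add, e1, e2, e3]
        linarith
      have h5 := (mul_eq_zero.1 h4).resolve_left ht.1.ne'
      rw [← h5]
      exact hd t)
  simp only [one_smul, zero_smul, map_zero, _root_.zero_apply, inner_zero_left, sub_zero] at h1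
  linarith

/-- The first derivative of a field of bilinear forms. -/
def der1 (H : V m → Bil m) : V m → V m →L[ℝ] Bil m := fderiv ℝ H

/-- The second derivative of a field of bilinear forms. -/
def der2 (H : V m → Bil m) : V m → V m →L[ℝ] V m →L[ℝ] Bil m := fderiv ℝ (fderiv ℝ H)

/-- The third derivative of a field of bilinear forms. -/
def der3 (H : V m → Bil m) : V m → V m →L[ℝ] V m →L[ℝ] V m →L[ℝ] Bil m :=
  fderiv ℝ (fderiv ℝ (fderiv ℝ H))

lemma hasFDerivAt_der1 (hH : ContDiff ℝ ∞ H) (x : V m) : HasFDerivAt H (der1 H x) x :=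
  (hH.differentiable (by simp) x).hasFDerivAt

lemma contDiff_der1 (hH : ContDiff ℝ ∞ H) : ContDiff ℝ ∞ (der1 H) :=
  hH.fderiv_right (m := ∞) (by simp)

lemma contDiff_der2 (hH : ContDiff ℝ ∞ H) : ContDiff ℝ ∞ (der2 H) :=
  (contDiff_der1 hH).fderiv_right (m := ∞) (by simp)

lemma contDiff_der3 (hH : ContDiff ℝ ∞ H) : ContDiff ℝ ∞ (der3 H) :=
  (contDiff_der2 hH).fderiv_right (m := ∞) (by simp)

lemma hasFDerivAt_der2 (hH : ContDiff ℝ ∞ H) (x : V m) : HasFDerivAt (der1 H) (der2 H x) x :=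
  ((contDiff_der1 hH).differentiable (by simp) x).hasFDerivAt

lemma hasFDerivAt_der3 (hH : ContDiff ℝ ∞ H) (x : V m) : HasFDerivAt (der2 H) (der3 H x) x :=
  ((contDiff_der2 hH).differentiable (by simp) x).hasFDerivAt

lemma der2_symm (hH : ContDiff ℝ ∞ H) (x a b : V m) : der2 H x a b = der2 H x b a :=
  ((hH.contDiffAt (x := x)).isSymmSndFDerivAt
    (by simpa using two_le_infty)).eq a b

lemma der3_symm_left (hH : ContDiff ℝ ∞ H) (x a b : V m) : der3 H x a b = der3 H x b a :=
  (((contDiff_der1 hH).contDiffAt (x := x)).isSymmSndFDerivAt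
    (by simpa using two_le_infty)).eq a b

lemma fderiv_der2_apply (hH : ContDiff ℝ ∞ H) (x a b c d e : V m) :
    fderiv ℝ (fun y => der2 H y a b c d) x e = der3 H x e a b c d := by
  have h1 := ((((hasFDerivAt_der3 hH x).clm_apply (hasFDerivAt_const a x)).clm_apply
    (hasFDerivAt_const b x)).clm_apply (hasFDerivAt_const c x)).clm_apply (hasFDerivAt_const d x)
  refine (congrArg (fun L => L e) h1.fderiv).trans ?_
  simp

lemma der3_symm_mid (hH : ContDiff ℝ ∞ H) (x a b c d e : V m) :
    der3 H x a b c d e = der3 H x a c b d e := by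
  rw [← fderiv_der2_apply hH, ← fderiv_der2_apply hH]
  simp only [der2_symm hH _ b c]

lemma der1_symm (hH : ContDiff ℝ ∞ H) (hs : ∀ x a b, H x a b = H x b a) (x a b c : V m) :
    der1 H x a b c = der1 H x a c b := by
  rw [der1, ← fderiv_apply₂ (hH.differentiable (by simp) x),
    ← fderiv_apply₂ (hH.differentiable (by simp) x)]
  simp only [hs _ b c]

lemma fderiv_der1_apply (hH : ContDiff ℝ ∞ H) (x a c d e : V m) :
    fderiv ℝ (fun y => der1 H y a c d) x e = der2 H x e a c d := by
  have h1 := (((hasFDerivAt_der2 hH x).clm_apply (hasFDerivAt_const a x)).clm_apply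
    (hasFDerivAt_const c x)).clm_apply (hasFDerivAt_const d x)
  refine (congrArg (fun L => L e) h1.fderiv).trans ?_
  simp

lemma der2_symm_right (hH : ContDiff ℝ ∞ H) (hs : ∀ x a b, H x a b = H x b a)
    (x a b c d : V m) : der2 H x a b c d = der2 H x a b d c := by
  rw [← fderiv_der1_apply hH, ← fderiv_der1_apply hH]
  simp only [der1_symm hH hs _ b c d]

lemma der3_symm_right (hH : ContDiff ℝ ∞ H) (hs : ∀ x a b, H x a b = H x b a)
    (x a b c d e : V m) : der3 H x a b c d e = der3 H x a b c e d := by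
  rw [← fderiv_der2_apply hH, ← fderiv_der2_apply hH]
  simp only [der2_symm_right hH hs _ b c d e]

lemma fderiv_clm_apply_const {W W' : Type*} [NormedAddCommGroup W] [NormedSpace ℝ W]
    [NormedAddCommGroup W'] [NormedSpace ℝ W'] {F : V m → W →L[ℝ] W'} {x : V m}
    (hF : DifferentiableAt ℝ F x) (c : W) (e : V m) :
    fderiv ℝ (fun y => F y c) x e = fderiv ℝ F x e c := by
  rw [fderiv_clm_apply hF (differentiableAt_const c)]
  simp

lemma fderiv_bil_apply_self {L : V m → Bil m} {x : V m} (hL : DifferentiableAt ℝ L x)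
    (d e : V m) :
    fderiv ℝ (fun y => L y y d) x e = fderiv ℝ L x e x d + L x e d := by
  have h1 : DifferentiableAt ℝ (fun y => L y y) x := hL.clm_apply differentiableAt_id
  rw [fderiv_clm_apply_const h1, fderiv_clm_apply hL differentiableAt_fun_id]
  simp [add_comm]

lemma fderiv_apply_eq_zero {f : V m → ℝ} {x : V m} {s : Set (V m)} (hs : s ∈ 𝓝 x) {c : ℝ}
    (h : ∀ y ∈ s, f y = c) (e : V m) : fderiv ℝ f x e = 0 := by
  have h1 : f =ᶠ[𝓝 x] fun _ => c := by
    filter_upwards [hs] with y hy using h y hy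
  rw [h1.fderiv_eq, fderiv_const_apply, _root_.zero_apply]

lemma differentiableAt_der1_apply (hH : ContDiff ℝ ∞ H) (x a b c : V m) :
    DifferentiableAt ℝ (fun y => der1 H y a b c) x :=
  (((((contDiff_der1 hH).clm_apply contDiff_const).clm_apply contDiff_const).clm_apply
    contDiff_const).differentiable (by simp)) x

lemma differentiableAt_der2_apply (hH : ContDiff ℝ ∞ H) (x a b c d : V m) :
    DifferentiableAt ℝ (fun y => der2 H y a b c d) x :=
  ((((((contDiff_der2 hH).clm_apply contDiff_const).clm_apply contDiff_const).clm_apply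
    contDiff_const).clm_apply contDiff_const).differentiable (by simp)) x

/-- The first derivative of the identity of the Gauss lemma. -/
lemma IsNormalMetric.gauss_deriv₁ (h : IsNormalMetric ε H) {x : V m}
    (hx : x ∈ ball (0 : V m) ε) (b d : V m) :
    der1 H x b x d + H x b d = inner ℝ b d := by
  have h1 : (fun y => H y y d) =ᶠ[𝓝 x] fun y => inner ℝ y d := by
    filter_upwards [isOpen_ball.mem_nhds hx] with z hz using h.gauss hz d
  have h2 := fderiv_bil_apply_self (h.smooth.differentiable (by simp) x) d b
  have h3 := (hasFDerivAt_id x).inner ℝ (hasFDerivAt_const d x)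
  rw [h1.fderiv_eq] at h2
  refine h2.symm.trans ((congrArg (fun L => L b) h3.fderiv).trans ?_)
  simp

/-- The second derivative of the identity of the Gauss lemma. -/
lemma IsNormalMetric.gauss_deriv₂ (h : IsNormalMetric ε H) {x : V m}
    (hx : x ∈ ball (0 : V m) ε) (b c d : V m) :
    der2 H x c b x d + der1 H x b c d + der1 H x c b d = 0 := by
  have hd1 : DifferentiableAt ℝ (der1 H) x := (contDiff_der1 h.smooth).differentiable (by simp) x
  have hL : DifferentiableAt ℝ (fun y => der1 H y b) x := hd1.clm_apply (differentiableAt_const b)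
  have h0 := fderiv_apply_eq_zero (isOpen_ball.mem_nhds hx)
    (fun y hy => h.gauss_deriv₁ hy b d) c
  have hA : DifferentiableAt ℝ (fun y => der1 H y b y d) x :=
    (hL.clm_apply differentiableAt_id).clm_apply (differentiableAt_const d)
  have hB : DifferentiableAt ℝ (fun y => H y b d) x :=
    ((h.smooth.differentiable (by simp) x).clm_apply (differentiableAt_const b)).clm_apply
      (differentiableAt_const d)
  rw [fderiv_fun_add hA hB, _root_.add_apply, fderiv_bil_apply_self hL,
    fderiv_clm_apply_const hd1, fderiv_apply₂ (h.smooth.differentiable (by simp) x)] at h0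
  exact h0

/-- The third derivative of the identity of the Gauss lemma. -/
lemma IsNormalMetric.gauss_deriv₃ (h : IsNormalMetric ε H) {x : V m}
    (hx : x ∈ ball (0 : V m) ε) (b c d e : V m) :
    der3 H x e c b x d + der2 H x c b e d + der2 H x e b c d + der2 H x e c b d = 0 := by
  have hd2 : DifferentiableAt ℝ (der2 H) x := (contDiff_der2 h.smooth).differentiable (by simp) x
  have hd2c : DifferentiableAt ℝ (fun y => der2 H y c) x := hd2.clm_apply (differentiableAt_const c)
  have hL : DifferentiableAt ℝ (fun y => der2 H y c b) x := hd2c.clm_apply (differentiableAt_const b)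
  have h0 := fderiv_apply_eq_zero (isOpen_ball.mem_nhds hx)
    (fun y hy => h.gauss_deriv₂ hy b c d) e
  have hA : DifferentiableAt ℝ (fun y => der2 H y c b y d) x :=
    (hL.clm_apply differentiableAt_id).clm_apply (differentiableAt_const d)
  have hB := differentiableAt_der1_apply h.smooth x b c d
  have hC := differentiableAt_der1_apply h.smooth x c b d
  rw [fderiv_fun_add (hA.fun_add hB) hC, _root_.add_apply, fderiv_fun_add hA hB, _root_.add_apply,
    fderiv_bil_apply_self hL, fderiv_clm_apply_const hd2c, fderiv_clm_apply_const hd2,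
    fderiv_der1_apply h.smooth, fderiv_der1_apply h.smooth] at h0
  exact h0

/-- The fourth derivative of the identity of the Gauss lemma, at the centre. -/
lemma IsNormalMetric.gauss_deriv₄ (h : IsNormalMetric ε H) (b c d e f : V m) :
    der3 H 0 e c b f d + der3 H 0 f c b e d + der3 H 0 f e b c d + der3 H 0 f e c b d = 0 := by
  have hd3 : DifferentiableAt ℝ (der3 H) 0 := (contDiff_der3 h.smooth).differentiable (by simp) 0
  have hd3e : DifferentiableAt ℝ (fun y => der3 H y e) 0 := hd3.clm_apply (differentiableAt_const e)
  have hd3c : DifferentiableAt ℝ (fun y => der3 H y e c) 0 :=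
    hd3e.clm_apply (differentiableAt_const c)
  have hL : DifferentiableAt ℝ (fun y => der3 H y e c b) 0 := hd3c.clm_apply (differentiableAt_const b)
  have h0 := fderiv_apply_eq_zero (ball_mem_nhds (0 : V m) h.pos)
    (fun y hy => h.gauss_deriv₃ hy b c d e) f
  have hA : DifferentiableAt ℝ (fun y => der3 H y e c b y d) 0 :=
    (hL.clm_apply differentiableAt_id).clm_apply (differentiableAt_const d)
  have hB := differentiableAt_der2_apply h.smooth 0 c b e d
  have hC := differentiableAt_der2_apply h.smooth 0 e b c d
  have hD := differentiableAt_der2_apply h.smooth 0 e c b d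
  rw [fderiv_fun_add ((hA.fun_add hB).fun_add hC) hD, _root_.add_apply, fderiv_fun_add (hA.fun_add hB) hC,
    _root_.add_apply, fderiv_fun_add hA hB, _root_.add_apply,
    fderiv_bil_apply_self hL, fderiv_der2_apply h.smooth, fderiv_der2_apply h.smooth,
    fderiv_der2_apply h.smooth, map_zero, _root_.zero_apply] at h0
  linarith

/-- The first derivatives of the metric vanish at the centre of normal coordinates. -/
lemma IsNormalMetric.der1_zero (h : IsNormalMetric ε H) : der1 H 0 = 0 := by
  have hs := der1_symm h.smooth h.symm
  have g : ∀ a b c, der1 H 0 a b c + der1 H 0 b a c = 0 := fun a b c => by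
    have h1 := h.gauss_deriv₂ (mem_ball_self h.pos) b a c
    simp only [map_zero, _root_.zero_apply] at h1
    linarith
  ext a b c
  have h1 := g a b c
  have h2 := g b c a
  have h3 := g c a b
  rw [hs] at h1 h2 h3
  simp only [_root_.zero_apply]
  linarith [hs 0 a b c, hs 0 b c a, hs 0 c a b]

end GaussLemma

/-! ### Curvature at the centre of normal coordinates -/

section Congruence

open Filter Topology

variable {m n : ℕ} {h h' : V m → Matrix (Fin m) (Fin m) ℝ} {x : V m}

lemma christoffel_eventuallyEq (hh : h =ᶠ[𝓝 x] h') (k a b : Fin m) :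
    christoffel h k a b =ᶠ[𝓝 x] christoffel h' k a b := by
  have he : ∀ i j, (fun y => h y i j) =ᶠ[𝓝 x] fun y => h' y i j := fun i j => by
    filter_upwards [hh] with y hy
    rw [hy]
  have hp := fun c i j => pd_eventuallyEq (he i j) c
  have hp' : ∀ᶠ y in 𝓝 x, ∀ c i j, pd c (fun y => h y i j) y = pd c (fun y => h' y i j) y :=
    eventually_all.2 fun c => eventually_all.2 fun i => eventually_all.2 fun j => hp c i j
  filter_upwards [hh, hp'] with y hy hy'
  simp only [christoffel, hy, hy']

lemma riemannUp_eventuallyEq (hh : h =ᶠ[𝓝 x] h') (a b c d : Fin m) :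
    riemannUp h a b c d =ᶠ[𝓝 x] riemannUp h' a b c d := by
  have h1 : ∀ᶠ y in 𝓝 x, ∀ k a b, christoffel h k a b y = christoffel h' k a b y :=
    eventually_all.2 fun k => eventually_all.2 fun a => eventually_all.2 fun b =>
      christoffel_eventuallyEq hh k a b
  filter_upwards [h1, pd_eventuallyEq (christoffel_eventuallyEq hh d b c) a,
    pd_eventuallyEq (christoffel_eventuallyEq hh d a c) b] with y h1 h2 h3
  simp only [riemannUp, h1, h2, h3]

lemma riemann_eventuallyEq (hh : h =ᶠ[𝓝 x] h') (a b c d : Fin m) :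
    riemann h a b c d =ᶠ[𝓝 x] riemann h' a b c d := by
  have h1 : ∀ᶠ y in 𝓝 x, ∀ e, riemannUp h a b c e y = riemannUp h' a b c e y :=
    eventually_all.2 fun e => riemannUp_eventuallyEq hh a b c e
  filter_upwards [hh, h1] with y hy h1
  simp only [riemann, hy, h1]

lemma curv_congr (hh : h =ᶠ[𝓝 x] h') (s t u v : V m) : curv h x s t u v = curv h' x s t u v := by
  simp only [curv, (riemann_eventuallyEq hh _ _ _ _).self_of_nhds]

lemma nablaCurv_congr (hh : h =ᶠ[𝓝 x] h') (r s t u v : V m) :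
    nablaCurv h x r s t u v = nablaCurv h' x r s t u v := by
  simp only [nablaCurv, nablaRiemann, (riemann_eventuallyEq hh _ _ _ _).self_of_nhds,
    (christoffel_eventuallyEq hh _ _ _).self_of_nhds, pd_congr (riemann_eventuallyEq hh _ _ _ _)]

/-- The second fundamental form depends only on the germs of the metric and of the submanifold. -/
lemma secondFF_congr {y Υ : V n → V m} {z : V n} (hy : ContinuousAt y z)
    (hh : h =ᶠ[𝓝 (y z)] h') (i j : Fin n) : secondFF h y Υ i j z = secondFF h' y Υ i j z := by
  have h1 : unitNormal h y Υ =ᶠ[𝓝 z] unitNormal h' y Υ := by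
    filter_upwards [hy.eventually hh] with z' hz'
    have h2 : ∀ u v, ip h (y z') u v = ip h' (y z') u v := fun u v => by simp only [ip, hz']
    have h3 : firstFF h y z' = firstFF h' y z' := by
      ext i j
      simp only [firstFF, Matrix.of_apply, h2]
    simp only [unitNormal, preNormal, h2, h3]
  simp only [secondFF, covAlong, ip, hh.self_of_nhds,
    (christoffel_eventuallyEq hh _ _ _).self_of_nhds, pd_congr h1, h1.self_of_nhds]

end Congruence

section Multilinear

variable {m : ℕ}

lemma sum_of_isLinearMap {f : V m → ℝ} (hf : IsLinearMap ℝ f) (v : V m) :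
    f v = ∑ a, f (coordVec a) * v a := by
  conv_lhs => rw [← sum_smul_coordVec v]
  have h1 := map_sum (hf.mk' f) (fun a => v a • coordVec a) Finset.univ
  simp only [map_smul, IsLinearMap.mk'_apply, smul_eq_mul] at h1
  rw [h1]
  exact Finset.sum_congr rfl fun a _ => mul_comm _ _

lemma sum_of_isLinearMap₄ {f : V m → V m → V m → V m → ℝ}
    (h1 : ∀ t u v, IsLinearMap ℝ fun s => f s t u v) (h2 : ∀ s u v, IsLinearMap ℝ fun t => f s t u v)
    (h3 : ∀ s t v, IsLinearMap ℝ fun u => f s t u v) (h4 : ∀ s t u, IsLinearMap ℝ fun v => f s t u v)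
    (s t u v : V m) : f s t u v = ∑ a, ∑ b, ∑ c, ∑ d,
      f (coordVec a) (coordVec b) (coordVec c) (coordVec d) * s a * t b * u c * v d := by
  rw [sum_of_isLinearMap (h1 t u v)]
  refine Finset.sum_congr rfl fun a _ => ?_
  rw [sum_of_isLinearMap (h2 _ u v), Finset.sum_mul]
  refine Finset.sum_congr rfl fun b _ => ?_
  rw [sum_of_isLinearMap (h3 _ _ v), Finset.sum_mul, Finset.sum_mul]
  refine Finset.sum_congr rfl fun c _ => ?_
  rw [sum_of_isLinearMap (h4 _ _ _), Finset.sum_mul, Finset.sum_mul, Finset.sum_mul]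
  exact Finset.sum_congr rfl fun d _ => by ring

end Multilinear

section Curvature

open Filter Topology

variable {m : ℕ} {ε : ℝ} {H : V m → Bil m}

/-- The part of the curvature tensor that is linear in the second derivatives `A` of the metric. -/
def linCurv (A : V m →L[ℝ] V m →L[ℝ] Bil m) (a b c d : V m) : ℝ :=
  (1 / 2) * (A a c b d + A b d a c - A b c a d - A a d b c)

lemma linCurv_eq_sum (A : V m →L[ℝ] V m →L[ℝ] Bil m) (s t u v : V m) :
    linCurv A s t u v = ∑ a, ∑ b, ∑ c, ∑ d,
      linCurv A (coordVec a) (coordVec b) (coordVec c) (coordVec d) * s a * t b * u c * v d := by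
  refine sum_of_isLinearMap₄ (f := linCurv A) ?_ ?_ ?_ ?_ s t u v <;>
  · intro _ _ _
    constructor
    · intro _ _
      simp only [linCurv, map_add, _root_.add_apply]
      ring
    · intro _ _
      simp only [linCurv, map_smul, _root_.smul_apply, smul_eq_mul]
      ring

lemma contDiffAt_christoffel {x : V m} (hH : ContDiff ℝ ∞ H) (hu : IsUnit (mat (H x)).det)
    (k a b : Fin m) : ContDiffAt ℝ ∞ (christoffel (fun y => mat (H y)) k a b) x := by
  have he : ∀ a b, ContDiff ℝ ∞ fun y => (mat (H y)) a b := fun a b =>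
    (hH.clm_apply contDiff_const).clm_apply contDiff_const
  have hp : ∀ c a b, ContDiff ℝ ∞ fun x => pd c (fun y => (mat (H y)) a b) x := fun c a b =>
    ((he a b).fderiv_right (m := ∞) (by simp)).clm_apply contDiff_const
  unfold christoffel
  refine contDiffAt_const.mul (ContDiffAt.sum fun l _ => ContDiffAt.mul ?_ ?_)
  · exact contDiffAt_matrix_inv (fun i j => (he i j).contDiffAt) hu k l
  · exact (((hp _ _ _).add (hp _ _ _)).sub (hp _ _ _)).contDiffAt

lemma eventually_isUnit_det {x : V m} (hH : Continuous H) (hu : IsUnit (mat (H x)).det) :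
    ∀ᶠ y in 𝓝 x, IsUnit (mat (H y)).det := by
  have hc : Continuous fun y => (mat (H y)).det := Continuous.matrix_det
    (continuous_matrix fun i j => (hH.clm_apply continuous_const).clm_apply continuous_const)
  filter_upwards [hc.continuousAt.eventually_ne hu.ne_zero] with y hy using isUnit_iff_ne_zero.2 hy

/-- The derivative of the lowered Christoffel symbols. -/
lemma deriv_sum_mul_christoffel {x : V m} (hH : ContDiff ℝ ∞ H) (hu : IsUnit (mat (H x)).det)
    (e d a b : Fin m) :
    ∑ k, (H x (coordVec d) (coordVec k) * pd e (christoffel (fun y => mat (H y)) k a b) x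
        + der1 H x (coordVec e) (coordVec d) (coordVec k)
          * christoffel (fun y => mat (H y)) k a b x)
      = lowChr (der2 H x (coordVec e)) (coordVec d) (coordVec a) (coordVec b) := by
  have h1 : (fun y => ∑ k, H y (coordVec d) (coordVec k)
      * christoffel (fun y => mat (H y)) k a b y) =ᶠ[𝓝 x]
      fun y => lowChr (der1 H y) (coordVec d) (coordVec a) (coordVec b) := by
    filter_upwards [eventually_isUnit_det hH.continuous hu] with y hy
    exact sum_mul_christoffel (Eventually.of_forall fun _ => rfl)
      (hH.differentiable (by simp) y) hy d a b
  have h2 : ∀ k, HasFDerivAt (fun y => H y (coordVec d) (coordVec k)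
      * christoffel (fun y => mat (H y)) k a b y) _ x := fun k =>
    ((((hasFDerivAt_der1 hH x).clm_apply (hasFDerivAt_const _ x)).clm_apply
      (hasFDerivAt_const _ x)).differentiableAt.hasFDerivAt).mul
      ((contDiffAt_christoffel hH hu k a b).differentiableAt (by simp)).hasFDerivAt
  have h3 := HasFDerivAt.fun_sum (u := Finset.univ) fun k _ => h2 k
  have h4 := congrArg (fun L => L (coordVec e)) (h3.fderiv.symm.trans h1.fderiv_eq)
  have hd := differentiableAt_der1_apply hH x
  have h5 : fderiv ℝ (fun y => lowChr (der1 H y) (coordVec d) (coordVec a) (coordVec b)) x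
      (coordVec e) = lowChr (der2 H x (coordVec e)) (coordVec d) (coordVec a) (coordVec b) := by
    simp only [lowChr]
    rw [fderiv_const_mul (((hd _ _ _).fun_add (hd _ _ _)).fun_sub (hd _ _ _)), _root_.smul_apply,
      fderiv_fun_sub ((hd _ _ _).fun_add (hd _ _ _)) (hd _ _ _), _root_.sub_apply,
      fderiv_fun_add (hd _ _ _) (hd _ _ _), _root_.add_apply, fderiv_der1_apply hH,
      fderiv_der1_apply hH, fderiv_der1_apply hH, smul_eq_mul]
  rw [← h5, ← h4]
  simp only [_root_.sum_apply, _root_.add_apply, _root_.smul_apply, smul_eq_mul]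
  refine Finset.sum_congr rfl fun k _ => ?_
  rw [fderiv_apply₂ (hH.differentiable (by simp) x), pd, der1]
  ring

/-- The curvature tensor is the sum of its linear part and of a quadratic expression in the first
derivatives of the metric and the Christoffel symbols. -/
lemma riemann_eq {x : V m} (hH : ContDiff ℝ ∞ H)
    (hu : IsUnit (mat (H x)).det) (a b c d : Fin m) :
    riemann (fun y => mat (H y)) a b c d x
      = linCurv (der2 H x) (coordVec a) (coordVec b) (coordVec c) (coordVec d)
        + ((∑ k, der1 H x (coordVec b) (coordVec d) (coordVec k)
            * christoffel (fun y => mat (H y)) k a c x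
          - ∑ k, der1 H x (coordVec a) (coordVec d) (coordVec k)
            * christoffel (fun y => mat (H y)) k b c x)
          + ∑ k, ∑ e, (H x (coordVec d) (coordVec k) * christoffel (fun y => mat (H y)) k a e x
                * christoffel (fun y => mat (H y)) e b c x
              - H x (coordVec d) (coordVec k) * christoffel (fun y => mat (H y)) k b e x
                * christoffel (fun y => mat (H y)) e a c x)) := by
  have h1 := deriv_sum_mul_christoffel hH hu a d b c
  have h2 := deriv_sum_mul_christoffel hH hu b d a c
  rw [Finset.sum_add_distrib] at h1 h2
  have h3 : linCurv (der2 H x) (coordVec a) (coordVec b) (coordVec c) (coordVec d)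
      = lowChr (der2 H x (coordVec a)) (coordVec d) (coordVec b) (coordVec c)
        - lowChr (der2 H x (coordVec b)) (coordVec d) (coordVec a) (coordVec c) := by
    simp only [linCurv, lowChr]
    rw [der2_symm hH x (coordVec b) (coordVec a)]
    ring
  rw [h3, ← h1, ← h2]
  simp only [riemann, riemannUp, mat_apply, mul_add, mul_sub, Finset.sum_add_distrib,
    Finset.sum_sub_distrib, Finset.mul_sum, mul_assoc]
  ring

lemma hasFDerivAt_mul_zero {E : Type*} [NormedAddCommGroup E] [NormedSpace ℝ E] {f g : E → ℝ}
    {x : E} (hf : DifferentiableAt ℝ f x) (hg : DifferentiableAt ℝ g x) (hf0 : f x = 0)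
    (hg0 : g x = 0) : HasFDerivAt (fun y => f y * g y) (0 : E →L[ℝ] ℝ) x := by
  simpa [hf0, hg0] using hf.hasFDerivAt.fun_mul hg.hasFDerivAt

lemma mat_eucl : mat (eucl m) = 1 := by
  ext a b
  rw [mat_apply, eucl_apply, Matrix.one_apply]
  simp [coordVec, EuclideanSpace.inner_single_left]

lemma IsNormalMetric.isUnit_det_zero (h : IsNormalMetric ε H) : IsUnit (mat (H 0)).det := by
  rw [h.zero, mat_eucl]
  simp

lemma IsNormalMetric.christoffel_zero (h : IsNormalMetric ε H) (k a b : Fin m) :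
    christoffel (fun y => mat (H y)) k a b 0 = 0 := by
  have h1 : ∀ a b c, pd c (fun y => (mat (H y)) a b) (0 : V m) = 0 := fun a b c => by
    rw [pd_entry (h := fun y => mat (H y)) (Eventually.of_forall fun _ => rfl)
      (h.smooth.differentiable (by simp) 0)]
    change der1 H 0 _ _ _ = 0
    simp [h.der1_zero]
  simp only [christoffel, h1]
  simp

lemma IsNormalMetric.riemann_zero (h : IsNormalMetric ε H) (a b c d : Fin m) :
    riemann (fun y => mat (H y)) a b c d 0
      = linCurv (der2 H 0) (coordVec a) (coordVec b) (coordVec c) (coordVec d) := by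
  rw [riemann_eq h.smooth h.isUnit_det_zero]
  simp [h.christoffel_zero]

/-- The quadratic part of the curvature tensor does not contribute to its first derivatives at the
centre, as each of its terms is a product of two functions vanishing there. -/
lemma IsNormalMetric.pd_riemann_zero (h : IsNormalMetric ε H) (e a b c d : Fin m) :
    pd e (riemann (fun y => mat (H y)) a b c d) 0
      = linCurv (der3 H 0 (coordVec e)) (coordVec a) (coordVec b) (coordVec c) (coordVec d) := by
  have hu := h.isUnit_det_zero
  have hG : ∀ k a b, DifferentiableAt ℝ (christoffel (fun y => mat (H y)) k a b) 0 := fun k a b =>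
    (contDiffAt_christoffel h.smooth hu k a b).differentiableAt (by simp)
  have hD : ∀ a b c, DifferentiableAt ℝ (fun y => der1 H y a b c) 0 := fun a b c =>
    differentiableAt_der1_apply h.smooth 0 a b c
  have hE : ∀ a b, DifferentiableAt ℝ (fun y => H y a b) 0 := fun a b =>
    ((h.smooth.clm_apply contDiff_const).clm_apply contDiff_const).differentiable (by simp) 0
  have h1 := eventually_isUnit_det h.smooth.continuous hu
  have h2 := h1.mono fun y hy => riemann_eq h.smooth hy a b c d
  have hp : ∀ a b d k a' c', HasFDerivAt (fun x => der1 H x a b d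
      * christoffel (fun y => mat (H y)) k a' c' x) (0 : V m →L[ℝ] ℝ) 0 := fun a b d k a' c' =>
    hasFDerivAt_mul_zero (hD _ _ _) (hG _ _ _) (by simp [h.der1_zero]) (h.christoffel_zero _ _ _)
  have hq : ∀ d k k' a e e' b c, HasFDerivAt (fun x => H x d k
      * christoffel (fun y => mat (H y)) k' a e x * christoffel (fun y => mat (H y)) e' b c x)
      (0 : V m →L[ℝ] ℝ) 0 := fun d k k' a e e' b c =>
    hasFDerivAt_mul_zero ((hE _ _).fun_mul (hG _ _ _)) (hG _ _ _)
      (by simp [h.christoffel_zero]) (h.christoffel_zero _ _ _)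
  have h3 := ((HasFDerivAt.fun_sum (u := Finset.univ) fun k _ =>
      hp (coordVec b) (coordVec d) (coordVec k) k a c).fun_sub
    (HasFDerivAt.fun_sum (u := Finset.univ) fun k _ =>
      hp (coordVec a) (coordVec d) (coordVec k) k b c)).fun_add
    (HasFDerivAt.fun_sum (u := Finset.univ) fun k _ =>
      HasFDerivAt.fun_sum (u := Finset.univ) fun e _ =>
        (hq (coordVec d) (coordVec k) k a e e b c).fun_sub
          (hq (coordVec d) (coordVec k) k b e e a c))
  have hA := differentiableAt_der2_apply h.smooth (0 : V m)
  have h4 : DifferentiableAt ℝ (fun x => linCurv (der2 H x) (coordVec a) (coordVec b) (coordVec c)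
      (coordVec d)) 0 := by
    simp only [linCurv]
    exact ((((hA _ _ _ _).fun_add (hA _ _ _ _)).fun_sub (hA _ _ _ _)).fun_sub
      (hA _ _ _ _)).const_mul _
  rw [pd, Filter.EventuallyEq.fderiv_eq h2, (h4.hasFDerivAt.fun_add h3).fderiv]
  simp only [Finset.sum_const_zero, sub_zero, add_zero]
  simp only [linCurv]
  rw [fderiv_const_mul ((((hA _ _ _ _).fun_add (hA _ _ _ _)).fun_sub (hA _ _ _ _)).fun_sub
      (hA _ _ _ _)), _root_.smul_apply,
    fderiv_fun_sub (((hA _ _ _ _).fun_add (hA _ _ _ _)).fun_sub (hA _ _ _ _)) (hA _ _ _ _),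
    _root_.sub_apply, fderiv_fun_sub ((hA _ _ _ _).fun_add (hA _ _ _ _)) (hA _ _ _ _),
    _root_.sub_apply, fderiv_fun_add (hA _ _ _ _) (hA _ _ _ _), _root_.add_apply,
    fderiv_der2_apply h.smooth, fderiv_der2_apply h.smooth, fderiv_der2_apply h.smooth,
    fderiv_der2_apply h.smooth, smul_eq_mul]

/-- The curvature tensor at the centre of normal coordinates. -/
lemma IsNormalMetric.curv_zero (h : IsNormalMetric ε H) (s t u v : V m) :
    curv (fun y => mat (H y)) 0 s t u v = linCurv (der2 H 0) s t u v := by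
  rw [linCurv_eq_sum]
  simp only [curv, h.riemann_zero]

/-- The covariant derivative of the curvature tensor at the centre of normal coordinates. -/
lemma IsNormalMetric.nablaCurv_zero (h : IsNormalMetric ε H) (r s t u v : V m) :
    nablaCurv (fun y => mat (H y)) 0 r s t u v = linCurv (der3 H 0 r) s t u v := by
  have h1 : IsLinearMap ℝ fun r => linCurv (der3 H 0 r) s t u v := by
    constructor
    · intro _ _
      simp only [linCurv, map_add, _root_.add_apply]
      ring
    · intro _ _
      simp only [linCurv, map_smul, _root_.smul_apply, smul_eq_mul]
      ring
  rw [sum_of_isLinearMap h1]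
  simp only [nablaCurv, nablaRiemann, h.christoffel_zero, h.pd_riemann_zero, zero_mul, add_zero,
    Finset.sum_const_zero, sub_zero]
  refine Finset.sum_congr rfl fun e _ => ?_
  rw [linCurv_eq_sum]
  simp only [Finset.sum_mul]
  refine Finset.sum_congr rfl fun a _ => Finset.sum_congr rfl fun b _ =>
    Finset.sum_congr rfl fun c _ => Finset.sum_congr rfl fun d _ => by ring

/-- Pair symmetry of the second derivatives of the metric at the centre, a consequence of the
third derivative of the identity of the Gauss lemma. -/
lemma IsNormalMetric.der2_pair_symm (h : IsNormalMetric ε H) (a b c d : V m) :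
    der2 H 0 a b c d = der2 H 0 c d a b := by
  have sL := der2_symm h.smooth (0 : V m)
  have sR := der2_symm_right h.smooth h.symm (0 : V m)
  have cyc : ∀ a b c d, der2 H 0 a b c d + der2 H 0 b c a d + der2 H 0 c a b d = 0 :=
    fun a b c d => by
      have h1 := h.gauss_deriv₃ (mem_ball_self h.pos) b a d c
      simp only [map_zero, _root_.zero_apply] at h1
      rw [sL c b] at h1
      linarith
  have h1 := cyc a b c d
  have h2 := cyc b c d a
  have h3 := cyc c d a b
  have h4 := cyc d a b c
  rw [sR b c d a, sR c d b a, sL d b, sR b d c a] at h2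
  rw [sL c a] at h1
  rw [sL d a, sR a d c b, sR a c d b] at h3
  rw [sL d a, sR a b d c] at h4
  linarith

lemma IsNormalMetric.der2_cyclic (h : IsNormalMetric ε H) (a b c d : V m) :
    der2 H 0 a b c d + der2 H 0 b c a d + der2 H 0 a c b d = 0 := by
  have sL := der2_symm h.smooth (0 : V m)
  have h1 := h.gauss_deriv₃ (mem_ball_self h.pos) b a d c
  simp only [map_zero, _root_.zero_apply] at h1
  rw [sL c b, sL c a] at h1
  linarith

/-- The second order term of the radial expansion of the metric. -/
lemma IsNormalMetric.der2_radial (h : IsNormalMetric ε H) (θ a b : V m) :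
    der2 H 0 θ θ a b = (2 / 3) * curv (fun y => mat (H y)) 0 θ a θ b := by
  have sL := der2_symm h.smooth (0 : V m)
  have sR := der2_symm_right h.smooth h.symm (0 : V m)
  rw [h.curv_zero, linCurv]
  have h1 := h.der2_cyclic θ θ a b
  have h2 := h.der2_cyclic θ θ b a
  have h3 := h.der2_pair_symm a b θ θ
  rw [sR θ θ b a] at h2
  rw [sL a θ, sR θ b a θ, h3]
  linarith

/-- The third order term of the radial expansion of the metric. -/
lemma IsNormalMetric.der3_radial (h : IsNormalMetric ε H) (θ a b : V m) :
    der3 H 0 θ θ θ a b = nablaCurv (fun y => mat (H y)) 0 θ θ a θ b := by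
  have sL := der3_symm_left h.smooth (0 : V m)
  have sM := der3_symm_mid h.smooth (0 : V m)
  have sR := der3_symm_right h.smooth h.symm (0 : V m)
  rw [h.nablaCurv_zero, linCurv]
  have h2 := h.gauss_deriv₄ θ θ a θ b
  have h3 := h.gauss_deriv₄ θ b θ a θ
  simp only [sL b θ, sM θ b θ, sM θ a θ, sR θ θ b a θ, sR θ θ a b θ, sR θ θ θ b a] at h2 h3 ⊢
  have h4 := h.gauss_deriv₄ θ θ b θ a
  have e1 : der3 H 0 a θ θ θ b = der3 H 0 θ θ a θ b := by rw [sL a θ, sM θ a θ]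
  have e2 : der3 H 0 a b θ θ θ = der3 H 0 θ a b θ θ := by rw [sM a b θ, sL a θ]
  rw [e1] at h4
  rw [e2] at h3
  linarith

/-- The first order term of the radial expansion of the lowered Christoffel symbols. -/
lemma IsNormalMetric.lowChr_radial (h : IsNormalMetric ε H) (θ c a b : V m) :
    lowChr (der2 H 0 θ) c a b = (1 / 3) * (curv (fun y => mat (H y)) 0 c a b θ
      + curv (fun y => mat (H y)) 0 θ a b c) := by
  have sL := der2_symm h.smooth (0 : V m)
  have sR := der2_symm_right h.smooth h.symm (0 : V m)
  rw [h.curv_zero, h.curv_zero, linCurv, linCurv, lowChr]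
  -- with `pair` and the symmetries, all terms are expressed by `∂_θ ∂_a h_bc`, `∂_θ ∂_b h_ac` and
  -- `∂_θ ∂_c h_ab`, whose sum vanishes
  have h1 := h.der2_cyclic θ a b c
  have pair := h.der2_pair_symm
  have e1 : der2 H 0 c b a θ = der2 H 0 θ a b c := by rw [pair, sL a θ, sR]
  have e2 : der2 H 0 a θ c b = der2 H 0 θ a b c := by rw [sL a θ, sR]
  have e3 : der2 H 0 a b c θ = der2 H 0 θ c a b := by rw [pair, sL c θ]
  have e4 : der2 H 0 a c θ b = der2 H 0 θ b a c := by rw [pair]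
  have e5 : der2 H 0 a b θ c = der2 H 0 θ c a b := by rw [pair]
  rw [e5] at h1
  rw [e1, e2, e3, e4, e5, sL c θ]
  linarith

end Curvature

/-! ### The second fundamental form of a hypersurface -/

section SecondFundamentalForm

open Filter Topology

variable {m n : ℕ} {H : V m → Bil m} {y Υ : V n → V m} {z : V n}

lemma contDiffAt_pd {W : Type*} [NormedAddCommGroup W] [NormedSpace ℝ W] {f : V n → W} {z : V n}
    {r s : WithTop ℕ∞} (hf : ContDiffAt ℝ s f z) (hrs : r + 1 ≤ s) (i : Fin n) :
    ContDiffAt ℝ r (pd i f) z :=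
  (hf.fderiv_right hrs).clm_apply contDiffAt_const

lemma firstFF_apply (i j : Fin n) : firstFF (fun x => mat (H x)) y z i j
    = H (y z) (pd i y z) (pd j y z) := by
  rw [firstFF, Matrix.of_apply, ip_eq rfl]

/-- `Ñ` is orthogonal to the submanifold. -/
lemma apply_preNormal (hs : ∀ a b, H (y z) a b = H (y z) b a)
    (hM : IsUnit (firstFF (fun x => mat (H x)) y z).det) (i : Fin n) :
    H (y z) (preNormal (fun x => mat (H x)) y Υ z) (pd i y z) = 0 := by
  set M := firstFF (fun x => mat (H x)) y z with hMdef
  set b : Fin n → ℝ := fun i => ip (fun x => mat (H x)) (y z) (Υ z) (pd i y z) with hb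
  have h1 : (M *ᵥ (M⁻¹ *ᵥ b)) i = b i := by
    rw [Matrix.mulVec_mulVec, Matrix.mul_nonsing_inv _ hM, Matrix.one_mulVec]
  have h2 : b i = H (y z) (Υ z) (pd i y z) := by rw [hb]; exact ip_eq rfl _ _
  rw [preNormal, ← hMdef, ← hb, map_add, map_neg, map_sum, _root_.add_apply, _root_.neg_apply,
    _root_.sum_apply, ← h2, ← h1, Matrix.mulVec, dotProduct, neg_add_eq_zero]
  refine Finset.sum_congr rfl fun j _ => ?_
  rw [map_smul, _root_.smul_apply, smul_eq_mul, hMdef, firstFF_apply, hs, mul_comm]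

lemma contDiffAt_preNormal (hH : ContDiff ℝ ∞ H) (hy : ContDiffAt ℝ 2 y z)
    (hΥ : ContDiffAt ℝ 1 Υ z) (hM : IsUnit (firstFF (fun x => mat (H x)) y z).det) :
    ContDiffAt ℝ 1 (preNormal (fun x => mat (H x)) y Υ) z := by
  have hH1 : ContDiffAt ℝ 1 (fun z' => H (y z')) z :=
    (hH.contDiffAt.of_le (by exact_mod_cast le_top)).comp z (hy.of_le (by norm_num))
  have hp : ∀ i, ContDiffAt ℝ 1 (pd i y) z := fun i => contDiffAt_pd hy (by norm_num) i
  have hf : ∀ i j, ContDiffAt ℝ 1 (fun z' => firstFF (fun x => mat (H x)) y z' i j) z :=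
    fun i j => by
      simp only [firstFF_apply]
      exact (hH1.clm_apply (hp i)).clm_apply (hp j)
  have hb : ∀ i, ContDiffAt ℝ 1 (fun z' => ip (fun x => mat (H x)) (y z') (Υ z') (pd i y z')) z :=
    fun i => by
      simp only [ip_eq (h := fun x => mat (H x)) rfl]
      exact (hH1.clm_apply hΥ).clm_apply (hp i)
  refine hΥ.neg.add (ContDiffAt.sum fun j _ => ?_)
  have hA : ContDiffAt ℝ 1 (fun z' => ((firstFF (fun x => mat (H x)) y z')⁻¹ *ᵥ fun i =>
      ip (fun x => mat (H x)) (y z') (Υ z') (pd i y z')) j) z := by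
    simp only [Matrix.mulVec, dotProduct]
    exact ContDiffAt.sum fun i _ => (contDiffAt_matrix_inv hf hM j i).mul (hb i)
  exact hA.smul (hp j)

lemma fderiv_bil_apply_apply {A : V n → Bil m} {A' : V n →L[ℝ] Bil m} {u v : V n → V m}
    (hA : HasFDerivAt A A' z) (hu : DifferentiableAt ℝ u z) (hv : DifferentiableAt ℝ v z)
    (e : V n) : fderiv ℝ (fun z' => A z' (u z') (v z')) z e
      = A' e (u z) (v z) + A z (fderiv ℝ u z e) (v z) + A z (u z) (fderiv ℝ v z e) := by
  have h1 : DifferentiableAt ℝ (fun z' => A z' (u z')) z := hA.differentiableAt.clm_apply hu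
  rw [fderiv_clm_apply h1 hv, fderiv_clm_apply hA.differentiableAt hu, hA.fderiv]
  simp
  ring

/-- The second fundamental form in terms of the second derivatives of a parametrization and the
lowered Christoffel symbols: the derivative of `g(N, Z_j) = 0`. -/
lemma secondFF_eq (hH : ContDiff ℝ ∞ H) (hs : ∀ x a b, H x a b = H x b a)
    (hy : ContDiffAt ℝ 2 y z) (hΥ : ContDiffAt ℝ 1 Υ z) (hu : IsUnit (mat (H (y z))).det)
    (hM : IsUnit (firstFF (fun x => mat (H x)) y z).det)
    (hN : 0 < H (y z) (preNormal (fun x => mat (H x)) y Υ z)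
      (preNormal (fun x => mat (H x)) y Υ z)) (i j : Fin n) :
    secondFF (fun x => mat (H x)) y Υ i j z
      = H (y z) (unitNormal (fun x => mat (H x)) y Υ z) (pd i (pd j y) z)
        + lowChr (der1 H (y z)) (unitNormal (fun x => mat (H x)) y Υ z) (pd i y z)
          (pd j y z) := by
  set N := unitNormal (fun x => mat (H x)) y Υ with hNdef
  have hHy : HasFDerivAt (fun z' => H (y z')) ((der1 H (y z)).comp (fderiv ℝ y z)) z :=
    (hasFDerivAt_der1 hH (y z)).comp z (hy.differentiableAt (by norm_num)).hasFDerivAt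
  have hp : ∀ i, ContDiffAt ℝ 1 (pd i y) z := fun i => contDiffAt_pd hy (by norm_num) i
  have hpre := contDiffAt_preNormal hH hy hΥ hM
  have hH1 : ContDiffAt ℝ 1 (fun z' => H (y z')) z :=
    (hH.contDiffAt.of_le (by exact_mod_cast le_top)).comp z (hy.of_le (by norm_num))
  have hNd : DifferentiableAt ℝ N z := by
    have h1 : ContDiffAt ℝ 1 (fun z' => ip (fun x => mat (H x)) (y z')
        (preNormal (fun x => mat (H x)) y Υ z') (preNormal (fun x => mat (H x)) y Υ z')) z := by
      simp only [ip_eq (h := fun x => mat (H x)) rfl]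
      exact (hH1.clm_apply hpre).clm_apply hpre
    have h2 : ip (fun x => mat (H x)) (y z) (preNormal (fun x => mat (H x)) y Υ z)
        (preNormal (fun x => mat (H x)) y Υ z) ≠ 0 := by
      rw [ip_eq rfl]
      exact hN.ne'
    exact (((h1.sqrt h2).inv (Real.sqrt_ne_zero'.2 (by rw [ip_eq rfl]; exact hN))).smul
      hpre).differentiableAt (by norm_num)
  -- `N` is orthogonal to `Z_j` near `z`
  have horth : (fun z' => H (y z') (N z') (pd j y z')) =ᶠ[𝓝 z] fun _ => 0 := by
    have hc : ContinuousAt (fun z' => (firstFF (fun x => mat (H x)) y z').det) z := by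
      refine (contDiffAt_det (r := 1) fun i j => ?_).continuousAt
      simp only [firstFF_apply]
      exact (hH1.clm_apply (hp i)).clm_apply (hp j)
    filter_upwards [hc.eventually_ne hM.ne_zero] with z' hz'
    rw [hNdef, unitNormal, map_smul, _root_.smul_apply,
      apply_preNormal (hs _) (isUnit_iff_ne_zero.2 hz'), smul_zero]
  have h2 : der1 H (y z) (pd i y z) (N z) (pd j y z)
      + H (y z) (pd i N z) (pd j y z) + H (y z) (N z) (pd i (pd j y) z) = 0 := by
    have h1 := fderiv_bil_apply_apply hHy hNd ((hp j).differentiableAt (by norm_num)) (coordVec i)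
    rw [horth.fderiv_eq, fderiv_const_apply, _root_.zero_apply] at h1
    exact h1.symm
  have h3 : covAlong (fun x => mat (H x)) y N i z
      = pd i N z + chrVec (fun x => mat (H x)) (y z) (pd i y z) (N z) := by
    ext k
    simp [covAlong, chrVec]
  have h4 : H (y z) (pd j y z) (chrVec (fun x => mat (H x)) (y z) (pd i y z) (N z))
      = lowChr (der1 H (y z)) (pd j y z) (pd i y z) (N z) :=
    apply_chrVec (Eventually.of_forall fun _ => rfl) (hH.differentiable (by simp) _) hu _ _ _
  rw [secondFF, ip_eq rfl, ← hNdef, h3, map_add, _root_.add_apply, hs _ (chrVec _ _ _ _), h4]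
  simp only [lowChr]
  have hsym := der1_symm hH hs (y z)
  rw [hsym (pd i y z) (pd j y z) (N z)]
  linarith

end SecondFundamentalForm

/-! ### The second fundamental form of a graph over a geodesic sphere -/

section JetFormula

variable {n : ℕ}

/-- The vectors `(1 - w) Θ_k - w_k Θ`, equal to `Z_k` up to the factor `ρ`. -/
def zvec (x : Frame n) (J : Jet n) (k : Fin n) : V (n + 1) := (1 - J.1) • x.2 k - J.2 k • x.1

/-- The Gram matrix of the vectors `zvec`. -/
def gram (B : Bil (n + 1)) (x : Frame n) (J : Jet n) : Matrix (Fin n) (Fin n) ℝ :=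
  Matrix.of fun k l => B (zvec x J k) (zvec x J l)

/-- The solution of `∑ l, gram k l * α l = w_k`. -/
def alpha (B : Bil (n + 1)) (x : Frame n) (J : Jet n) (k : Fin n) : ℝ :=
  ∑ l, (gram B x J)⁻¹ k l * J.2 l

/-- The length of the normal vector `Ñ`. -/
def normalLength (B : Bil (n + 1)) (x : Frame n) (J : Jet n) : ℝ :=
  √(1 - ∑ k, alpha B x J k * J.2 k)

/-- The normal vector `-Ñ`. -/
def outer (B : Bil (n + 1)) (x : Frame n) (J : Jet n) : V (n + 1) :=
  x.1 + ∑ k, alpha B x J k • zvec x J k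

lemma inner_zvec {x : Frame n} (hx : IsFrame x) (J : Jet n) (k : Fin n) :
    inner ℝ x.1 (zvec x J k) = -J.2 k := by
  rw [zvec, inner_sub_right, real_inner_smul_right, real_inner_smul_right, hx.2.1,
    real_inner_self_eq_norm_sq, hx.1]
  ring

lemma inner_zvec_right {x : Frame n} (hx : IsFrame x) (J : Jet n) (k l : Fin n) :
    inner ℝ (x.2 l) (zvec x J k) = if l = k then 1 - J.1 else 0 := by
  rw [zvec, inner_sub_right, real_inner_smul_right, real_inner_smul_right, hx.2.2,
    real_inner_comm, hx.2.1]
  simp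

lemma sum_zvec_ne_zero {x : Frame n} (hx : IsFrame x) {J : Jet n} (hJ : J.1 ≠ 1) {c : Fin n → ℝ}
    (hc : c ≠ 0) : ∑ k, c k • zvec x J k ≠ 0 := by
  intro h0
  refine hc (funext fun l => ?_)
  have h1 := congrArg (fun v => inner ℝ (x.2 l) v) h0
  simp only [inner_sum, real_inner_smul_right, inner_zvec_right hx, inner_zero_right] at h1
  simp only [mul_ite, mul_zero, Finset.sum_ite_eq, Finset.mem_univ, if_true] at h1
  exact (mul_eq_zero.1 h1).resolve_right (sub_ne_zero.2 hJ.symm)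

lemma outer_ne_zero (B : Bil (n + 1)) {x : Frame n} (hx : IsFrame x) {J : Jet n} (hJ : J.1 ≠ 1) :
    outer B x J ≠ 0 := by
  intro h0
  have hα : ∀ l, alpha B x J l = 0 := fun l => by
    have h1 := congrArg (fun v => inner ℝ (x.2 l) v) h0
    simp only [outer, inner_add_right, inner_sum, real_inner_smul_right, inner_zvec_right hx,
      inner_zero_right, real_inner_comm, hx.2.1] at h1
    simp only [mul_ite, mul_zero, Finset.sum_ite_eq, Finset.mem_univ, if_true, zero_add] at h1
    exact (mul_eq_zero.1 h1).resolve_right (sub_ne_zero.2 hJ.symm)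
  rw [outer] at h0
  simp only [hα, zero_smul, Finset.sum_const_zero, add_zero] at h0
  have h2 := hx.1
  rw [h0] at h2
  simp at h2

variable {B : Bil (n + 1)} {x : Frame n} {J : Jet n}

lemma isUnit_det_gram (hB : ∀ v, v ≠ 0 → 0 < B v v) (hx : IsFrame x) (hJ : J.1 ≠ 1) :
    IsUnit (gram B x J).det := by
  rw [← Matrix.isUnit_iff_isUnit_det, ← Matrix.mulVec_injective_iff_isUnit]
  refine (injective_iff_map_eq_zero (gram B x J).mulVecLin).2 fun c hc => ?_
  by_contra hne
  refine (hB _ (sum_zvec_ne_zero hx hJ hne)).ne' ?_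
  rw [map_sum B, _root_.sum_apply]
  refine Finset.sum_eq_zero fun k _ => ?_
  have h1 := congrFun hc k
  simp only [Matrix.mulVecLin_apply, Matrix.mulVec, dotProduct, gram, Matrix.of_apply,
    Pi.zero_apply] at h1
  rw [map_smul, _root_.smul_apply, map_sum, smul_eq_mul]
  simp only [map_smul, smul_eq_mul]
  have h2 : ∑ l, c l * B (zvec x J k) (zvec x J l) = 0 := by
    rw [← h1]
    exact Finset.sum_congr rfl fun l _ => mul_comm _ _
  rw [h2, mul_zero]

lemma sum_gram_mul_alpha (hu : IsUnit (gram B x J).det) (k : Fin n) :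
    ∑ l, gram B x J k l * alpha B x J l = J.2 k := by
  have h1 : (gram B x J *ᵥ ((gram B x J)⁻¹ *ᵥ fun l => J.2 l)) k = J.2 k := by
    rw [Matrix.mulVec_mulVec, Matrix.mul_nonsing_inv _ hu, Matrix.one_mulVec]
  exact h1

lemma outer_orthogonal (hs : ∀ a b, B a b = B b a) (hg : ∀ v, B x.1 v = inner ℝ x.1 v)
    (hx : IsFrame x) (hu : IsUnit (gram B x J).det) (k : Fin n) :
    B (outer B x J) (zvec x J k) = 0 := by
  have h1 := sum_gram_mul_alpha hu k
  rw [outer, map_add, _root_.add_apply, hg, inner_zvec hx, map_sum, _root_.sum_apply,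
    neg_add_eq_zero, ← h1]
  refine Finset.sum_congr rfl fun l _ => ?_
  rw [map_smul, _root_.smul_apply, smul_eq_mul, gram, Matrix.of_apply, hs, mul_comm]

lemma outer_apply (hs : ∀ a b, B a b = B b a) (hg : ∀ v, B x.1 v = inner ℝ x.1 v)
    (hx : IsFrame x) : B (outer B x J) x.1 = 1 - ∑ k, alpha B x J k * J.2 k := by
  rw [hs, outer, map_add, hg, real_inner_self_eq_norm_sq, hx.1, hg, inner_sum]
  simp only [real_inner_smul_right, inner_zvec hx, mul_neg, Finset.sum_neg_distrib]
  ring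

lemma outer_self (hs : ∀ a b, B a b = B b a) (hg : ∀ v, B x.1 v = inner ℝ x.1 v)
    (hx : IsFrame x) (hu : IsUnit (gram B x J).det) :
    B (outer B x J) (outer B x J) = 1 - ∑ k, alpha B x J k * J.2 k := by
  conv_lhs => rw [outer.eq_1 B x J, map_add, map_sum]
  rw [← outer, outer_apply hs hg hx]
  simp only [map_smul, outer_orthogonal hs hg hx hu, smul_zero, Finset.sum_const_zero, add_zero]

lemma normalLength_pos (hB : ∀ v, v ≠ 0 → 0 < B v v) (hs : ∀ a b, B a b = B b a)
    (hg : ∀ v, B x.1 v = inner ℝ x.1 v) (hx : IsFrame x) (hJ : J.1 ≠ 1) :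
    0 < 1 - ∑ k, alpha B x J k * J.2 k := by
  rw [← outer_self hs hg hx (isUnit_det_gram hB hx hJ)]
  exact hB _ (outer_ne_zero B hx hJ)

variable {ε : ℝ} {H : V (n + 1) → Bil (n + 1)}

/-- The expression `h(a, b) - ⟨a, b⟩ + (t / 2) ∂_θ h(a, b)`, up to a factor the second fundamental
form, minus its Euclidean value, of the geodesic sphere of radius `t`. -/
def sphereDefect (H : V (n + 1) → Bil (n + 1)) (t : ℝ) (θ a b : V (n + 1)) : ℝ :=
  H (t • θ) a b - inner ℝ a b + t / 2 * der1 H (t • θ) θ a b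

/-- The Gauss lemma on the sphere of radius `t`. -/
lemma IsNormalMetric.gauss_smul (h : IsNormalMetric ε H) {t : ℝ} (ht : t ≠ 0) {θ : V (n + 1)}
    (hb : t • θ ∈ ball (0 : V (n + 1)) ε) (v : V (n + 1)) :
    H (t • θ) θ v = inner ℝ θ v := by
  have h1 := h.gauss hb v
  rw [map_smul, _root_.smul_apply, real_inner_smul_left, smul_eq_mul] at h1
  exact mul_left_cancel₀ ht h1

/-- The second fundamental form of the geodesic sphere of radius `t` is a radial derivative of the
metric. -/
lemma IsNormalMetric.lowChr_normal (h : IsNormalMetric ε H) {t : ℝ} {θ : V (n + 1)}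
    (hb : t • θ ∈ ball (0 : V (n + 1)) ε) (a b : V (n + 1)) :
    t * lowChr (der1 H (t • θ)) θ a b = -sphereDefect H t θ a b := by
  have h1 : ∀ a b, t * der1 H (t • θ) a b θ = inner ℝ a b - H (t • θ) a b := fun a b => by
    have h2 := h.gauss_deriv₁ hb a b
    rw [map_smul, _root_.smul_apply, smul_eq_mul, der1_symm h.smooth h.symm] at h2
    linarith
  have h2 := h1 a b
  have h3 := h1 b a
  rw [real_inner_comm, h.symm] at h3
  rw [lowChr, sphereDefect]
  linarith

lemma IsNormalMetric.sphereDefect_left (h : IsNormalMetric ε H) {t : ℝ} (ht : t ≠ 0)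
    {θ : V (n + 1)} (hb : t • θ ∈ ball (0 : V (n + 1)) ε) (b : V (n + 1)) :
    sphereDefect H t θ θ b = 0 := by
  have h2 := h.gauss_deriv₁ hb θ b
  rw [map_smul, _root_.smul_apply, smul_eq_mul] at h2
  rw [sphereDefect]
  linarith [h.gauss_smul ht hb b]

lemma IsNormalMetric.sphereDefect_zvec (h : IsNormalMetric ε H) {t : ℝ} (ht : t ≠ 0)
    (hb : t • x.1 ∈ ball (0 : V (n + 1)) ε) (i j : Fin n) :
    sphereDefect H t x.1 (zvec x J i) (zvec x J j)
      = (1 - J.1) ^ 2 * sphereDefect H t x.1 (x.2 i) (x.2 j) := by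
  have hsymm : ∀ a b, sphereDefect H t x.1 a b = sphereDefect H t x.1 b a := fun a b => by
    rw [sphereDefect, sphereDefect, h.symm, real_inner_comm, der1_symm h.smooth h.symm]
  have hlin : ∀ (c d : ℝ) (a b e : V (n + 1)), sphereDefect H t x.1 (c • a - d • b) e
      = c * sphereDefect H t x.1 a e - d * sphereDefect H t x.1 b e := fun c d a b e => by
    simp only [sphereDefect, map_sub, map_smul, _root_.sub_apply, _root_.smul_apply,
      inner_sub_left, real_inner_smul_left, smul_eq_mul]
    ring
  have h0 := h.sphereDefect_left ht hb
  rw [zvec, hlin, h0, hsymm, zvec, hlin, h0, hsymm (x.2 j)]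
  ring

/-- The second fundamental form, as a function of the two-jet of `w`. Here `J` is the one-jet of `w`
and `D` stands for the second derivative `w_ij`. -/
lemma IsNormalMetric.secondFF_jet (h : IsNormalMetric ε H) (hx : IsFrame x) (hJ : J.1 < 1) {ρ : ℝ}
    (hρ : 0 < ρ) (hb : (ρ * (1 - J.1)) • x.1 ∈ ball (0 : V (n + 1)) ε)
    (hpos : ∀ v, v ≠ 0 → 0 < H ((ρ * (1 - J.1)) • x.1) v v) {y Υ : V n → V (n + 1)} {z : V n}
    (hy : ContDiffAt ℝ 2 y z) (hΥ : ContDiffAt ℝ 1 Υ z) (hy0 : y z = (ρ * (1 - J.1)) • x.1)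
    (hΥ0 : Υ z = x.1) (hy1 : ∀ k, pd k y z = ρ • zvec x J k) {i j : Fin n} {D : ℝ}
    (hy2 : pd i (pd j y) z = -(ρ • (((1 - J.1) * (if i = j then 1 else 0) + D) • x.1
      + (J.2 i • x.2 j + J.2 j • x.2 i)))) :
    secondFF (fun x => mat (H x)) y Υ i j z
      = ρ * (normalLength (H ((ρ * (1 - J.1)) • x.1)) x J * D
        + normalLength (H ((ρ * (1 - J.1)) • x.1)) x J * (1 - J.1) * (if i = j then 1 else 0)
        + (normalLength (H ((ρ * (1 - J.1)) • x.1)) x J)⁻¹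
          * ∑ k, alpha (H ((ρ * (1 - J.1)) • x.1)) x J k
            * H ((ρ * (1 - J.1)) • x.1) (zvec x J k) (J.2 i • x.2 j + J.2 j • x.2 i)
        + (normalLength (H ((ρ * (1 - J.1)) • x.1)) x J)⁻¹ * (1 - J.1)
          * sphereDefect H (ρ * (1 - J.1)) x.1 (x.2 i) (x.2 j)
        - ρ * (normalLength (H ((ρ * (1 - J.1)) • x.1)) x J)⁻¹
          * ∑ k, alpha (H ((ρ * (1 - J.1)) • x.1)) x J k
            * lowChr (der1 H ((ρ * (1 - J.1)) • x.1)) (zvec x J k) (zvec x J i)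
              (zvec x J j)) := by
  set t := ρ * (1 - J.1) with ht
  set B := H (t • x.1) with hB
  have ht0 : t ≠ 0 := (mul_pos hρ (sub_pos.2 hJ)).ne'
  have hs : ∀ a b, B a b = B b a := h.symm _
  have hg : ∀ v, B x.1 v = inner ℝ x.1 v := h.gauss_smul ht0 hb
  have hu : IsUnit (gram B x J).det := isUnit_det_gram hpos hx hJ.ne
  -- the first fundamental form and the normal in terms of the frame and the jet
  have hff : firstFF (fun x => mat (H x)) y z = (ρ ^ 2) • gram B x J := by
    ext k l
    rw [firstFF_apply, hy0, hy1, hy1, Matrix.smul_apply, gram, Matrix.of_apply, ← hB]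
    simp only [map_smul, _root_.smul_apply, smul_eq_mul]
    ring
  have hM : IsUnit (firstFF (fun x => mat (H x)) y z).det := by
    rw [hff, Matrix.det_smul]
    exact ((isUnit_iff_ne_zero.2 (pow_ne_zero _ hρ.ne')).pow _).mul hu
  have hpre : preNormal (fun x => mat (H x)) y Υ z = -outer B x J := by
    have h1 : (fun k => ip (fun x => mat (H x)) (y z) (Υ z) (pd k y z))
        = firstFF (fun x => mat (H x)) y z *ᵥ fun k => -ρ⁻¹ * alpha B x J k := by
      ext k
      rw [ip_eq rfl, hy0, hΥ0, hy1, ← hB, map_smul, hg, inner_zvec hx, hff, Matrix.mulVec,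
        dotProduct, ← sum_gram_mul_alpha hu k, smul_eq_mul, mul_neg, Finset.mul_sum,
        ← Finset.sum_neg_distrib]
      refine Finset.sum_congr rfl fun l _ => ?_
      rw [Matrix.smul_apply, smul_eq_mul]
      field_simp
    rw [preNormal, h1, Matrix.mulVec_mulVec, Matrix.nonsing_inv_mul _ hM, Matrix.one_mulVec, hΥ0,
      outer, neg_add, ← Finset.sum_neg_distrib]
    refine congrArg _ (Finset.sum_congr rfl fun k _ => ?_)
    rw [hy1, smul_smul, ← neg_smul]
    congr 1
    field_simp
  have hself := outer_self hs hg hx hu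
  have hlen := normalLength_pos hpos hs hg hx hJ.ne
  have hN : unitNormal (fun x => mat (H x)) y Υ z = -((normalLength B x J)⁻¹ • outer B x J) := by
    rw [unitNormal, hpre, ip_eq rfl, hy0, ← hB, map_neg, map_neg, _root_.neg_apply, neg_neg, hself,
      smul_neg, normalLength]
  have hlen' : 0 < normalLength B x J := Real.sqrt_pos.2 hlen
  have hsq : normalLength B x J ^ 2 = 1 - ∑ k, alpha B x J k * J.2 k := Real.sq_sqrt hlen.le
  rw [secondFF_eq h.smooth h.symm hy hΥ (by rw [hy0]; exact isUnit_det_mat hpos) hM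
    (by rw [hpre, hy0, ← hB, map_neg, map_neg, _root_.neg_apply, neg_neg, hself]; exact hlen),
    hN, hy2, hy1, hy1, hy0, ← hB]
  have hort : ∀ k, B x.1 (x.2 k) = 0 := fun k => by rw [hg, hx.2.1]
  -- the contribution of the second derivatives: `θ` is orthogonal to the frame by the Gauss lemma
  have e1 : B (outer B x J) (J.2 i • x.2 j + J.2 j • x.2 i)
      = ∑ k, alpha B x J k * B (zvec x J k) (J.2 i • x.2 j + J.2 j • x.2 i) := by
    rw [outer, map_add B, _root_.add_apply, map_add (B x.1), map_smul, map_smul, hort, hort,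
      smul_zero, smul_zero, add_zero, zero_add, map_sum, _root_.sum_apply]
    refine Finset.sum_congr rfl fun k _ => ?_
    rw [map_smul, _root_.smul_apply, smul_eq_mul]
  -- the contribution of the Christoffel symbols, split along `outer = θ + ∑ α_k z_k`
  have e2 : lowChr (der1 H (t • x.1)) (outer B x J) (zvec x J i) (zvec x J j)
      = lowChr (der1 H (t • x.1)) x.1 (zvec x J i) (zvec x J j)
        + ∑ k, alpha B x J k * lowChr (der1 H (t • x.1)) (zvec x J k) (zvec x J i)
          (zvec x J j) := by
    have hl : IsLinearMap ℝ fun c => lowChr (der1 H (t • x.1)) c (zvec x J i) (zvec x J j) := by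
      constructor
      · intro _ _
        simp only [lowChr, map_add, _root_.add_apply]
        ring
      · intro _ _
        simp only [lowChr, map_smul, _root_.smul_apply, smul_eq_mul]
        ring
    have h1 := map_add (hl.mk' _) x.1 (∑ k, alpha B x J k • zvec x J k)
    rw [map_sum] at h1
    rw [outer]
    simpa only [map_smul, IsLinearMap.mk'_apply, smul_eq_mul] using h1
  -- the radial part is the second fundamental form of the geodesic sphere
  have e3 : t * lowChr (der1 H (t • x.1)) x.1 (zvec x J i) (zvec x J j)
      = -((1 - J.1) ^ 2 * sphereDefect H t x.1 (x.2 i) (x.2 j)) := by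
    rw [h.lowChr_normal hb, h.sphereDefect_zvec ht0 hb]
  have e4 : lowChr (der1 H (t • x.1)) (-((normalLength B x J)⁻¹ • outer B x J))
      (ρ • zvec x J i) (ρ • zvec x J j) = -((normalLength B x J)⁻¹ * ρ ^ 2
        * lowChr (der1 H (t • x.1)) (outer B x J) (zvec x J i) (zvec x J j)) := by
    simp only [lowChr, map_smul, map_neg, _root_.smul_apply, _root_.neg_apply, smul_eq_mul]
    ring
  have e5 := outer_apply hs hg hx (J := J)
  rw [← hsq] at e5
  have e6 : ρ * lowChr (der1 H (t • x.1)) x.1 (zvec x J i) (zvec x J j)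
      = -((1 - J.1) * sphereDefect H t x.1 (x.2 i) (x.2 j)) := by
    refine mul_left_cancel₀ (sub_pos.2 hJ).ne' ?_
    linear_combination e3
  have e7 : (normalLength B x J)⁻¹ * normalLength B x J ^ 2 = normalLength B x J := by
    field_simp
  generalize J.2 i • x.2 j + J.2 j • x.2 i = u at e1 ⊢
  have e8 : ∀ c : ℝ, B (-((normalLength B x J)⁻¹ • outer B x J)) (-(ρ • (c • x.1 + u)))
      = (normalLength B x J)⁻¹ * ρ * (c * B (outer B x J) x.1 + B (outer B x J) u) := fun c => by
    simp only [map_smul, map_neg, map_add, _root_.smul_apply, _root_.neg_apply, smul_eq_mul]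
    ring
  rw [e4, e2, e8, e5, e1]
  linear_combination (ρ * ((1 - J.1) * (if i = j then 1 else 0) + D)) * e7
    - (normalLength B x J)⁻¹ * ρ * e6

end JetFormula

/-! ### Radial expansion of the metric, with remainders depending smoothly on all parameters -/

section RadialExpansion

open Filter Topology

/-- Taylor's formula in one variable, with parameters and a smooth remainder. -/
lemma exists_taylor_of_contDiff {Q W : Type} [NormedAddCommGroup Q] [NormedSpace ℝ Q]
    [NormedAddCommGroup W] [NormedSpace ℝ W] [CompleteSpace W] (N : ℕ) {G : Q × ℝ → W}
    (hG : ContDiff ℝ ∞ G) :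
    ∃ R : Q × ℝ → W, ContDiff ℝ ∞ R ∧ ∀ q t, G (q, t)
      = ∑ k ∈ Finset.range N, ((k.factorial : ℝ)⁻¹ * t ^ k) •
        iteratedDeriv k (fun s => G (q, s)) 0 + t ^ N • R (q, t) := by
  let f : ℕ → Q × ℝ → W := fun k => Nat.rec G (fun _ g z => fderiv ℝ g z (0, 1)) k
  have hf : ∀ k, ContDiff ℝ ∞ (f k) := fun k => by
    induction k with
    | zero => exact hG
    | succ k ih => exact (ih.fderiv_right (m := ∞) (by simp)).clm_apply contDiff_const
  have hd : ∀ k q t, HasDerivAt (fun s => f k (q, s)) (f (k + 1) (q, t)) t := fun k q t =>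
    ((hf k).differentiable (by simp) (q, t)).hasFDerivAt.comp_hasDerivAt t
      ((hasDerivAt_const t q).prodMk (hasDerivAt_id t))
  have hi : ∀ k q, iteratedDeriv k (fun s => G (q, s)) = fun s => f k (q, s) := fun k q => by
    induction k with
    | zero => exact iteratedDeriv_zero
    | succ k ih =>
      rw [iteratedDeriv_succ, ih]
      exact funext fun t => (hd k q t).deriv
  obtain ⟨R, hR, h⟩ := exists_taylor_remainder N f hf hd
  refine ⟨R, hR, fun q t => ?_⟩
  simp only [hi]
  exact h q t

variable {P : Type} [NormedAddCommGroup P] [NormedSpace ℝ P] {m : ℕ}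

lemma hasDerivAt_ray {W : Type*} [NormedAddCommGroup W] [NormedSpace ℝ W] {G : V m → W}
    (hG : ContDiff ℝ ∞ G) (θ : V m) (t : ℝ) :
    HasDerivAt (fun t : ℝ => G (t • θ)) (fderiv ℝ G (t • θ) θ) t := by
  have h2 : HasDerivAt (fun t : ℝ => t • θ) θ t := by
    simpa using (hasDerivAt_id t).smul_const θ
  exact (hG.differentiable (by simp) _).hasFDerivAt.comp_hasDerivAt t h2

lemma contDiff_fderiv_snd {W : Type*} [NormedAddCommGroup W] [NormedSpace ℝ W] {G : P × V m → W}
    (hG : ContDiff ℝ ∞ G) : ContDiff ℝ ∞ fun z : P × V m => fderiv ℝ (fun y => G (z.1, y)) z.2 :=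
  ContDiff.fderiv (f := fun (z : P × V m) y => G (z.1, y)) (g := fun z => z.2) (n := ∞)
    (hG.comp ((contDiff_fst.comp contDiff_fst).prodMk contDiff_snd)) contDiff_snd (by simp)

/-- The Taylor expansions, along rays, of the metrics of a normal family: `A` is the second derivative
of the metric at the centre, and `R`, `T` and `F` are the remainders for the metric, for its first
derivatives, and for the second fundamental form of geodesic spheres (`sphereDefect`). -/
structure IsRadialExpansion (K : Set P) (H : P × V m → Bil m)
    (A : P → V m →L[ℝ] V m →L[ℝ] Bil m) (R F : (P × V m) × ℝ → Bil m)
    (T : (P × V m) × ℝ → V m →L[ℝ] Bil m) : Prop where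
  smooth_A : ContDiff ℝ ∞ A
  smooth_R : ContDiff ℝ ∞ R
  smooth_F : ContDiff ℝ ∞ F
  smooth_T : ContDiff ℝ ∞ T
  eq_A : ∀ κ, A κ = der2 (fun y => H (κ, y)) 0
  metric : ∀ κ ∈ K, ∀ θ t, H (κ, t • θ) = eucl m + t ^ 2 • R ((κ, θ), t)
  deriv : ∀ κ ∈ K, ∀ θ t,
    der1 (fun y => H (κ, y)) (t • θ) = t • A κ θ + t ^ 2 • T ((κ, θ), t)
  radial : ∀ κ ∈ K, ∀ (θ : V m) (t : ℝ) (a b : V m), H (κ, t • θ) a b - inner ℝ a b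
      + t / 2 * der1 (fun y => H (κ, y)) (t • θ) θ a b
    = t ^ 2 * A κ θ θ a b + 5 / 12 * t ^ 3 * der3 (fun y => H (κ, y)) 0 θ θ θ a b
      + t ^ 4 * F ((κ, θ), t) a b

/-- The expansions of the metric and of its radial derivative combine to that of `sphereDefect`:
`1/2 + 1/2 = 1` in order two and `1/6 + 1/4 = 5/12` in order three. -/
lemma radial_algebra {h e d x₂ x₃ f₁ f₂ t : ℝ}
    (c : h = 0 + 1⁻¹ * t ^ 0 * e + 0 + 2⁻¹ * t ^ 2 * x₂ + 6⁻¹ * t ^ 3 * x₃ + t ^ 4 * f₁)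
    (c' : d = 0 + 0 + 1⁻¹ * t ^ 1 * x₂ + 2⁻¹ * t ^ 2 * x₃ + t ^ 3 * f₂) :
    h - e + t / 2 * d = t ^ 2 * x₂ + 5 / 12 * t ^ 3 * x₃ + t ^ 4 * (f₁ + 1 / 2 * f₂) := by
  rw [c, c']
  ring

/-- Taylor's formula with smooth remainder, applied along rays with all other variables as
parameters. -/
lemma IsNormalFamily.exists_radialExpansion {K : Set P} {ε : ℝ} {H : P × V m → Bil m}
    (h : IsNormalFamily K ε H) : ∃ A R F T, IsRadialExpansion K H A R F T := by
  have hs : ∀ κ, ContDiff ℝ ∞ fun y => H (κ, y) := fun κ =>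
    h.smooth.comp (contDiff_const.prodMk contDiff_id)
  have h1 : ContDiff ℝ ∞ fun z : P × V m => der1 (fun y => H (z.1, y)) z.2 :=
    contDiff_fderiv_snd h.smooth
  have h2 : ContDiff ℝ ∞ fun z : P × V m => der2 (fun y => H (z.1, y)) z.2 :=
    contDiff_fderiv_snd h1
  have hray : ContDiff ℝ ∞ fun z : (P × V m) × ℝ => (z.1.1, z.2 • z.1.2) :=
    (contDiff_fst.comp contDiff_fst).prodMk (contDiff_snd.smul (contDiff_snd.comp contDiff_fst))
  have hθ : ContDiff ℝ ∞ fun z : (P × V m) × ℝ => z.1.2 := contDiff_snd.comp contDiff_fst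
  have hG0 : ContDiff ℝ ∞ fun z : (P × V m) × ℝ => H (z.1.1, z.2 • z.1.2) := h.smooth.comp hray
  have hG1 : ContDiff ℝ ∞ fun z : (P × V m) × ℝ => der1 (fun y => H (z.1.1, y)) (z.2 • z.1.2) :=
    h1.comp hray
  obtain ⟨R, hR, eR⟩ := exists_taylor_of_contDiff 2 hG0
  obtain ⟨T, hT, eT⟩ := exists_taylor_of_contDiff 2 hG1
  obtain ⟨F₁, hF₁, eF₁⟩ := exists_taylor_of_contDiff 4 hG0
  obtain ⟨F₂, hF₂, eF₂⟩ := exists_taylor_of_contDiff 3 (hG1.clm_apply hθ)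
  -- the derivatives along rays
  have d1 : ∀ κ (θ : V m), deriv (fun s : ℝ => H (κ, s • θ))
      = fun s => der1 (fun y => H (κ, y)) (s • θ) θ := fun κ θ =>
    funext fun t => (hasDerivAt_ray (hs κ) θ t).deriv
  have d2 : ∀ κ (θ : V m), deriv (fun s : ℝ => der1 (fun y => H (κ, y)) (s • θ))
      = fun s => der2 (fun y => H (κ, y)) (s • θ) θ := fun κ θ =>
    funext fun t => (hasDerivAt_ray (contDiff_der1 (hs κ)) θ t).deriv
  have d2' : ∀ κ (θ : V m), deriv (fun s : ℝ => der1 (fun y => H (κ, y)) (s • θ) θ)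
      = fun s => der2 (fun y => H (κ, y)) (s • θ) θ θ := fun κ θ => funext fun t => by
    have h4 : HasDerivAt (fun s : ℝ => der1 (fun y => H (κ, y)) (s • θ))
        (der2 (fun y => H (κ, y)) (t • θ) θ) t := hasDerivAt_ray (contDiff_der1 (hs κ)) θ t
    have h3 := h4.clm_apply (hasDerivAt_const t θ)
    simpa using h3.deriv
  have d3 : ∀ κ (θ : V m), deriv (fun s : ℝ => der2 (fun y => H (κ, y)) (s • θ) θ θ)
      = fun s => der3 (fun y => H (κ, y)) (s • θ) θ θ θ := fun κ θ => funext fun t => by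
    have h4 : HasDerivAt (fun s : ℝ => der2 (fun y => H (κ, y)) (s • θ))
        (der3 (fun y => H (κ, y)) (t • θ) θ) t := hasDerivAt_ray (contDiff_der2 (hs κ)) θ t
    have h3 := (h4.clm_apply (hasDerivAt_const t θ)).clm_apply (hasDerivAt_const t θ)
    simpa using h3.deriv
  refine ⟨fun κ => der2 (fun y => H (κ, y)) 0, R, fun z => F₁ z + (1 / 2 : ℝ) • F₂ z, T,
    h2.comp (contDiff_id.prodMk contDiff_const), hR, hF₁.add (hF₂.const_smul _), hT,
    fun κ => rfl, fun κ hκ θ t => ?_, fun κ hκ θ t => ?_, fun κ hκ θ t a b => ?_⟩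
  · have h0 := (h.isNormalMetric hκ).der1_zero
    have e := eR (κ, θ) t
    simp only [Finset.sum_range_succ, Finset.sum_range_zero, iteratedDeriv_zero, iteratedDeriv_one,
      d1, zero_smul, h0] at e
    simpa [h.zero κ hκ] using e
  · have h0 := (h.isNormalMetric hκ).der1_zero
    have e := eT (κ, θ) t
    simp only [Finset.sum_range_succ, Finset.sum_range_zero, iteratedDeriv_zero, iteratedDeriv_one,
      d2, zero_smul, h0] at e
    simpa using e
  · have h0 := (h.isNormalMetric hκ).der1_zero
    have e := eF₁ (κ, θ) t
    have e' := eF₂ (κ, θ) t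
    simp only [Finset.sum_range_succ, Finset.sum_range_zero, iteratedDeriv_succ,
      iteratedDeriv_zero, d1, d2', d3, zero_smul, h0, h.zero κ hκ] at e e'
    have c := congrArg (fun L : Bil m => L a b) e
    have c' := congrArg (fun L : Bil m => L a b) e'
    simp only [_root_.add_apply, _root_.smul_apply, smul_eq_mul, eucl_apply, _root_.zero_apply,
      smul_zero, Nat.factorial] at c c' ⊢
    push_cast at c c'
    exact radial_algebra c c'

end RadialExpansion

/-! ### Decomposition of the second fundamental form -/

section Decomposition

variable {n : ℕ} {P : Type} [NormedAddCommGroup P] [NormedSpace ℝ P]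

/-- The variables: parameters of the metric, `ρ`, a frame of the sphere and a one-jet. -/
abbrev Vars (P : Type) (n : ℕ) : Type := (P × ℝ) × (Frame n × Jet n)

/-- The distance `ρ (1 - w)` from the centre. -/
def rad (ξ : Vars P n) : ℝ := ξ.1.2 * (1 - ξ.2.2.1)

variable (H : P × V (n + 1) → Bil (n + 1))
  (A : P → V (n + 1) →L[ℝ] V (n + 1) →L[ℝ] Bil (n + 1)) (R F : (P × V (n + 1)) × ℝ → Bil (n + 1))
  (T : (P × V (n + 1)) × ℝ → V (n + 1) →L[ℝ] Bil (n + 1)) (i j : Fin n)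

/-- The metric at the point `ρ (1 - w) Θ`. -/
def met (ξ : Vars P n) : Bil (n + 1) := H (ξ.1.1, rad ξ • ξ.2.1.1)

/-- The coefficients of the normal vector. -/
def coef (k : Fin n) (ξ : Vars P n) : ℝ := alpha (met H ξ) ξ.2.1 ξ.2.2 k

/-- The length of the normal vector. -/
def len (ξ : Vars P n) : ℝ := normalLength (met H ξ) ξ.2.1 ξ.2.2

/-- The leading term of the lowered Christoffel symbol `Γ_{Θ_k, Θ_i Θ_j}`. -/
def chrFrame (k : Fin n) (ξ : Vars P n) : ℝ :=
  lowChr (A ξ.1.1 ξ.2.1.1) (ξ.2.1.2 k) (ξ.2.1.2 i) (ξ.2.1.2 j)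

/-- The leading term of the lowered Christoffel symbol `Γ_{Z_k, Z_i Z_j}`. -/
def chrZ (k : Fin n) (ξ : Vars P n) : ℝ :=
  lowChr (A ξ.1.1 ξ.2.1.1) (zvec ξ.2.1 ξ.2.2 k) (zvec ξ.2.1 ξ.2.2 i) (zvec ξ.2.1 ξ.2.2 j)

/-- The factor of `coef k` in the quadratic part. -/
def quadFactor (k : Fin n) (ξ : Vars P n) : ℝ :=
  (len H ξ)⁻¹ * met H ξ (zvec ξ.2.1 ξ.2.2 k)
      (ξ.2.2.2 i • ξ.2.1.2 j + ξ.2.2.2 j • ξ.2.1.2 i)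
    + ξ.1.2 ^ 2 * ((1 - ξ.2.2.1) ^ 2 * chrFrame A i j k ξ
      - (1 - ξ.2.2.1) * (len H ξ)⁻¹ * chrZ A i j k ξ
      + ξ.2.2.2 k * ∑ l, ξ.2.2.2 l * chrFrame A i j l ξ)

/-- The factor of `len - 1` in the quadratic part. -/
def lenFactor (ξ : Vars P n) : ℝ :=
  (1 - ξ.2.2.1) * (if i = j then 1 else 0) - (len H ξ)⁻¹ * (1 - ξ.2.2.1)
    * sphereDefect (fun y => H (ξ.1.1, y)) (rad ξ) ξ.2.1.1 (ξ.2.1.2 i) (ξ.2.1.2 j)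

/-- The part of the second fundamental form vanishing to second order at `(w, w_k) = 0`. -/
def quadPart (ξ : Vars P n) : ℝ :=
  (len H ξ - 1) * lenFactor H i j ξ + ∑ k, coef H k ξ * quadFactor H A i j k ξ

/-- The part of order `ρ ^ 5` of the second fundamental form, divided by `ρ ^ 5`. -/
def constPart (ξ : Vars P n) : ℝ :=
  (1 - ξ.2.2.1) ^ 5 * F ((ξ.1.1, ξ.2.1.1), rad ξ) (ξ.2.1.2 i) (ξ.2.1.2 j)

/-- The factor of `coef k` in the part vanishing at `(w, w_k) = 0`. -/
def linFactor (k : Fin n) (ξ : Vars P n) : ℝ :=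
  ξ.1.2 * (1 - ξ.2.2.1) ^ 4 * ∑ l, R ((ξ.1.1, ξ.2.1.1), rad ξ) (ξ.2.1.2 l) (ξ.2.1.2 k)
      * chrFrame A i j l ξ
    - (1 - ξ.2.2.1) ^ 2 * (len H ξ)⁻¹ * lowChr (T ((ξ.1.1, ξ.2.1.1), rad ξ))
      (zvec ξ.2.1 ξ.2.2 k) (zvec ξ.2.1 ξ.2.2 i) (zvec ξ.2.1 ξ.2.2 j)

/-- The part of order `ρ ^ 4` that vanishes at `(w, w_k) = 0`, divided by `ρ ^ 4`. -/
def linPart (ξ : Vars P n) : ℝ := ∑ k, coef H k ξ * linFactor H A R T i j k ξ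

variable {H A R F T i j} {K : Set P} {ε : ℝ}

lemma IsNormalFamily.met_fst (h : IsNormalFamily K ε H) {ξ : Vars P n} (hκ : ξ.1.1 ∈ K)
    (hb : rad ξ • ξ.2.1.1 ∈ ball (0 : V (n + 1)) ε) (v : V (n + 1)) :
    met H ξ ξ.2.1.1 v = inner ℝ ξ.2.1.1 v := by
  by_cases h0 : rad ξ = 0
  · rw [met, h0, zero_smul, h.zero _ hκ, eucl_apply]
  · exact (h.isNormalMetric hκ).gauss_smul h0 hb v

/-- The bookkeeping in the decomposition: `l` is the length of the normal vector, `l'` its inverse,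
`t = ρ (1 - w)`, and the sum `x₂ = ∑ w_k Γ_k` is rewritten by means of `w = gram α`. -/
lemma decomposition_algebra {l l' t w ρ δ D x₁ x₂ x₃ x₄ x₅ x₆ x₇ x₈ x₉ x₁₀ : ℝ}
    (ht : t = ρ * (1 - w)) (hl : l' * l = 1)
    (hw : x₂ = (1 - w) ^ 2 * x₁ + (1 - w) ^ 2 * t ^ 2 * x₅ + x₃ * x₂) :
    l * D + l * (1 - w) * δ + l' * x₇
        + l' * (1 - w) * (t ^ 2 * x₉ + 5 / 12 * t ^ 3 * x₁₀ + t ^ 4 * x₈)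
        - ρ * l' * (t * x₄ + t ^ 2 * x₆)
      = (1 - w) * δ + D + ρ ^ 2 * (1 - w) ^ 3 * x₉ + 5 / 12 * ρ ^ 3 * (1 - w) ^ 4 * x₁₀
        - ρ ^ 2 * x₂ + (l - 1) * D
        + ((l - 1) * ((1 - w) * δ
            - l' * (1 - w) * (t ^ 2 * x₉ + 5 / 12 * t ^ 3 * x₁₀ + t ^ 4 * x₈))
          + (l' * x₇ + ρ ^ 2 * ((1 - w) ^ 2 * x₁ - (1 - w) * l' * x₄ + x₃ * x₂)))
        + ρ ^ 4 * ((1 - w) ^ 5 * x₈)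
        + ρ ^ 3 * (ρ * (1 - w) ^ 4 * x₅ - (1 - w) ^ 2 * l' * x₆) := by
  subst ht
  linear_combination (1 - w) * (ρ ^ 2 * (1 - w) ^ 2 * x₉ + 5 / 12 * ρ ^ 3 * (1 - w) ^ 3 * x₁₀
    + ρ ^ 4 * (1 - w) ^ 4 * x₈) * hl + ρ ^ 2 * hw

/-- The second fundamental form is the sum of the leading terms, of the parts of order `ρ ^ 5`, of
order `ρ ^ 4` and vanishing at `0`, and quadratic, and of the product of the Hessian with
`len - 1`. -/
lemma IsRadialExpansion.decomposition (h : IsNormalFamily K ε H)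
    (hR : IsRadialExpansion K H A R F T) {ξ : Vars P n} (hκ : ξ.1.1 ∈ K) (hx : IsFrame ξ.2.1)
    (hb : rad ξ • ξ.2.1.1 ∈ ball (0 : V (n + 1)) ε) (hu : IsUnit (gram (met H ξ) ξ.2.1 ξ.2.2).det)
    (hl : len H ξ ≠ 0) (D : ℝ) :
    len H ξ * D + len H ξ * (1 - ξ.2.2.1) * (if i = j then 1 else 0)
        + (len H ξ)⁻¹ * ∑ k, coef H k ξ
            * met H ξ (zvec ξ.2.1 ξ.2.2 k) (ξ.2.2.2 i • ξ.2.1.2 j + ξ.2.2.2 j • ξ.2.1.2 i)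
        + (len H ξ)⁻¹ * (1 - ξ.2.2.1)
          * sphereDefect (fun y => H (ξ.1.1, y)) (rad ξ) ξ.2.1.1 (ξ.2.1.2 i) (ξ.2.1.2 j)
        - ξ.1.2 * (len H ξ)⁻¹ * ∑ k, coef H k ξ
            * lowChr (der1 (fun y => H (ξ.1.1, y)) (rad ξ • ξ.2.1.1)) (zvec ξ.2.1 ξ.2.2 k)
              (zvec ξ.2.1 ξ.2.2 i) (zvec ξ.2.1 ξ.2.2 j)
      = (1 - ξ.2.2.1) * (if i = j then 1 else 0) + D
        + ξ.1.2 ^ 2 * (1 - ξ.2.2.1) ^ 3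
          * A ξ.1.1 ξ.2.1.1 ξ.2.1.1 (ξ.2.1.2 i) (ξ.2.1.2 j)
        + 5 / 12 * ξ.1.2 ^ 3 * (1 - ξ.2.2.1) ^ 4 * der3 (fun y => H (ξ.1.1, y)) 0 ξ.2.1.1 ξ.2.1.1
          ξ.2.1.1 (ξ.2.1.2 i) (ξ.2.1.2 j)
        - ξ.1.2 ^ 2 * ∑ k, ξ.2.2.2 k * chrFrame A i j k ξ
        + (len H ξ - 1) * D + quadPart H A i j ξ + ξ.1.2 ^ 4 * constPart F i j ξ
        + ξ.1.2 ^ 3 * linPart H A R T i j ξ := by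
  have hdef : sphereDefect (fun y => H (ξ.1.1, y)) (rad ξ) ξ.2.1.1 (ξ.2.1.2 i) (ξ.2.1.2 j)
      = _ := hR.radial _ hκ ξ.2.1.1 (rad ξ) (ξ.2.1.2 i) (ξ.2.1.2 j)
  have hlow : ∑ k, coef H k ξ
      * lowChr (der1 (fun y => H (ξ.1.1, y)) (rad ξ • ξ.2.1.1)) (zvec ξ.2.1 ξ.2.2 k)
        (zvec ξ.2.1 ξ.2.2 i) (zvec ξ.2.1 ξ.2.2 j)
      = rad ξ * ∑ k, coef H k ξ * chrZ A i j k ξ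
        + rad ξ ^ 2 * ∑ k, coef H k ξ * lowChr (T ((ξ.1.1, ξ.2.1.1), rad ξ))
          (zvec ξ.2.1 ξ.2.2 k) (zvec ξ.2.1 ξ.2.2 i) (zvec ξ.2.1 ξ.2.2 j) := by
    rw [hR.deriv _ hκ, Finset.mul_sum, Finset.mul_sum, ← Finset.sum_add_distrib]
    refine Finset.sum_congr rfl fun k _ => ?_
    simp only [chrZ, lowChr, _root_.add_apply, _root_.smul_apply, smul_eq_mul]
    ring
  -- the first derivatives of `w` in terms of the coefficients of the normal vector
  have hgram : ∀ k l, gram (met H ξ) ξ.2.1 ξ.2.2 k l = (1 - ξ.2.2.1) ^ 2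
      * ((if k = l then 1 else 0)
        + rad ξ ^ 2 * R ((ξ.1.1, ξ.2.1.1), rad ξ) (ξ.2.1.2 k) (ξ.2.1.2 l))
      + ξ.2.2.2 k * ξ.2.2.2 l := fun k l => by
    have hθ := h.met_fst hκ hb
    have hsymm : ∀ a b, met H ξ a b = met H ξ b a := h.symm _
    have h1 : met H ξ (ξ.2.1.2 k) (ξ.2.1.2 l) = (if k = l then 1 else 0)
        + rad ξ ^ 2 * R ((ξ.1.1, ξ.2.1.1), rad ξ) (ξ.2.1.2 k) (ξ.2.1.2 l) := by
      rw [met, hR.metric _ hκ, _root_.add_apply, _root_.add_apply, eucl_apply, hx.2.2]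
      simp
    rw [← h1, gram, Matrix.of_apply, zvec, zvec]
    simp only [map_sub, map_smul, _root_.sub_apply, _root_.smul_apply, smul_eq_mul, hθ,
      hsymm _ ξ.2.1.1, hx.2.1, real_inner_self_eq_norm_sq, hx.1]
    ring
  -- hence the leading term linear in the gradient, up to terms of higher order in `ρ` or in the jet
  have hw : ∑ k, ξ.2.2.2 k * chrFrame A i j k ξ
      = (1 - ξ.2.2.1) ^ 2 * ∑ k, coef H k ξ * chrFrame A i j k ξ
        + (1 - ξ.2.2.1) ^ 2 * rad ξ ^ 2 * ∑ k, coef H k ξ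
          * ∑ l, R ((ξ.1.1, ξ.2.1.1), rad ξ) (ξ.2.1.2 l) (ξ.2.1.2 k) * chrFrame A i j l ξ
        + (∑ k, coef H k ξ * ξ.2.2.2 k) * ∑ l, ξ.2.2.2 l * chrFrame A i j l ξ := by
    calc ∑ k, ξ.2.2.2 k * chrFrame A i j k ξ
        = ∑ l, (∑ k, gram (met H ξ) ξ.2.1 ξ.2.2 l k * coef H k ξ) * chrFrame A i j l ξ := by
          refine Finset.sum_congr rfl fun l _ => ?_
          rw [← sum_gram_mul_alpha hu l]
          rfl
      _ = ∑ k, ∑ l, gram (met H ξ) ξ.2.1 ξ.2.2 l k * coef H k ξ * chrFrame A i j l ξ := by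
          simp only [Finset.sum_mul]
          exact Finset.sum_comm
      _ = _ := by
          rw [Finset.sum_mul_sum]
          simp only [Finset.mul_sum, hgram]
          rw [← Finset.sum_add_distrib, ← Finset.sum_add_distrib]
          refine Finset.sum_congr rfl fun k _ => ?_
          have h2 : (1 - ξ.2.2.1) ^ 2 * (coef H k ξ * chrFrame A i j k ξ)
              = ∑ l, (1 - ξ.2.2.1) ^ 2 * (if l = k then 1 else 0) * coef H k ξ
                * chrFrame A i j l ξ := by
            simp [mul_assoc]
          rw [h2, ← Finset.sum_add_distrib, ← Finset.sum_add_distrib]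
          refine Finset.sum_congr rfl fun l _ => ?_
          ring
  -- the parts of the decomposition, written as sums
  have hq : ∑ k, coef H k ξ * quadFactor H A i j k ξ
      = (len H ξ)⁻¹ * ∑ k, coef H k ξ
          * met H ξ (zvec ξ.2.1 ξ.2.2 k) (ξ.2.2.2 i • ξ.2.1.2 j + ξ.2.2.2 j • ξ.2.1.2 i)
        + ξ.1.2 ^ 2 * ((1 - ξ.2.2.1) ^ 2 * ∑ k, coef H k ξ * chrFrame A i j k ξ
          - (1 - ξ.2.2.1) * (len H ξ)⁻¹ * ∑ k, coef H k ξ * chrZ A i j k ξ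
          + (∑ k, coef H k ξ * ξ.2.2.2 k) * ∑ l, ξ.2.2.2 l * chrFrame A i j l ξ) := by
    simp only [quadFactor]
    generalize ∑ l, ξ.2.2.2 l * chrFrame A i j l ξ = X
    simp only [Finset.mul_sum, Finset.sum_mul]
    rw [← Finset.sum_sub_distrib, ← Finset.sum_add_distrib, Finset.mul_sum,
      ← Finset.sum_add_distrib]
    exact Finset.sum_congr rfl fun k _ => by ring
  have hlin : linPart H A R T i j ξ
      = ξ.1.2 * (1 - ξ.2.2.1) ^ 4 * ∑ k, coef H k ξ
          * ∑ l, R ((ξ.1.1, ξ.2.1.1), rad ξ) (ξ.2.1.2 l) (ξ.2.1.2 k) * chrFrame A i j l ξ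
        - (1 - ξ.2.2.1) ^ 2 * (len H ξ)⁻¹ * ∑ k, coef H k ξ
          * lowChr (T ((ξ.1.1, ξ.2.1.1), rad ξ))
            (zvec ξ.2.1 ξ.2.2 k) (zvec ξ.2.1 ξ.2.2 i) (zvec ξ.2.1 ξ.2.2 j) := by
    rw [linPart, Finset.mul_sum, Finset.mul_sum, ← Finset.sum_sub_distrib]
    refine Finset.sum_congr rfl fun k _ => ?_
    rw [linFactor]
    ring
  rw [hlow, quadPart, hq, hlin, lenFactor, constPart, hdef]
  have hr : rad ξ = ξ.1.2 * (1 - ξ.2.2.1) := rfl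
  have hl' : (len H ξ)⁻¹ * len H ξ = 1 := inv_mul_cancel₀ hl
  exact decomposition_algebra hr hl' hw

end Decomposition

/-! ### Smoothness of the parts of the second fundamental form -/

section Smoothness

open Filter Topology

variable {n : ℕ} {P : Type} [NormedAddCommGroup P] [NormedSpace ℝ P]

lemma contDiffAt_lowChr {E : Type*} [NormedAddCommGroup E] [NormedSpace ℝ E] {m : ℕ}
    {K : E → V m →L[ℝ] Bil m} {c a b : E → V m} {x : E} (hK : ContDiffAt ℝ ∞ K x)
    (hc : ContDiffAt ℝ ∞ c x) (ha : ContDiffAt ℝ ∞ a x) (hb : ContDiffAt ℝ ∞ b x) :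
    ContDiffAt ℝ ∞ (fun y => lowChr (K y) (c y) (a y) (b y)) x := by
  unfold lowChr
  exact contDiffAt_const.mul (((((hK.clm_apply ha).clm_apply hb).clm_apply hc).add
    (((hK.clm_apply hb).clm_apply ha).clm_apply hc)).sub
    (((hK.clm_apply hc).clm_apply ha).clm_apply hb))

lemma contDiff_scale : ContDiff ℝ ∞ fun ξ : Vars P n => ξ.1.2 := contDiff_snd.comp contDiff_fst

lemma contDiff_center : ContDiff ℝ ∞ fun ξ : Vars P n => ξ.1.1 := contDiff_fst.comp contDiff_fst

lemma contDiff_jet : ContDiff ℝ ∞ fun ξ : Vars P n => ξ.2.2 := contDiff_snd.comp contDiff_snd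

lemma contDiff_jet_fst : ContDiff ℝ ∞ fun ξ : Vars P n => ξ.2.2.1 := contDiff_fst.comp contDiff_jet

lemma contDiff_jet_snd (k : Fin n) : ContDiff ℝ ∞ fun ξ : Vars P n => ξ.2.2.2 k :=
  (contDiff_euclidean.1 (contDiff_snd.comp contDiff_jet)) k

lemma contDiff_theta : ContDiff ℝ ∞ fun ξ : Vars P n => ξ.2.1.1 :=
  contDiff_fst.comp (contDiff_fst.comp contDiff_snd)

lemma contDiff_frame (k : Fin n) : ContDiff ℝ ∞ fun ξ : Vars P n => ξ.2.1.2 k :=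
  (contDiff_apply ℝ (V (n + 1)) k).comp (contDiff_snd.comp (contDiff_fst.comp contDiff_snd))

lemma contDiff_rad : ContDiff ℝ ∞ (rad : Vars P n → ℝ) :=
  contDiff_scale.mul (contDiff_const.sub contDiff_jet_fst)

lemma contDiff_zvec (k : Fin n) : ContDiff ℝ ∞ fun ξ : Vars P n => zvec ξ.2.1 ξ.2.2 k :=
  ((contDiff_const.sub contDiff_jet_fst).smul (contDiff_frame k)).sub
    ((contDiff_jet_snd k).smul contDiff_theta)

lemma contDiff_ray : ContDiff ℝ ∞ fun ξ : Vars P n => ((ξ.1.1, ξ.2.1.1), rad ξ) :=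
  (contDiff_center.prodMk contDiff_theta).prodMk contDiff_rad

variable {H : P × V (n + 1) → Bil (n + 1)}
  {A : P → V (n + 1) →L[ℝ] V (n + 1) →L[ℝ] Bil (n + 1)} {R F : (P × V (n + 1)) × ℝ → Bil (n + 1)}
  {T : (P × V (n + 1)) × ℝ → V (n + 1) →L[ℝ] Bil (n + 1)} {i j : Fin n} {K : Set P} {ε : ℝ}

lemma contDiff_met (hH : ContDiff ℝ ∞ H) : ContDiff ℝ ∞ (met H : Vars P n → Bil (n + 1)) :=
  hH.comp (contDiff_center.prodMk (contDiff_rad.smul contDiff_theta))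

lemma contDiffAt_coef (hH : ContDiff ℝ ∞ H) {ξ : Vars P n}
    (hu : IsUnit (gram (met H ξ) ξ.2.1 ξ.2.2).det) (k : Fin n) : ContDiffAt ℝ ∞ (coef H k) ξ := by
  unfold coef alpha
  refine ContDiffAt.sum fun l _ => ContDiffAt.mul ?_ (contDiff_jet_snd l).contDiffAt
  exact contDiffAt_matrix_inv (A := fun ξ : Vars P n => gram (met H ξ) ξ.2.1 ξ.2.2)
    (fun a b => (((contDiff_met hH).clm_apply (contDiff_zvec a)).clm_apply
      (contDiff_zvec b)).contDiffAt) hu k l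

/-- The points at which the normal vector is well defined. -/
structure IsRegular (H : P × V (n + 1) → Bil (n + 1)) (ξ : Vars P n) : Prop where
  isUnit : IsUnit (gram (met H ξ) ξ.2.1 ξ.2.2).det
  pos : 0 < 1 - ∑ k, coef H k ξ * ξ.2.2.2 k

lemma IsRegular.len_pos {ξ : Vars P n} (h : IsRegular H ξ) : 0 < len H ξ := Real.sqrt_pos.2 h.pos

lemma IsRegular.contDiffAt_len (hH : ContDiff ℝ ∞ H) {ξ : Vars P n} (h : IsRegular H ξ) :
    ContDiffAt ℝ ∞ (len H) ξ :=
  (contDiffAt_const.sub (ContDiffAt.sum fun k _ =>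
    (contDiffAt_coef hH h.isUnit k).mul (contDiff_jet_snd k).contDiffAt)).sqrt h.pos.ne'

lemma IsRegular.contDiffAt_len_inv (hH : ContDiff ℝ ∞ H) {ξ : Vars P n} (h : IsRegular H ξ) :
    ContDiffAt ℝ ∞ (fun ξ => (len H ξ)⁻¹) ξ :=
  (h.contDiffAt_len hH).inv h.len_pos.ne'

lemma contDiff_chrFrame (hA : ContDiff ℝ ∞ A) (k : Fin n) :
    ContDiff ℝ ∞ (chrFrame A i j k : Vars P n → ℝ) :=
  contDiff_iff_contDiffAt.2 fun _ => contDiffAt_lowChr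
    ((hA.comp contDiff_center).clm_apply contDiff_theta).contDiffAt
    (contDiff_frame k).contDiffAt (contDiff_frame i).contDiffAt (contDiff_frame j).contDiffAt

lemma contDiff_chrZ (hA : ContDiff ℝ ∞ A) (k : Fin n) :
    ContDiff ℝ ∞ (chrZ A i j k : Vars P n → ℝ) :=
  contDiff_iff_contDiffAt.2 fun _ => contDiffAt_lowChr
    ((hA.comp contDiff_center).clm_apply contDiff_theta).contDiffAt
    (contDiff_zvec k).contDiffAt (contDiff_zvec i).contDiffAt (contDiff_zvec j).contDiffAt

lemma IsRegular.contDiffAt_quadFactor (hH : ContDiff ℝ ∞ H) (hA : ContDiff ℝ ∞ A) {ξ : Vars P n}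
    (h : IsRegular H ξ) (k : Fin n) : ContDiffAt ℝ ∞ (quadFactor H A i j k) ξ := by
  have h1 : ContDiff ℝ ∞ fun ξ : Vars P n => met H ξ (zvec ξ.2.1 ξ.2.2 k)
      (ξ.2.2.2 i • ξ.2.1.2 j + ξ.2.2.2 j • ξ.2.1.2 i) :=
    ((contDiff_met hH).clm_apply (contDiff_zvec k)).clm_apply
      (((contDiff_jet_snd i).smul (contDiff_frame j)).add
        ((contDiff_jet_snd j).smul (contDiff_frame i)))
  have h2 : ContDiff ℝ ∞ fun ξ : Vars P n => 1 - ξ.2.2.1 := contDiff_const.sub contDiff_jet_fst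
  have h3 : ContDiff ℝ ∞ fun ξ : Vars P n => ∑ l, ξ.2.2.2 l * chrFrame A i j l ξ :=
    ContDiff.sum fun l _ => (contDiff_jet_snd l).mul (contDiff_chrFrame hA l)
  have h4 := h.contDiffAt_len_inv hH
  exact (h4.mul h1.contDiffAt).add ((contDiff_scale.pow 2).contDiffAt.mul
    (((((h2.pow 2).mul (contDiff_chrFrame hA k)).contDiffAt).sub
      ((h2.contDiffAt.mul h4).mul (contDiff_chrZ hA k).contDiffAt)).add
      ((contDiff_jet_snd k).mul h3).contDiffAt))

lemma IsRegular.contDiffAt_lenFactor (hH : ContDiff ℝ ∞ H) {ξ : Vars P n} (h : IsRegular H ξ) :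
    ContDiffAt ℝ ∞ (lenFactor H i j) ξ := by
  have h2 : ContDiff ℝ ∞ fun ξ : Vars P n => 1 - ξ.2.2.1 := contDiff_const.sub contDiff_jet_fst
  have h3 : ContDiff ℝ ∞ fun ξ : Vars P n =>
      der1 (fun y => H (ξ.1.1, y)) (rad ξ • ξ.2.1.1) :=
    (contDiff_fderiv_snd hH).comp (contDiff_center.prodMk (contDiff_rad.smul contDiff_theta))
  have h4 : ContDiff ℝ ∞ fun ξ : Vars P n =>
      sphereDefect (fun y => H (ξ.1.1, y)) (rad ξ) ξ.2.1.1 (ξ.2.1.2 i) (ξ.2.1.2 j) :=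
    ((((contDiff_met hH).clm_apply (contDiff_frame i)).clm_apply (contDiff_frame j)).sub
      ((contDiff_frame i).inner ℝ (contDiff_frame j))).add ((contDiff_rad.div_const 2).mul
      (((h3.clm_apply contDiff_theta).clm_apply (contDiff_frame i)).clm_apply (contDiff_frame j)))
  exact (h2.mul contDiff_const).contDiffAt.sub
    (((h.contDiffAt_len_inv hH).mul h2.contDiffAt).mul h4.contDiffAt)

lemma IsRegular.contDiffAt_quadPart (hH : ContDiff ℝ ∞ H) (hA : ContDiff ℝ ∞ A) {ξ : Vars P n}
    (h : IsRegular H ξ) : ContDiffAt ℝ ∞ (quadPart H A i j) ξ :=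
  (((h.contDiffAt_len hH).sub contDiffAt_const).mul (h.contDiffAt_lenFactor hH)).add
    (ContDiffAt.sum fun k _ => (contDiffAt_coef hH h.isUnit k).mul (h.contDiffAt_quadFactor hH hA k))

lemma contDiff_constPart (hF : ContDiff ℝ ∞ F) :
    ContDiff ℝ ∞ (constPart F i j : Vars P n → ℝ) :=
  ((contDiff_const.sub contDiff_jet_fst).pow 5).mul
    (((hF.comp contDiff_ray).clm_apply (contDiff_frame i)).clm_apply (contDiff_frame j))

lemma IsRegular.contDiffAt_linPart (hH : ContDiff ℝ ∞ H) (hA : ContDiff ℝ ∞ A)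
    (hR : ContDiff ℝ ∞ R) (hT : ContDiff ℝ ∞ T) {ξ : Vars P n} (h : IsRegular H ξ) :
    ContDiffAt ℝ ∞ (linPart H A R T i j) ξ := by
  have h2 : ContDiff ℝ ∞ fun ξ : Vars P n => 1 - ξ.2.2.1 := contDiff_const.sub contDiff_jet_fst
  refine ContDiffAt.sum fun k _ => (contDiffAt_coef hH h.isUnit k).mul (ContDiffAt.sub ?_ ?_)
  · exact ((contDiff_scale.mul (h2.pow 4)).mul (ContDiff.sum fun l _ =>
      (((hR.comp contDiff_ray).clm_apply (contDiff_frame l)).clm_apply (contDiff_frame k)).mul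
        (contDiff_chrFrame hA l))).contDiffAt
  · exact ((h2.pow 2).contDiffAt.mul (h.contDiffAt_len_inv hH)).mul
      (contDiffAt_lowChr (hT.comp contDiff_ray).contDiffAt (contDiff_zvec k).contDiffAt
        (contDiff_zvec i).contDiffAt (contDiff_zvec j).contDiffAt)

end Smoothness

/-! ### Order of vanishing at `w = 0` -/

section Vanishing

open Filter Topology

variable {n : ℕ} {P : Type} [NormedAddCommGroup P] [NormedSpace ℝ P]
  {H : P × V (n + 1) → Bil (n + 1)}
  {A : P → V (n + 1) →L[ℝ] V (n + 1) →L[ℝ] Bil (n + 1)} {R F : (P × V (n + 1)) × ℝ → Bil (n + 1)}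
  {T : (P × V (n + 1)) × ℝ → V (n + 1) →L[ℝ] Bil (n + 1)} {i j : Fin n} {K : Set P} {ε : ℝ}
  {q : P × ℝ} {x : Frame n}

lemma coef_zero (k : Fin n) : coef H k (q, (x, 0)) = 0 := by
  simp [coef, alpha]

lemma len_zero : len H (q, (x, 0)) = 1 := by
  simp [len, normalLength]

lemma zvec_zero (k : Fin n) : zvec x 0 k = x.2 k := by
  simp [zvec]

lemma quadFactor_zero (k : Fin n) : quadFactor H A i j k (q, (x, 0)) = 0 := by
  simp [quadFactor, len_zero, chrFrame, chrZ, zvec_zero]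

lemma contDiffAt_slice {f : Vars P n → ℝ} {J : Jet n} (hf : ContDiffAt ℝ ∞ f (q, (x, J))) :
    ContDiffAt ℝ ∞ (fun J => f (q, (x, J))) J :=
  ContDiffAt.comp (g := f) (f := fun J : Jet n => (q, (x, J))) J hf
    (contDiffAt_const.prodMk (contDiffAt_const.prodMk contDiffAt_id))

lemma IsRegular.hasFDerivAt_len (hH : ContDiff ℝ ∞ H) (h : IsRegular H (q, (x, 0))) :
    HasFDerivAt (fun J : Jet n => len H (q, (x, J))) (0 : Jet n →L[ℝ] ℝ) 0 := by
  have h1 : ∀ k, HasFDerivAt (fun J : Jet n => coef H k (q, (x, J)) * J.2 k)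
      (0 : Jet n →L[ℝ] ℝ) 0 := fun k =>
    hasFDerivAt_mul_zero
      ((contDiffAt_slice (contDiffAt_coef hH h.isUnit k)).differentiableAt (by simp))
      ((contDiffAt_slice (contDiff_jet_snd (P := P) k).contDiffAt (q := q)
        (x := x)).differentiableAt (by simp)) (coef_zero k) rfl
  have h2 := (HasFDerivAt.fun_sum (u := Finset.univ) fun k _ => h1 k).const_sub 1
  have h3 : HasFDerivAt (fun J : Jet n => len H (q, (x, J))) _ 0 := h2.sqrt h.pos.ne'
  exact h3.congr_fderiv (by simp)

lemma IsRegular.hasFDerivAt_quadPart (hH : ContDiff ℝ ∞ H) (hA : ContDiff ℝ ∞ A)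
    (h : IsRegular H (q, (x, 0))) :
    HasFDerivAt (fun J : Jet n => quadPart H A i j (q, (x, J))) (0 : Jet n →L[ℝ] ℝ) 0 := by
  have h1 : ∀ k, HasFDerivAt
      (fun J : Jet n => coef H k (q, (x, J)) * quadFactor H A i j k (q, (x, J)))
      (0 : Jet n →L[ℝ] ℝ) 0 := fun k =>
    hasFDerivAt_mul_zero
      ((contDiffAt_slice (contDiffAt_coef hH h.isUnit k)).differentiableAt (by simp))
      ((contDiffAt_slice (h.contDiffAt_quadFactor hH hA k)).differentiableAt (by simp))
      (coef_zero k) (quadFactor_zero k)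
  have h2 := ((h.hasFDerivAt_len hH).sub_const 1).fun_mul
    ((contDiffAt_slice (h.contDiffAt_lenFactor (i := i) (j := j) hH)).differentiableAt
      (by simp)).hasFDerivAt
  have h3 : HasFDerivAt (fun J : Jet n => quadPart H A i j (q, (x, J))) _ 0 :=
    h2.fun_add (HasFDerivAt.fun_sum (u := Finset.univ) fun k _ => h1 k)
  exact h3.congr_fderiv (by simp [len_zero])

lemma quadPart_zero : quadPart H A i j (q, (x, 0)) = 0 := by
  simp [quadPart, len_zero, coef_zero]

lemma linPart_zero : linPart H A R T i j (q, (x, 0)) = 0 := by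
  simp [linPart, coef_zero]

end Vanishing

/-! ### Uniform bounds -/

section Bounds

open Filter Topology

variable {Ξ X : Type*} [NormedAddCommGroup Ξ] [NormedSpace ℝ Ξ] [NormedAddCommGroup X]
  [NormedSpace ℝ X]

/-- Partial derivatives of a jointly smooth function are jointly smooth. -/
lemma contDiffAt_fderiv_slice {W : Type*} [NormedAddCommGroup W] [NormedSpace ℝ W]
    {f : Ξ × X → W} {z : Ξ × X} (hf : ContDiffAt ℝ ∞ f z) :
    ContDiffAt ℝ ∞ (fun z : Ξ × X => fderiv ℝ (fun u => f (z.1, u)) z.2) z := by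
  refine ContDiffAt.fderiv (f := fun (z : Ξ × X) u => f (z.1, u)) (g := fun z => z.2) (n := ∞)
    ?_ contDiffAt_snd (by simp)
  exact ContDiffAt.comp (g := f) (f := fun p : (Ξ × X) × X => (p.1.1, p.2)) (z, z.2) hf
    ((contDiff_fst.comp contDiff_fst).prodMk contDiff_snd).contDiffAt

set_option synthInstance.maxHeartbeats 400000 in
lemma contDiffAt_iteratedFDeriv_slice {W : Type*} [NormedAddCommGroup W] [NormedSpace ℝ W]
    {f : Ξ × X → W} {z : Ξ × X} (hf : ContDiffAt ℝ ∞ f z) (k : ℕ) :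
    ContDiffAt ℝ ∞ (fun z : Ξ × X => iteratedFDeriv ℝ k (fun u => f (z.1, u)) z.2) z := by
  induction k with
  | zero =>
    simp only [iteratedFDeriv_zero_eq_comp, Function.comp_apply]
    exact (LinearIsometryEquiv.contDiff _).contDiffAt.comp z hf
  | succ k ih =>
    simp only [iteratedFDeriv_succ_eq_comp_left, Function.comp_apply]
    exact (continuousMultilinearCurryLeftEquiv ℝ (fun _ : Fin (k + 1) => X) W).symm.contDiff
      |>.contDiffAt.comp z (contDiffAt_fderiv_slice ih)

/-- On a compact set, the derivatives of a jointly smooth function with respect to some of its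
variables are bounded. -/
lemma exists_bound_iteratedFDeriv {ι : Type*} [Fintype ι] {f : ι → Ξ × X → ℝ} {𝒦 : Set (Ξ × X)}
    (hK : IsCompact 𝒦) (hf : ∀ a, ∀ z ∈ 𝒦, ContDiffAt ℝ ∞ (f a) z) :
    ∃ C : ℕ → ℝ, (∀ k, 0 ≤ C k) ∧ ∀ a, ∀ z ∈ 𝒦, ∀ k,
      ‖iteratedFDeriv ℝ k (fun u => f a (z.1, u)) z.2‖ ≤ C k := by
  have h1 : ∀ a k, ∃ C : ℝ, ∀ z ∈ 𝒦, ‖iteratedFDeriv ℝ k (fun u => f a (z.1, u)) z.2‖ ≤ C :=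
    fun a k => hK.exists_bound_of_continuousOn fun z hz =>
      (contDiffAt_iteratedFDeriv_slice (hf a z hz) k).continuousAt.continuousWithinAt
  choose C hC using h1
  refine ⟨fun k => ∑ a, |C a k|, fun k => Finset.sum_nonneg fun a _ => abs_nonneg _,
    fun a z hz k => ((hC a k z hz).trans (le_abs_self _)).trans ?_⟩
  exact Finset.single_le_sum (f := fun a => |C a k|) (fun a _ => abs_nonneg _) (Finset.mem_univ a)

lemma isCompact_isFrame (n : ℕ) : IsCompact {x : Frame n | IsFrame x} := by
  have hi : ∀ i : Fin n, Continuous fun x : Frame n => x.2 i := fun i =>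
    (continuous_apply i).comp continuous_snd
  refine Metric.isCompact_of_isClosed_isBounded ?_ ?_
  · have he : {x : Frame n | IsFrame x} = {x | ‖x.1‖ = 1} ∩ ((⋂ i, {x | inner ℝ x.1 (x.2 i) = (0 : ℝ)})
        ∩ ⋂ i, ⋂ j, {x | inner ℝ (x.2 i) (x.2 j) = if i = j then (1 : ℝ) else 0}) := by
      ext x
      simp [IsFrame]
    rw [he]
    refine (isClosed_eq continuous_fst.norm continuous_const).inter
      ((isClosed_iInter fun i => isClosed_eq (continuous_fst.inner (hi i)) continuous_const).inter
      (isClosed_iInter fun i => isClosed_iInter fun j =>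
        isClosed_eq ((hi i).inner (hi j)) continuous_const))
  · refine (isBounded_closedBall (x := (0 : Frame n)) (r := 1)).subset fun x hx => ?_
    rw [mem_closedBall_zero_iff, Prod.norm_def, max_le_iff, pi_norm_le_iff_of_nonneg zero_le_one]
    refine ⟨hx.1.le, fun i => ?_⟩
    have h1 := hx.2.2 i i
    rw [if_pos rfl, real_inner_self_eq_norm_sq] at h1
    nlinarith [norm_nonneg (x.2 i)]

lemma isCompact_jet (n : ℕ) (δ Λ : ℝ) : IsCompact {J : Jet n | |J.1| ≤ δ ∧ ‖J.2‖ ≤ Λ} := by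
  have he : {J : Jet n | |J.1| ≤ δ ∧ ‖J.2‖ ≤ Λ} = closedBall (0 : ℝ) δ ×ˢ closedBall (0 : V n) Λ := by
    ext J
    simp [Real.norm_eq_abs]
  rw [he]
  exact (isCompact_closedBall _ _).prod (isCompact_closedBall _ _)

end Bounds

section Core

open Filter Topology

variable {n : ℕ} {P : Type} [NormedAddCommGroup P] [NormedSpace ℝ P]
  {H : P × V (n + 1) → Bil (n + 1)} {K : Set P} {ε : ℝ}

/-- A form close to the Euclidean one is positive. -/
lemma pos_of_norm_sub_eucl_lt {m : ℕ} {B : Bil m} (hB : ‖B - eucl m‖ < 1) {v : V m} (hv : v ≠ 0) :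
    0 < B v v := by
  have h1 : ‖(B - eucl m) v v‖ ≤ ‖B - eucl m‖ * ‖v‖ * ‖v‖ :=
    (B - eucl m).le_opNorm₂ v v
  rw [_root_.sub_apply, _root_.sub_apply, eucl_apply, real_inner_self_eq_norm_sq,
    Real.norm_eq_abs] at h1
  have h2 : 0 < ‖v‖ ^ 2 := by positivity
  have h3 := (abs_le.1 h1).1
  nlinarith

/-- The metrics of a normal family are positive near the centre. -/
lemma IsNormalFamily.exists_pos (h : IsNormalFamily K ε H) :
    ∃ η : ℝ, 0 < η ∧ η ≤ ε ∧ ∀ κ ∈ K, ∀ y ∈ ball (0 : V (n + 1)) η, ∀ v, v ≠ 0 →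
      0 < H (κ, y) v v := by
  obtain ⟨η, hη, hb⟩ := exists_ball_of_isCompact h.isCompact
    (S := {z : P × V (n + 1) | ‖H z - eucl (n + 1)‖ < 1})
    (isOpen_lt (h.smooth.continuous.sub continuous_const).norm continuous_const)
    (fun κ hκ => by
      change ‖H (κ, 0) - eucl (n + 1)‖ < 1
      rw [h.zero κ hκ, sub_self, norm_zero]
      exact one_pos)
  exact ⟨min η ε, lt_min hη h.pos, min_le_right _ _, fun κ hκ y hy v hv =>
    pos_of_norm_sub_eucl_lt (hb κ hκ y (ball_subset_ball (min_le_left _ _) hy)) hv⟩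

lemma IsNormalFamily.isRegular (h : IsNormalFamily K ε H) {ξ : Vars P n} (hκ : ξ.1.1 ∈ K)
    (hx : IsFrame ξ.2.1) (hJ : ξ.2.2.1 ≠ 1) (hb : rad ξ • ξ.2.1.1 ∈ ball (0 : V (n + 1)) ε)
    (hpos : ∀ v, v ≠ 0 → 0 < met H ξ v v) : IsRegular H ξ :=
  ⟨isUnit_det_gram hpos hx hJ, normalLength_pos hpos (h.symm _) (h.met_fst hκ hb) hx hJ⟩

lemma rad_smul_mem_ball {ξ : Vars P n} {η δ : ℝ} (hδ : δ < 1) (h0 : 0 ≤ ξ.1.2)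
    (h1 : ξ.1.2 ≤ η / 4) (hη : 0 < η) (hx : IsFrame ξ.2.1) (hJ : |ξ.2.2.1| ≤ δ) :
    rad ξ • ξ.2.1.1 ∈ ball (0 : V (n + 1)) η := by
  rw [mem_ball_zero_iff, norm_smul, hx.1, mul_one, rad, norm_mul, Real.norm_of_nonneg h0,
    Real.norm_eq_abs]
  have h2 := abs_le.1 hJ
  have h3 : |1 - ξ.2.2.1| ≤ 2 := abs_le.2 ⟨by linarith, by linarith⟩
  calc ξ.1.2 * |1 - ξ.2.2.1| ≤ η / 4 * 2 := mul_le_mul h1 h3 (abs_nonneg _) (by positivity)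
    _ < η := by linarith

/-- A linear function on one-jets, in coordinates. -/
lemma jet_eq_sum (L : Jet n →L[ℝ] ℝ) (J : Jet n) :
    L J = L (1, 0) * J.1 + ∑ k, L (0, coordVec k) * J.2 k := by
  have h1 : J = J.1 • ((1, 0) : Jet n) + ∑ k, J.2 k • ((0, coordVec k) : Jet n) := by
    refine Prod.ext ?_ ?_
    · simp [Prod.fst_sum]
    · rw [Prod.snd_add, Prod.snd_sum]
      simp [sum_smul_coordVec]
  conv_lhs => rw [h1]
  rw [map_add, map_smul, map_sum]
  simp only [map_smul, smul_eq_mul]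
  rw [mul_comm]
  exact congrArg _ (Finset.sum_congr rfl fun k _ => mul_comm _ _)

/-- The derivative at `J = 0` of a smooth function of all variables is smooth. -/
lemma contDiffAt_jetDeriv {f : Vars P n → ℝ} {ζ : (P × ℝ) × Frame n}
    (hf : ContDiffAt ℝ ∞ f (ζ.1, (ζ.2, 0))) :
    ContDiffAt ℝ ∞ (fun ζ : (P × ℝ) × Frame n =>
      fderiv ℝ (fun J : Jet n => f (ζ.1, (ζ.2, J))) 0) ζ := by
  refine ContDiffAt.fderiv (f := fun (ζ : (P × ℝ) × Frame n) J => f (ζ.1, (ζ.2, J)))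
    (g := fun _ => 0) (n := ∞) ?_ contDiffAt_const (by simp)
  exact ContDiffAt.comp (g := f)
    (f := fun p : ((P × ℝ) × Frame n) × Jet n => (p.1.1, (p.1.2, p.2))) (ζ, 0) hf
    ((contDiff_fst.comp contDiff_fst).prodMk
      ((contDiff_snd.comp contDiff_fst).prodMk contDiff_snd)).contDiffAt

end Core

/-! ### The error terms -/

section ErrorTerms

open Filter Topology

variable {n : ℕ} {P : Type} [NormedAddCommGroup P] [NormedSpace ℝ P]
  (H : P × V (n + 1) → Bil (n + 1))
  (A : P → V (n + 1) →L[ℝ] V (n + 1) →L[ℝ] Bil (n + 1)) (R F : (P × V (n + 1)) × ℝ → Bil (n + 1))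
  (T : (P × V (n + 1)) × ℝ → V (n + 1) →L[ℝ] Bil (n + 1)) (i j : Fin n)

/-- The coefficients of the operator of type `L^1`, as a linear form on one-jets. -/
def linForm (ζ : (P × ℝ) × Frame n) : Jet n →L[ℝ] ℝ :=
  ζ.1.2 • fderiv ℝ (fun J : Jet n => constPart F i j (ζ.1, (ζ.2, J))) 0
    + fderiv ℝ (fun J : Jet n => linPart H A R T i j (ζ.1, (ζ.2, J))) 0

/-- The operator of type `Q^1`: the quadratic part, together with the second order Taylor
remainders of the other parts. -/
def quadRest (ξ : Vars P n) : ℝ :=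
  quadPart H A i j ξ + ξ.1.2 ^ 4 * (constPart F i j ξ - constPart F i j (ξ.1, (ξ.2.1, 0)))
    + ξ.1.2 ^ 3 * (linPart H A R T i j ξ - linForm H A R F T i j (ξ.1, ξ.2.1) ξ.2.2)

variable {H A R F T i j} {K : Set P} {ε : ℝ}

lemma IsRegular.contDiffAt_linForm (hH : ContDiff ℝ ∞ H) (hR : IsRadialExpansion K H A R F T)
    {ζ : (P × ℝ) × Frame n} (h : IsRegular H (ζ.1, (ζ.2, 0))) :
    ContDiffAt ℝ ∞ (linForm H A R F T i j) ζ :=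
  ((contDiff_snd.comp contDiff_fst).contDiffAt.smul
    (contDiffAt_jetDeriv (contDiff_constPart hR.smooth_F).contDiffAt)).add
    (contDiffAt_jetDeriv (h.contDiffAt_linPart hH hR.smooth_A hR.smooth_R hR.smooth_T))

lemma IsRegular.contDiffAt_quadRest (hH : ContDiff ℝ ∞ H) (hR : IsRadialExpansion K H A R F T)
    {ξ : Vars P n} (h : IsRegular H ξ) (h0 : IsRegular H (ξ.1, (ξ.2.1, 0))) :
    ContDiffAt ℝ ∞ (quadRest H A R F T i j) ξ := by
  have hb : ContDiff ℝ ∞ fun ξ : Vars P n => (ξ.1, ξ.2.1) :=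
    contDiff_fst.prodMk (contDiff_fst.comp contDiff_snd)
  have hb0 : ContDiff ℝ ∞ fun ξ : Vars P n => ((ξ.1, (ξ.2.1, 0)) : Vars P n) :=
    contDiff_fst.prodMk ((contDiff_fst.comp contDiff_snd).prodMk contDiff_const)
  have hc : ContDiff ℝ ∞ (constPart F i j : Vars P n → ℝ) := contDiff_constPart hR.smooth_F
  have hl : ContDiffAt ℝ ∞ (fun ξ : Vars P n => linForm H A R F T i j (ξ.1, ξ.2.1)) ξ :=
    ContDiffAt.comp (g := linForm H A R F T i j) (f := fun ξ : Vars P n => (ξ.1, ξ.2.1)) ξ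
      (h0.contDiffAt_linForm hH hR) hb.contDiffAt
  exact ((h.contDiffAt_quadPart hH hR.smooth_A).add ((contDiff_scale.pow 4).contDiffAt.mul
    (hc.sub (hc.comp hb0)).contDiffAt)).add ((contDiff_scale.pow 3).contDiffAt.mul
    ((h.contDiffAt_linPart hH hR.smooth_A hR.smooth_R hR.smooth_T).sub
      (hl.clm_apply contDiff_jet.contDiffAt)))

lemma quadRest_zero {q : P × ℝ} {x : Frame n} : quadRest H A R F T i j (q, (x, 0)) = 0 := by
  simp [quadRest, quadPart_zero, linPart_zero]

lemma IsRegular.fderiv_quadRest (hH : ContDiff ℝ ∞ H) (hR : IsRadialExpansion K H A R F T)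
    {q : P × ℝ} {x : Frame n} (h : IsRegular H (q, (x, 0))) :
    fderiv ℝ (fun J : Jet n => quadRest H A R F T i j (q, (x, J))) 0 = 0 := by
  have h1 := h.hasFDerivAt_quadPart (i := i) (j := j) hH hR.smooth_A
  have h2 := ((contDiffAt_slice (contDiff_constPart (i := i) (j := j) (P := P)
    hR.smooth_F).contDiffAt (q := q) (x := x) (J := 0)).differentiableAt (by simp)).hasFDerivAt
  have h3 := ((contDiffAt_slice (h.contDiffAt_linPart (i := i) (j := j) hH hR.smooth_A hR.smooth_R
    hR.smooth_T)).differentiableAt (by simp)).hasFDerivAt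
  have h4 := (linForm H A R F T i j (q, x)).hasFDerivAt (x := (0 : Jet n))
  have h5 : HasFDerivAt (fun J : Jet n => quadRest H A R F T i j (q, (x, J))) _ 0 :=
    (h1.fun_add ((h2.sub_const (constPart F i j (q, (x, 0)))).const_mul (q.2 ^ 4))).fun_add
      ((h3.fun_sub h4).const_mul (q.2 ^ 3))
  rw [h5.fderiv, linForm]
  ext J
  · simp
    ring
  · simp
    ring

lemma isCoeff_const {C : ℕ → ℝ} (hC : ∀ k, 1 ≤ C k) {c : ℝ} (hc : |c| ≤ 1) :
    IsCoeff C (fun _ : Frame n => c) := by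
  refine fun x _ => ⟨contDiffAt_const, fun k => ?_⟩
  rcases k with _ | k
  · rw [norm_iteratedFDeriv_zero]
    exact hc.trans (hC 0)
  · rw [iteratedFDeriv_succ_const]
    simpa using zero_le_one.trans (hC (k + 1))

lemma IsCoeff.mono {C C' : ℕ → ℝ} (hC : ∀ k, C k ≤ C' k) {a : Frame n → ℝ} (h : IsCoeff C a) :
    IsCoeff C' a :=
  fun x hx => ⟨(h x hx).1, fun k => ((h x hx).2 k).trans (hC k)⟩

lemma IsQ1.mono {C C' : ℕ → ℝ} (hC : ∀ k, C k ≤ C' k) {δ Λ : ℝ} {Q : Frame n × Jet n → ℝ}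
    (h : IsQ1 C δ Λ Q) : IsQ1 C' δ Λ Q :=
  ⟨fun x J hx h1 h2 => ⟨(h.1 x J hx h1 h2).1, fun k => ((h.1 x J hx h1 h2).2 k).trans (hC k)⟩, h.2⟩

lemma IsCoeff.const_mul {C : ℕ → ℝ} {a : Frame n → ℝ} (h : IsCoeff C a) {c : ℝ} (hc : 0 ≤ c) :
    IsCoeff (fun k => C k * c) (fun x => c * a x) := by
  refine fun x hx => ⟨contDiffAt_const.mul (h x hx).1, fun k => ?_⟩
  have h1 : iteratedFDeriv ℝ k (c • a) x = c • iteratedFDeriv ℝ k a x :=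
    iteratedFDeriv_const_smul_apply ((h x hx).1.of_le (by exact_mod_cast le_top))
  change ‖iteratedFDeriv ℝ k (c • a) x‖ ≤ _
  rw [h1, norm_smul, Real.norm_of_nonneg hc, mul_comm]
  exact mul_le_mul_of_nonneg_right ((h x hx).2 k) hc

/-- Functions depending smoothly on parameters in a compact set are coefficients with common
bounds. -/
lemma exists_isCoeff {ι : Type*} [Fintype ι] {f : ι → (P × ℝ) × Frame n → ℝ} {𝒬 : Set (P × ℝ)}
    (hQ : IsCompact 𝒬) (hf : ∀ a, ∀ q ∈ 𝒬, ∀ x, IsFrame x → ContDiffAt ℝ ∞ (f a) (q, x)) :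
    ∃ C : ℕ → ℝ, (∀ k, 0 ≤ C k) ∧ ∀ a, ∀ q ∈ 𝒬, IsCoeff C fun x => f a (q, x) := by
  obtain ⟨C, hC, b⟩ := exists_bound_iteratedFDeriv (hQ.prod (isCompact_isFrame n))
    fun a z hz => hf a z.1 hz.1 z.2 hz.2
  refine ⟨C, hC, fun a q hq x hx => ⟨?_, fun k => b a (q, x) ⟨hq, hx⟩ k⟩⟩
  exact ContDiffAt.comp (g := f a) (f := fun x : Frame n => (q, x)) x (hf a q hq x hx)
    (contDiffAt_const.prodMk contDiffAt_id)

/-- Functions depending smoothly on parameters in a compact set and vanishing to second order are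
operators of type `Q^1` with common bounds. -/
lemma exists_isQ1 {ι : Type*} [Fintype ι] {f : ι → Vars P n → ℝ} {𝒬 : Set (P × ℝ)} {δ Λ : ℝ}
    (hQ : IsCompact 𝒬) (hf : ∀ a, ∀ q ∈ 𝒬, ∀ x, IsFrame x → ∀ J : Jet n, |J.1| ≤ δ → ‖J.2‖ ≤ Λ →
      ContDiffAt ℝ ∞ (f a) (q, (x, J)))
    (h0 : ∀ a, ∀ q ∈ 𝒬, ∀ x, IsFrame x → f a (q, (x, 0)) = 0)
    (h1 : ∀ a, ∀ q ∈ 𝒬, ∀ x, IsFrame x → fderiv ℝ (fun J : Jet n => f a (q, (x, J))) 0 = 0) :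
    ∃ C : ℕ → ℝ, (∀ k, 0 ≤ C k) ∧ ∀ a, ∀ q ∈ 𝒬, IsQ1 C δ Λ fun y => f a (q, y) := by
  obtain ⟨C, hC, b⟩ := exists_bound_iteratedFDeriv
    (hQ.prod ((isCompact_isFrame n).prod (isCompact_jet n δ Λ)))
    fun a z hz => hf a z.1 hz.1 z.2.1 hz.2.1 z.2.2 hz.2.2.1 hz.2.2.2
  refine ⟨C, hC, fun a q hq => ⟨fun x J hx hJ₁ hJ₂ =>
    ⟨?_, fun k => b a (q, (x, J)) ⟨hq, hx, hJ₁, hJ₂⟩ k⟩, fun x hx => ⟨h0 a q hq x hx, h1 a q hq x hx⟩⟩⟩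
  exact ContDiffAt.comp (g := f a) (f := fun y : Frame n × Jet n => (q, y)) (x, J)
    (hf a q hq x hx J hJ₁ hJ₂) (contDiffAt_const.prodMk contDiffAt_id)

lemma isL2_apply {C : ℕ → ℝ} (hC : ∀ k, 1 ≤ C k) (i j : Fin n) :
    IsL2 C (fun (_ : Frame n) (_ : Jet n) (D : Fin n → Fin n → ℝ) => D i j) := by
  refine ⟨fun _ => 0, fun _ _ => 0, fun k l _ => if k = i ∧ l = j then 1 else 0,
    isCoeff_const hC (by simp), fun _ => isCoeff_const hC (by simp),
    fun k l => isCoeff_const hC (by split_ifs <;> simp), fun x J D => ?_⟩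
  simp [ite_and]

/-- The error terms for a normal family. The part of order `ρ⁵` is evaluated at `w = 0`; the
derivatives at `w = 0` of the remaining parts form the operator of type `L¹`, and what is left vanishes
to second order. The only product of type `L² ⋉ Q¹` is that of `w_ij` and `len - 1`. -/
theorem IsNormalFamily.exists_error_terms (h : IsNormalFamily K ε H)
    (hR : IsRadialExpansion K H A R F T) {δ : ℝ} (hδ : 0 < δ) (Λ : ℝ)
    {η : ℝ} (hη : ∀ ξ : Vars P n, ξ.1.1 ∈ K → 0 ≤ ξ.1.2 → ξ.1.2 ≤ η → IsFrame ξ.2.1 →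
      |ξ.2.2.1| ≤ δ → IsRegular H ξ) :
    ∃ C : ℕ → ℝ, ∀ κ ∈ K, ∀ ρ : ℝ, 0 < ρ → ρ < η →
      ∃ (O : Fin n → Fin n → Frame n → ℝ) (L₁ : Fin n → Fin n → Frame n → Jet n → ℝ)
        (Q₁ : Fin n → Fin n → Frame n × Jet n → ℝ)
        (L₂ : Fin n → Fin n → Frame n → Jet n → (Fin n → Fin n → ℝ) → ℝ)
        (Q₂ : Frame n × Jet n → ℝ),
        (∀ i j, IsCoeff (fun k => C k * ρ ^ 5) (O i j)) ∧ (∀ i j, IsL1 C (L₁ i j)) ∧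
        (∀ i j, IsQ1 C δ Λ (Q₁ i j)) ∧ (∀ i j, IsL2 C (L₂ i j)) ∧ IsQ1 C δ Λ Q₂ ∧
        ∀ i j x J D, ρ * ((len H ((κ, ρ), (x, J)) - 1) * D i j
            + quadPart H A i j ((κ, ρ), (x, J)) + ρ ^ 4 * constPart F i j ((κ, ρ), (x, J))
            + ρ ^ 3 * linPart H A R T i j ((κ, ρ), (x, J)))
          = O i j x + ρ ^ 4 * L₁ i j x J + ρ * Q₁ i j (x, J) + ρ * (L₂ i j x J D * Q₂ (x, J)) := by
  have hQ : IsCompact (K ×ˢ Icc (0 : ℝ) η) := h.isCompact.prod isCompact_Icc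
  have hreg : ∀ q ∈ K ×ˢ Icc (0 : ℝ) η, ∀ x : Frame n, IsFrame x → ∀ J : Jet n, |J.1| ≤ δ →
      IsRegular H (q, (x, J)) := fun q hq x hx J hJ =>
    hη (q, (x, J)) hq.1 hq.2.1 hq.2.2 hx hJ
  have hreg₀ : ∀ q ∈ K ×ˢ Icc (0 : ℝ) η, ∀ x : Frame n, IsFrame x →
      IsRegular H (q, (x, 0)) := fun q hq x hx => hreg q hq x hx 0 (by simpa using hδ.le)
  have hs := h.smooth
  obtain ⟨C₁, hC₁, b₁⟩ := exists_isCoeff hQ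
    (f := fun (a : Fin n × Fin n) (ζ : (P × ℝ) × Frame n) => constPart F a.1 a.2 (ζ.1, (ζ.2, 0)))
    fun a q _ x _ => ((contDiff_constPart hR.smooth_F).comp
      (contDiff_fst.prodMk (contDiff_snd.prodMk contDiff_const))).contDiffAt
  obtain ⟨C₂, hC₂, b₂⟩ := exists_isCoeff hQ
    (f := fun (a : Fin n × Fin n) (ζ : (P × ℝ) × Frame n) =>
      linForm H A R F T a.1 a.2 ζ (1, 0))
    fun a q hq x hx => ((hreg₀ q hq x hx).contDiffAt_linForm (ζ := (q, x)) hs hR).clm_apply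
      contDiffAt_const
  obtain ⟨C₃, hC₃, b₃⟩ := exists_isCoeff hQ
    (f := fun (a : Fin n × Fin n × Fin n) (ζ : (P × ℝ) × Frame n) =>
      linForm H A R F T a.1 a.2.1 ζ (0, coordVec a.2.2))
    fun a q hq x hx => ((hreg₀ q hq x hx).contDiffAt_linForm (ζ := (q, x)) hs hR).clm_apply
      contDiffAt_const
  obtain ⟨C₄, hC₄, b₄⟩ := exists_isQ1 (δ := δ) (Λ := Λ) hQ
    (f := fun (a : Fin n × Fin n) (ξ : Vars P n) => quadRest H A R F T a.1 a.2 ξ)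
    (fun a q hq x hx J hJ _ => (hreg q hq x hx J hJ).contDiffAt_quadRest hs hR (hreg₀ q hq x hx))
    (fun _ _ _ _ _ => quadRest_zero) fun a q hq x hx => (hreg₀ q hq x hx).fderiv_quadRest hs hR
  obtain ⟨C₅, hC₅, b₅⟩ := exists_isQ1 (δ := δ) (Λ := Λ) hQ
    (f := fun (_ : Unit) (ξ : Vars P n) => len H ξ - 1)
    (fun a q hq x hx J hJ _ => ((hreg q hq x hx J hJ).contDiffAt_len hs).sub contDiffAt_const)
    (fun _ q _ x _ => by simp [len_zero])
    fun a q hq x hx => (((hreg₀ q hq x hx).hasFDerivAt_len hs).sub_const 1).fderiv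
  have hC : ∀ k, 1 ≤ 1 + C₁ k + C₂ k + C₃ k + C₄ k + C₅ k ∧
      C₁ k ≤ 1 + C₁ k + C₂ k + C₃ k + C₄ k + C₅ k ∧ C₂ k ≤ 1 + C₁ k + C₂ k + C₃ k + C₄ k + C₅ k ∧
      C₃ k ≤ 1 + C₁ k + C₂ k + C₃ k + C₄ k + C₅ k ∧ C₄ k ≤ 1 + C₁ k + C₂ k + C₃ k + C₄ k + C₅ k ∧
      C₅ k ≤ 1 + C₁ k + C₂ k + C₃ k + C₄ k + C₅ k := fun k => by
    have h1 := hC₁ k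
    have h2 := hC₂ k
    have h3 := hC₃ k
    have h4 := hC₄ k
    have h5 := hC₅ k
    refine ⟨?_, ?_, ?_, ?_, ?_, ?_⟩ <;> linarith
  refine ⟨fun k => 1 + C₁ k + C₂ k + C₃ k + C₄ k + C₅ k, fun κ hκ ρ hρ hρη => ?_⟩
  have hq : ((κ, ρ) : P × ℝ) ∈ K ×ˢ Icc (0 : ℝ) η := ⟨hκ, hρ.le, hρη.le⟩
  refine ⟨fun i j x => ρ ^ 5 * constPart F i j ((κ, ρ), (x, 0)),
    fun i j x J => linForm H A R F T i j ((κ, ρ), x) J,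
    fun i j y => quadRest H A R F T i j ((κ, ρ), y), fun i j _ _ D => D i j,
    fun y => len H ((κ, ρ), y) - 1, fun i j => ?_, fun i j => ?_,
    fun i j => (b₄ (i, j) _ hq).mono fun k => (hC k).2.2.2.2.1,
    fun i j => isL2_apply (fun k => (hC k).1) i j,
    (b₅ () _ hq).mono fun k => (hC k).2.2.2.2.2, fun i j x J D => ?_⟩
  · exact ((b₁ (i, j) _ hq).mono fun k => (hC k).2.1).const_mul (by positivity)
  · exact ⟨fun x => linForm H A R F T i j ((κ, ρ), x) (1, 0),
      fun k x => linForm H A R F T i j ((κ, ρ), x) (0, coordVec k),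
      (b₂ (i, j) _ hq).mono fun k => (hC k).2.2.1,
      fun l => (b₃ (i, j, l) _ hq).mono fun k => (hC k).2.2.2.1, fun x J => jet_eq_sum _ J⟩
  · simp only [quadRest]
    ring

end ErrorTerms

/-! ### Parametrizations of the unit sphere -/

section Parametrization

open Filter Topology

variable {n : ℕ} {Θ : V n → S n} {z : V n} {w : S n → ℝ}

lemma pd_smul {m : ℕ} {W : Type*} [NormedAddCommGroup W] [NormedSpace ℝ W] {f : V m → ℝ}
    {v : V m → W} {x : V m} (hf : DifferentiableAt ℝ f x) (hv : DifferentiableAt ℝ v x)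
    (a : Fin m) : pd a (fun y => f y • v y) x = f x • pd a v x + pd a f x • v x := by
  simp [pd, fderiv_fun_smul hf hv]

lemma pd_inner {m : ℕ} {W : Type*} [NormedAddCommGroup W] [InnerProductSpace ℝ W] {u v : V m → W}
    {x : V m} (hu : DifferentiableAt ℝ u x) (hv : DifferentiableAt ℝ v x) (a : Fin m) :
    pd a (fun y => (inner ℝ (u y) (v y) : ℝ)) x
      = inner ℝ (u x) (pd a v x) + inner ℝ (pd a u x) (v x) := by
  rw [pd, fderiv_inner_apply ℝ hu hv]
  rfl

lemma inner_pos_self (z : V n) : (inner ℝ (pos Θ z) (pos Θ z) : ℝ) = 1 := by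
  simp [pos]

lemma IsNormalAt.contDiffAt_pos (h : IsNormalAt Θ z) : ContDiffAt ℝ ∞ (pos Θ) z := by
  have := Fact.mk (finrank_euclideanSpace_fin (𝕜 := ℝ) (n := n + 1))
  have h1 : ContMDiff (𝓡 n) 𝓘(ℝ, V (n + 1)) ∞ ((↑) : S n → V (n + 1)) := contMDiff_coe_sphere
  exact (h1.contMDiffAt.comp z h.smooth).contDiffAt

lemma IsNormalAt.contDiffAt_comp (h : IsNormalAt Θ z) (hw : ContMDiff (𝓡 n) 𝓘(ℝ, ℝ) 2 w) :
    ContDiffAt ℝ 2 (fun y => w (Θ y)) z :=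
  (hw.contMDiffAt.comp z (h.smooth.of_le two_le_infty)).contDiffAt

lemma inner_pos_pd {z : V n} (h : DifferentiableAt ℝ (pos Θ) z) (i : Fin n) :
    (inner ℝ (pos Θ z) (pd i (pos Θ) z) : ℝ) = 0 := by
  have h1 := pd_inner h h i
  simp only [inner_pos_self] at h1
  rw [pd, fderiv_const_apply, _root_.zero_apply, real_inner_comm (pos Θ z)] at h1
  linarith

lemma IsNormalAt.isFrame (h : IsNormalAt Θ z) : IsFrame (frameAt Θ z) :=
  ⟨by simp [frameAt, pos],
    fun i => inner_pos_pd (h.contDiffAt_pos.differentiableAt (by simp)) i, h.orthonormal⟩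

lemma IsNormalAt.eventually_differentiableAt (h : IsNormalAt Θ z) :
    ∀ᶠ y in 𝓝 z, DifferentiableAt ℝ (pos Θ) y := by
  have h1 : ContDiffAt ℝ 1 (pos Θ) z := h.contDiffAt_pos.of_le (by exact_mod_cast le_top)
  filter_upwards [h1.eventually (by simp)] with y hy
  exact hy.differentiableAt (by norm_num)

/-- The second fundamental form of the unit sphere is minus the first one. -/
lemma IsNormalAt.pd_pd_pos (h : IsNormalAt Θ z) (i j : Fin n) :
    pd i (pd j (pos Θ)) z = -((if i = j then (1 : ℝ) else 0) • pos Θ z) := by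
  have hd := h.contDiffAt_pos.differentiableAt (by simp)
  have hj : DifferentiableAt ℝ (pd j (pos Θ)) z :=
    (contDiffAt_pd (r := ∞) h.contDiffAt_pos (by simp) j).differentiableAt (by simp)
  obtain ⟨c, hc⟩ : ∃ c : ℝ, c • pos Θ z = pd i (pd j (pos Θ)) z := by
    have h1 := h.connection i j
    rwa [Submodule.starProjection_apply_eq_zero_iff, Submodule.orthogonal_orthogonal,
      Submodule.mem_span_singleton] at h1
  have h0 : (fun y => (inner ℝ (pos Θ y) (pd j (pos Θ) y) : ℝ)) =ᶠ[𝓝 z] fun _ => 0 := by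
    filter_upwards [h.eventually_differentiableAt] with y hy using inner_pos_pd hy j
  have h2 := pd_inner hd hj i
  rw [pd, h0.fderiv_eq, fderiv_const_apply, _root_.zero_apply, ← hc, inner_smul_right,
    inner_pos_self, h.orthonormal] at h2
  rw [← hc, ← neg_smul]
  congr 1
  linarith

variable (ρ : ℝ)

lemma IsNormalAt.contDiffAt_sphereParam (h : IsNormalAt Θ z)
    (hw : ContMDiff (𝓡 n) 𝓘(ℝ, ℝ) 2 w) : ContDiffAt ℝ 2 (sphereParam ρ w Θ) z :=
  (contDiffAt_const.mul (contDiffAt_const.sub (h.contDiffAt_comp hw))).smul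
    (h.contDiffAt_pos.of_le two_le_infty)

lemma pd_sphereParam {z : V n} (hP : DifferentiableAt ℝ (pos Θ) z)
    (hw : DifferentiableAt ℝ (fun y => w (Θ y)) z) (k : Fin n) :
    pd k (sphereParam ρ w Θ) z = (ρ * (1 - w (Θ z))) • pd k (pos Θ) z
      - (ρ * pd k (fun y => w (Θ y)) z) • pos Θ z := by
  have h1 : pd k (fun y => ρ * (1 - w (Θ y))) z = -(ρ * pd k (fun y => w (Θ y)) z) := by
    rw [pd, fderiv_const_mul (hw.const_sub 1), fderiv_const_sub]
    simp [pd]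
  have h2 := pd_smul ((hw.const_sub 1).const_mul ρ) hP k
  rw [h1, neg_smul, ← sub_eq_add_neg] at h2
  exact h2

lemma IsNormalAt.pd_sphereParam (h : IsNormalAt Θ z) (hw : ContMDiff (𝓡 n) 𝓘(ℝ, ℝ) 2 w)
    (k : Fin n) :
    pd k (sphereParam ρ w Θ) z = ρ • zvec (frameAt Θ z) (jetAt w Θ z) k := by
  rw [SmallSpheres.pd_sphereParam ρ (h.contDiffAt_pos.differentiableAt (by simp))
    ((h.contDiffAt_comp hw).differentiableAt (by norm_num)), zvec, smul_sub, smul_smul, smul_smul]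
  rfl

/-- The second derivatives of the parametrization of the perturbed sphere, in terms of the frame
and of the two-jet of `w`. -/
lemma IsNormalAt.pd_pd_sphereParam (h : IsNormalAt Θ z) (hw : ContMDiff (𝓡 n) 𝓘(ℝ, ℝ) 2 w)
    (i j : Fin n) :
    pd i (pd j (sphereParam ρ w Θ)) z
      = -(ρ • (((1 - w (Θ z)) * (if i = j then 1 else 0) + hessAt w Θ z i j) • pos Θ z
          + ((jetAt w Θ z).2 i • pd j (pos Θ) z + (jetAt w Θ z).2 j • pd i (pos Θ) z))) := by
  have hW := h.contDiffAt_comp hw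
  have hd := h.contDiffAt_pos.differentiableAt (by simp)
  have hWd := hW.differentiableAt (by norm_num)
  have hj : DifferentiableAt ℝ (pd j (pos Θ)) z :=
    (contDiffAt_pd (r := ∞) h.contDiffAt_pos (by simp) j).differentiableAt (by simp)
  have hWj : DifferentiableAt ℝ (pd j fun y => w (Θ y)) z :=
    (contDiffAt_pd (r := 1) hW (by norm_num) j).differentiableAt (by norm_num)
  have hWe : ∀ᶠ y in 𝓝 z, DifferentiableAt ℝ (fun y => w (Θ y)) y := by
    filter_upwards [hW.eventually (by simp)] with y hy using hy.differentiableAt (by norm_num)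
  have h0 : pd j (sphereParam ρ w Θ) =ᶠ[𝓝 z] fun y => (ρ * (1 - w (Θ y))) • pd j (pos Θ) y
      - (ρ * pd j (fun y => w (Θ y)) y) • pos Θ y := by
    filter_upwards [h.eventually_differentiableAt, hWe] with y h1 h2
      using SmallSpheres.pd_sphereParam ρ h1 h2 j
  have h1 : pd i (fun y => ρ * (1 - w (Θ y))) z = -(ρ * pd i (fun y => w (Θ y)) z) := by
    rw [pd, fderiv_const_mul (hWd.const_sub 1), fderiv_const_sub]
    simp [pd]
  have h2 : pd i (fun y => ρ * pd j (fun y => w (Θ y)) y) z = ρ * hessAt w Θ z i j := by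
    rw [pd, fderiv_const_mul hWj]
    rfl
  have h3 := pd_smul ((hWd.const_sub 1).const_mul ρ) hj i
  have h4 := pd_smul (hWj.const_mul ρ) hd i
  rw [h1, h.pd_pd_pos] at h3
  rw [h2] at h4
  have h5 : pd i (pd j (sphereParam ρ w Θ)) z
      = pd i (fun y => (ρ * (1 - w (Θ y))) • pd j (pos Θ) y) z
        - pd i (fun y => (ρ * pd j (fun y => w (Θ y)) y) • pos Θ y) z := by
    rw [pd, h0.fderiv_eq, fderiv_fun_sub (((hWd.const_sub 1).const_mul ρ).fun_smul hj)
      ((hWj.const_mul ρ).fun_smul hd)]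
    rfl
  rw [h5, h3, h4]
  simp only [jetAt]
  module

lemma isLinearMap_lowChr_left {m : ℕ} (L : V m →L[ℝ] Bil m) (a b : V m) :
    IsLinearMap ℝ fun c => lowChr L c a b := by
  constructor
  · intro c d
    simp [lowChr]
    ring
  · intro r c
    simp [lowChr]
    ring

/-- The term of the second fundamental form linear in `∇w`. -/
lemma IsNormalMetric.sum_lowChr {ε : ℝ} {H : V (n + 1) → Bil (n + 1)} (h : IsNormalMetric ε H)
    (i j : Fin n) :
    ∑ k, (jetAt w Θ z).2 k * lowChr (der2 H 0 (SmallSpheres.pos Θ z)) (pd k (SmallSpheres.pos Θ) z) (pd i (SmallSpheres.pos Θ) z)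
        (pd j (SmallSpheres.pos Θ) z)
      = (1 / 3) * (curv (fun y => mat (H y)) 0 (gradAt w Θ z) (pd i (SmallSpheres.pos Θ) z) (pd j (SmallSpheres.pos Θ) z)
          (SmallSpheres.pos Θ z)
        + curv (fun y => mat (H y)) 0 (SmallSpheres.pos Θ z) (pd i (SmallSpheres.pos Θ) z) (pd j (SmallSpheres.pos Θ) z)
          (gradAt w Θ z)) := by
  rw [← h.lowChr_radial, gradAt]
  have hl := isLinearMap_lowChr_left (der2 H 0 (SmallSpheres.pos Θ z)) (pd i (SmallSpheres.pos Θ) z) (pd j (SmallSpheres.pos Θ) z)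
  have h1 := map_sum hl.mk' (fun k => pd k (fun y => w (Θ y)) z • pd k (SmallSpheres.pos Θ) z) Finset.univ
  simp only [IsLinearMap.mk'_apply, hl.map_smul, smul_eq_mul] at h1
  exact h1.symm

end Parametrization

/-! ### The expansion, locally uniformly in the centre -/

section Expansion

open Filter Topology

lemma IsL1.mono {n : ℕ} {C C' : ℕ → ℝ} (hC : ∀ k, C k ≤ C' k) {L : Frame n → Jet n → ℝ}
    (h : IsL1 C L) : IsL1 C' L := by
  obtain ⟨a, b, ha, hb, hL⟩ := h
  exact ⟨a, b, ha.mono hC, fun k => (hb k).mono hC, hL⟩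

lemma IsL2.mono {n : ℕ} {C C' : ℕ → ℝ} (hC : ∀ k, C k ≤ C' k)
    {L : Frame n → Jet n → (Fin n → Fin n → ℝ) → ℝ} (h : IsL2 C L) : IsL2 C' L := by
  obtain ⟨a, b, c, ha, hb, hc, hL⟩ := h
  exact ⟨a, b, c, ha.mono hC, fun k => (hb k).mono hC, fun k l => (hc k l).mono hC, hL⟩

/-- The leading part of the expansion of the second fundamental form of the perturbed sphere, for
the metric coefficients `h`. -/
def leadingPart {n : ℕ} (h : V (n + 1) → Matrix (Fin (n + 1)) (Fin (n + 1)) ℝ) (ρ : ℝ)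
    (w : S n → ℝ) (Θ : V n → S n) (i j : Fin n) (z : V n) : ℝ :=
  ρ * (1 - w (Θ z)) * (if i = j then 1 else 0)
    + ρ * hessAt w Θ z i j
    + (2 / 3) * curv h 0 (pos Θ z) (pd i (pos Θ) z) (pos Θ z) (pd j (pos Θ) z)
      * ρ ^ 3 * (1 - w (Θ z)) ^ 3
    + (5 / 12) * nablaCurv h 0 (pos Θ z) (pos Θ z) (pd i (pos Θ) z) (pos Θ z) (pd j (pos Θ) z)
      * ρ ^ 4 * (1 - w (Θ z)) ^ 4
    - (1 / 3) * (curv h 0 (gradAt w Θ z) (pd i (pos Θ) z) (pd j (pos Θ) z) (pos Θ z)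
        + curv h 0 (pos Θ z) (pd i (pos Θ) z) (pd j (pos Θ) z) (gradAt w Θ z))
      * ρ ^ 3

/-- The expansion of the second fundamental form of the perturbed spheres `S_ρ(p, w)`, with a single
product in the error term `L² ⋉ Q¹`, and with the bounds `C`. -/
def HasExpansion {n : ℕ} {M : Type*} [TopologicalSpace M] [ChartedSpace (V (n + 1)) M]
    [IsManifold (𝓡 (n + 1)) ∞ M]
    (g : ContMDiffRiemannianMetric (𝓡 (n + 1)) ∞ (V (n + 1))
      (fun q : M => TangentSpace (𝓡 (n + 1)) q))
    (p : M) (E : Fin (n + 1) → TangentSpace (𝓡 (n + 1)) p) (δ Λ : ℝ) (C : ℕ → ℝ) (ρ : ℝ) : Prop :=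
  ∃ (O : Fin n → Fin n → Frame n → ℝ) (L₁ : Fin n → Fin n → Frame n → Jet n → ℝ)
    (Q₁ : Fin n → Fin n → Frame n × Jet n → ℝ)
    (L₂ : Fin n → Fin n → Frame n → Jet n → (Fin n → Fin n → ℝ) → ℝ)
    (Q₂ : Frame n × Jet n → ℝ),
    (∀ i j, IsCoeff (fun k => C k * ρ ^ 5) (O i j)) ∧ (∀ i j, IsL1 C (L₁ i j)) ∧
    (∀ i j, IsQ1 C δ Λ (Q₁ i j)) ∧ (∀ i j, IsL2 C (L₂ i j)) ∧ IsQ1 C δ Λ Q₂ ∧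
    ∀ (w : S n → ℝ) (Θ : V n → S n) (z : V n), ContMDiff (𝓡 n) 𝓘(ℝ, ℝ) 2 w → IsNormalAt Θ z →
      |w (Θ z)| ≤ δ → ‖gradAt w Θ z‖ ≤ Λ → ∀ i j : Fin n,
        sphereSecondFF g p E ρ w Θ i j z = leadingPart (normalMetric g p E) ρ w Θ i j z
          + O i j (frameAt Θ z) + ρ ^ 4 * L₁ i j (frameAt Θ z) (jetAt w Θ z)
          + ρ * Q₁ i j (frameAt Θ z, jetAt w Θ z)
          + ρ * (L₂ i j (frameAt Θ z) (jetAt w Θ z) (hessAt w Θ z)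
            * Q₂ (frameAt Θ z, jetAt w Θ z))

variable {n : ℕ} {P : Type} [NormedAddCommGroup P] [NormedSpace ℝ P] {K : Set P} {ε : ℝ}
  {H : P × V (n + 1) → Bil (n + 1)}
  {A : P → V (n + 1) →L[ℝ] V (n + 1) →L[ℝ] Bil (n + 1)} {R F : (P × V (n + 1)) × ℝ → Bil (n + 1)}
  {T : (P × V (n + 1)) × ℝ → V (n + 1) →L[ℝ] Bil (n + 1)}

/-- The exact formula for the second fundamental form of a perturbed sphere, for a metric of a normal
family. -/
lemma IsRadialExpansion.secondFF_sphereParam (h : IsNormalFamily K ε H)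
    (hR : IsRadialExpansion K H A R F T) {η : ℝ} (hη : 0 < η) (hηε : η ≤ ε)
    (hpos : ∀ κ ∈ K, ∀ y ∈ ball (0 : V (n + 1)) η, ∀ v, v ≠ 0 → 0 < H (κ, y) v v)
    {κ : P} (hκ : κ ∈ K) {ρ : ℝ} (hρ : 0 < ρ) (hρη : ρ ≤ η / 4) {δ : ℝ} (hδ : δ < 1)
    {w : S n → ℝ} {Θ : V n → S n} {z : V n} (hw : ContMDiff (𝓡 n) 𝓘(ℝ, ℝ) 2 w)
    (hΘ : IsNormalAt Θ z) (hwδ : |w (Θ z)| ≤ δ) (i j : Fin n) :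
    secondFF (fun y => mat (H (κ, y))) (sphereParam ρ w Θ) (pos Θ) i j z
      = leadingPart (fun y => mat (H (κ, y))) ρ w Θ i j z
        + ρ * ((len H ((κ, ρ), (frameAt Θ z, jetAt w Θ z)) - 1) * hessAt w Θ z i j
          + quadPart H A i j ((κ, ρ), (frameAt Θ z, jetAt w Θ z))
          + ρ ^ 4 * constPart F i j ((κ, ρ), (frameAt Θ z, jetAt w Θ z))
          + ρ ^ 3 * linPart H A R T i j ((κ, ρ), (frameAt Θ z, jetAt w Θ z))) := by
  set ξ : Vars P n := ((κ, ρ), (frameAt Θ z, jetAt w Θ z)) with hξ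
  have hm := h.isNormalMetric hκ
  have hx : IsFrame (frameAt Θ z) := hΘ.isFrame
  have hJ : (jetAt w Θ z).1 < 1 := (le_abs_self _).trans_lt (lt_of_le_of_lt hwδ hδ)
  have hbη : rad ξ • ξ.2.1.1 ∈ ball (0 : V (n + 1)) η :=
    rad_smul_mem_ball hδ hρ.le hρη hη hx hwδ
  have hb := ball_subset_ball hηε hbη
  have hreg : IsRegular H ξ := h.isRegular hκ hx hJ.ne hb (hpos κ hκ _ hbη)
  have h1 := hm.secondFF_jet hx hJ hρ hb (hpos κ hκ _ hbη) (hΘ.contDiffAt_sphereParam ρ hw)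
    (hΘ.contDiffAt_pos.of_le (by exact_mod_cast le_top)) (y := sphereParam ρ w Θ) (Υ := pos Θ)
    rfl rfl (fun k => hΘ.pd_sphereParam ρ hw k) (hΘ.pd_pd_sphereParam ρ hw i j)
  have h2 := hR.decomposition (i := i) (j := j) h (ξ := ξ) hκ hx hb hreg.isUnit hreg.len_pos.ne'
    (hessAt w Θ z i j)
  have h3 : ∑ k, ξ.2.2.2 k * chrFrame A i j k ξ
      = (1 / 3) * (curv (fun y => mat (H (κ, y))) 0 (gradAt w Θ z) (pd i (pos Θ) z)
          (pd j (pos Θ) z) (pos Θ z)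
        + curv (fun y => mat (H (κ, y))) 0 (pos Θ z) (pd i (pos Θ) z) (pd j (pos Θ) z)
          (gradAt w Θ z)) := by
    simp only [chrFrame, hR.eq_A]
    exact hm.sum_lowChr i j
  have h4 : A ξ.1.1 ξ.2.1.1 ξ.2.1.1 (ξ.2.1.2 i) (ξ.2.1.2 j)
      = (2 / 3) * curv (fun y => mat (H (κ, y))) 0 (pos Θ z) (pd i (pos Θ) z) (pos Θ z)
        (pd j (pos Θ) z) := by
    rw [hR.eq_A]
    exact hm.der2_radial _ _ _
  have h5 : der3 (fun y => H (ξ.1.1, y)) 0 ξ.2.1.1 ξ.2.1.1 ξ.2.1.1 (ξ.2.1.2 i) (ξ.2.1.2 j)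
      = nablaCurv (fun y => mat (H (κ, y))) 0 (pos Θ z) (pos Θ z) (pd i (pos Θ) z) (pos Θ z)
        (pd j (pos Θ) z) := hm.der3_radial _ _ _
  rw [h3, h4, h5] at h2
  rw [h1]
  refine (congrArg (ρ * ·) h2).trans ?_
  rw [leadingPart]
  simp only [hξ, jetAt]
  ring

/-- Near each point, the expansion holds with common bounds. -/
lemma exists_hasExpansion_nhds {M : Type*} [TopologicalSpace M] [T2Space M]
    [ChartedSpace (V (n + 1)) M] [IsManifold (𝓡 (n + 1)) ∞ M]
    (g : ContMDiffRiemannianMetric (𝓡 (n + 1)) ∞ (V (n + 1))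
      (fun q : M => TangentSpace (𝓡 (n + 1)) q)) {δ : ℝ} (hδ : 0 < δ) (hδ1 : δ < 1) (Λ : ℝ)
    (q : M) :
    ∃ U ∈ 𝓝 q, ∃ (ρ₀ : ℝ) (C : ℕ → ℝ), 0 < ρ₀ ∧ ∀ p ∈ U, ∀ E, IsOrthonormalBasis g p E →
      ∀ ρ, 0 < ρ → ρ < ρ₀ → HasExpansion g p E δ Λ C ρ := by
  obtain ⟨U, hU, K, ε, H, h, hn⟩ := exists_normal_family g q
  obtain ⟨A, R, F, T, hR⟩ := h.exists_radialExpansion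
  obtain ⟨η, hη, hηε, hpos⟩ := h.exists_pos
  obtain ⟨C, hC⟩ := h.exists_error_terms hR hδ Λ (η := η / 4) fun ξ hκ h0 h1 hx hJ => by
    have hb := rad_smul_mem_ball hδ1 h0 h1 hη hx hJ
    exact h.isRegular hκ hx ((le_abs_self _).trans_lt (hJ.trans_lt hδ1)).ne
      (ball_subset_ball hηε hb) (hpos _ hκ _ hb)
  refine ⟨U, hU, η / 4, C, by positivity, fun p hp E hE ρ hρ hρη => ?_⟩
  obtain ⟨κ, hκ, hm⟩ := hn p hp E hE
  obtain ⟨O, L₁, Q₁, L₂, Q₂, hO, hL₁, hQ₁, hL₂, hQ₂, he⟩ := hC κ hκ ρ hρ hρη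
  refine ⟨O, L₁, Q₁, L₂, Q₂, hO, hL₁, hQ₁, hL₂, hQ₂, fun w Θ z hw hΘ hwδ _ i j => ?_⟩
  have hb : sphereParam ρ w Θ z ∈ ball (0 : V (n + 1)) ε :=
    ball_subset_ball hηε (rad_smul_mem_ball (ξ := ((κ, ρ), (frameAt Θ z, jetAt w Θ z))) hδ1 hρ.le
      hρη.le hη hΘ.isFrame hwδ)
  have hg : ∀ x ∈ ball (0 : V (n + 1)) ε, normalMetric g p E =ᶠ[𝓝 x] fun y => mat (H (κ, y)) :=
    fun x hx => by
      filter_upwards [isOpen_ball.mem_nhds hx] with y hy using hm y hy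
  have h0 := hg 0 (mem_ball_self h.pos)
  have h1 : leadingPart (normalMetric g p E) ρ w Θ i j z
      = leadingPart (fun y => mat (H (κ, y))) ρ w Θ i j z := by
    simp only [leadingPart, curv_congr h0, nablaCurv_congr h0]
  rw [sphereSecondFF, secondFF_congr (hΘ.contDiffAt_sphereParam ρ hw).continuousAt (hg _ hb),
    hR.secondFF_sphereParam h hη hηε hpos hκ hρ hρη.le hδ1 hw hΘ hwδ i j, h1,
    he i j (frameAt Θ z) (jetAt w Θ z) (hessAt w Θ z)]
  ring

lemma HasExpansion.mono {M : Type*} [TopologicalSpace M] [ChartedSpace (V (n + 1)) M]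
    [IsManifold (𝓡 (n + 1)) ∞ M]
    {g : ContMDiffRiemannianMetric (𝓡 (n + 1)) ∞ (V (n + 1))
      (fun q : M => TangentSpace (𝓡 (n + 1)) q)}
    {p : M} {E : Fin (n + 1) → TangentSpace (𝓡 (n + 1)) p} {δ Λ : ℝ} {C C' : ℕ → ℝ} {ρ : ℝ}
    (hρ : 0 ≤ ρ) (hC : ∀ k, C k ≤ C' k) (h : HasExpansion g p E δ Λ C ρ) :
    HasExpansion g p E δ Λ C' ρ := by
  obtain ⟨O, L₁, Q₁, L₂, Q₂, hO, hL₁, hQ₁, hL₂, hQ₂, he⟩ := h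
  exact ⟨O, L₁, Q₁, L₂, Q₂,
    fun i j => (hO i j).mono fun k => mul_le_mul_of_nonneg_right (hC k) (pow_nonneg hρ 5),
    fun i j => (hL₁ i j).mono hC, fun i j => (hQ₁ i j).mono hC, fun i j => (hL₂ i j).mono hC,
    hQ₂.mono hC, he⟩

/-- The expansion holds with common bounds for centres in a compact set. -/
lemma exists_hasExpansion {M : Type*} [TopologicalSpace M] [T2Space M]
    [ChartedSpace (V (n + 1)) M] [IsManifold (𝓡 (n + 1)) ∞ M]
    (g : ContMDiffRiemannianMetric (𝓡 (n + 1)) ∞ (V (n + 1))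
      (fun q : M => TangentSpace (𝓡 (n + 1)) q)) {K : Set M} (hK : IsCompact K) {δ : ℝ}
    (hδ : 0 < δ) (hδ1 : δ < 1) (Λ : ℝ) :
    ∃ (ρ₀ : ℝ) (C : ℕ → ℝ), 0 < ρ₀ ∧ ∀ p ∈ K, ∀ E, IsOrthonormalBasis g p E →
      ∀ ρ, 0 < ρ → ρ < ρ₀ → HasExpansion g p E δ Λ C ρ := by
  refine hK.induction_on (p := fun s => ∃ (ρ₀ : ℝ) (C : ℕ → ℝ), 0 < ρ₀ ∧ ∀ p ∈ s, ∀ E,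
    IsOrthonormalBasis g p E → ∀ ρ, 0 < ρ → ρ < ρ₀ → HasExpansion g p E δ Λ C ρ)
    ⟨1, 0, one_pos, fun p hp => hp.elim⟩ ?_ ?_ fun q _ => ?_
  · rintro s t hst ⟨ρ₀, C, h0, h⟩
    exact ⟨ρ₀, C, h0, fun p hp => h p (hst hp)⟩
  · rintro s t ⟨ρ₁, C₁, h1, hs⟩ ⟨ρ₂, C₂, h2, ht⟩
    refine ⟨min ρ₁ ρ₂, fun k => max (C₁ k) (C₂ k), lt_min h1 h2, fun p hp E hE ρ h0 hρ => ?_⟩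
    rcases hp with hp | hp
    · exact (hs p hp E hE ρ h0 (hρ.trans_le (min_le_left _ _))).mono h0.le fun k => le_max_left _ _
    · exact (ht p hp E hE ρ h0 (hρ.trans_le (min_le_right _ _))).mono h0.le
        fun k => le_max_right _ _
  · obtain ⟨U, hU, h⟩ := exists_hasExpansion_nhds g hδ hδ1 Λ q
    exact ⟨U, mem_nhdsWithin_of_mem_nhds hU, h⟩

end Expansion

end SmallSpheres

end

theorem mainTheorem2 (n : ℕ) {M : Type*} [TopologicalSpace M] [T2Space M]
    [ChartedSpace (SmallSpheres.V (n + 1)) M] [IsManifold (𝓡 (n + 1)) ∞ M]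
    (g : ContMDiffRiemannianMetric (𝓡 (n + 1)) ∞ (SmallSpheres.V (n + 1))
      (fun q : M => TangentSpace (𝓡 (n + 1)) q))
    (K : Set M) (hK : IsCompact K) (δ Λ : ℝ) (hδ : 0 < δ) (hδ1 : δ < 1) (hΛ : 0 < Λ) :
    ∃ (ρ₀ : ℝ) (C : ℕ → ℝ) (r : ℕ), 0 < ρ₀ ∧
      ∀ p ∈ K, ∀ E : Fin (n + 1) → TangentSpace (𝓡 (n + 1)) p,
      SmallSpheres.IsOrthonormalBasis g p E → ∀ ρ : ℝ, 0 < ρ → ρ < ρ₀ →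
      ∃ (O : Fin n → Fin n → SmallSpheres.Frame n → ℝ)
        (L₁ : Fin n → Fin n → SmallSpheres.Frame n → SmallSpheres.Jet n → ℝ)
        (Q₁ : Fin n → Fin n → SmallSpheres.Frame n × SmallSpheres.Jet n → ℝ)
        (L₂ : Fin r → Fin n → Fin n →
          SmallSpheres.Frame n → SmallSpheres.Jet n → (Fin n → Fin n → ℝ) → ℝ)
        (Q₂ : Fin r → Fin n → Fin n → SmallSpheres.Frame n × SmallSpheres.Jet n → ℝ),
        (∀ i j, SmallSpheres.IsCoeff (fun k => C k * ρ ^ 5) (O i j)) ∧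
        (∀ i j, SmallSpheres.IsL1 C (L₁ i j)) ∧
        (∀ i j, SmallSpheres.IsQ1 C δ Λ (Q₁ i j)) ∧
        (∀ s i j, SmallSpheres.IsL2 C (L₂ s i j)) ∧
        (∀ s i j, SmallSpheres.IsQ1 C δ Λ (Q₂ s i j)) ∧
        ∀ (w : SmallSpheres.S n → ℝ) (Θ : SmallSpheres.V n → SmallSpheres.S n)
          (z : SmallSpheres.V n),
          ContMDiff (𝓡 n) 𝓘(ℝ, ℝ) 2 w → SmallSpheres.IsNormalAt Θ z →
          |w (Θ z)| ≤ δ → ‖SmallSpheres.gradAt w Θ z‖ ≤ Λ →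
          ∀ i j : Fin n,
            SmallSpheres.sphereSecondFF g p E ρ w Θ i j z =
              ρ * (1 - w (Θ z)) * (if i = j then 1 else 0)
              + ρ * SmallSpheres.hessAt w Θ z i j
              + (2 / 3) * SmallSpheres.curv (SmallSpheres.normalMetric g p E) 0
                  (SmallSpheres.pos Θ z) (SmallSpheres.pd i (SmallSpheres.pos Θ) z)
                  (SmallSpheres.pos Θ z) (SmallSpheres.pd j (SmallSpheres.pos Θ) z)
                * ρ ^ 3 * (1 - w (Θ z)) ^ 3
              + (5 / 12) * SmallSpheres.nablaCurv (SmallSpheres.normalMetric g p E) 0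
                  (SmallSpheres.pos Θ z)
                  (SmallSpheres.pos Θ z) (SmallSpheres.pd i (SmallSpheres.pos Θ) z)
                  (SmallSpheres.pos Θ z) (SmallSpheres.pd j (SmallSpheres.pos Θ) z)
                * ρ ^ 4 * (1 - w (Θ z)) ^ 4
              - (1 / 3) * (SmallSpheres.curv (SmallSpheres.normalMetric g p E) 0
                    (SmallSpheres.gradAt w Θ z) (SmallSpheres.pd i (SmallSpheres.pos Θ) z)
                    (SmallSpheres.pd j (SmallSpheres.pos Θ) z) (SmallSpheres.pos Θ z)
                  + SmallSpheres.curv (SmallSpheres.normalMetric g p E) 0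
                    (SmallSpheres.pos Θ z) (SmallSpheres.pd i (SmallSpheres.pos Θ) z)
                    (SmallSpheres.pd j (SmallSpheres.pos Θ) z) (SmallSpheres.gradAt w Θ z))
                * ρ ^ 3
              + O i j (SmallSpheres.frameAt Θ z)
              + ρ ^ 4 * L₁ i j (SmallSpheres.frameAt Θ z) (SmallSpheres.jetAt w Θ z)
              + ρ * Q₁ i j (SmallSpheres.frameAt Θ z, SmallSpheres.jetAt w Θ z)
              + ρ * ∑ s, L₂ s i j (SmallSpheres.frameAt Θ z) (SmallSpheres.jetAt w Θ z)
                    (SmallSpheres.hessAt w Θ z)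
                  * Q₂ s i j (SmallSpheres.frameAt Θ z, SmallSpheres.jetAt w Θ z) := by
  obtain ⟨ρ₀, C, h0, h⟩ := SmallSpheres.exists_hasExpansion g hK hδ hδ1 Λ
  refine ⟨ρ₀, C, 1, h0, fun p hp E hE ρ hρ hρ₀ => ?_⟩
  obtain ⟨O, L₁, Q₁, L₂, Q₂, hO, hL₁, hQ₁, hL₂, hQ₂, he⟩ := h p hp E hE ρ hρ hρ₀
  refine ⟨O, L₁, Q₁, fun _ => L₂, fun _ _ _ => Q₂, hO, hL₁, hQ₁, fun _ => hL₂, fun _ _ _ => hQ₂,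
    fun w Θ z hw hΘ hwδ hwΛ i j => ?_⟩
  rw [he w Θ z hw hΘ hwδ hwΛ i j, SmallSpheres.leadingPart, Fin.sum_univ_one]
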